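/- **Setting.** Let $m\ge 1$, $(x_i,y_i)_{i=1}^m\subset\mathbb R^d\times\{\pm1\}$, and let $f(x;\theta)$ be a model with parameters $\theta=(W_1,\dots,W_K,u)\in\mathbb R^p$, a collection of real matrices $W_k$ and a vector $u$. Let $\mathcal L(\theta)=\sum_{i=1}^m e^{-\varphi(y_if(x_i;\theta))}$, where $\varphi\in C^2(\mathbb R)$ has bounded $\varphi'>0$ and bounded $\varphi''\ge0$. Write $\partial F(\theta)$ for the Clarke subdifferential: the convex hull of all limits of $\nabla F(\theta_n)$ with $\theta_n\to\theta$ and $F$ differentiable at $\theta_n$. Fix $\eta_0^M,\eta_0^A>0$ and put $$\|\theta\|=\max\Big\{\tfrac{\eta_0^A}{\eta_0^M}\max_{k}\|W_k\|_{\mathrm{sp}},\ \|u\|_\infty\Big\},\qquad \gamma(\theta)=\min_{i} y_if\big(x_i;\theta/\|\theta\|\big).$$ **Dynamics.** Let $\theta_t$, $t\ge0$, be absolutely continuous on compact intervals and $g_t\in\partial\mathcal L(\theta_t)$ a measurable choice of subgradients, with components $G_k(t)$ (for $W_k$) and $g^u_t$ (for $u$). For $c>0$ let $A(h,c)(t)=\int_0^t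 c\,e^{-c(t-s)}h(s)\,ds$. Let $c_M>0$, $c_1\ge c_2>0$, and suppose that for almost every $t>0$: * (Muon) for each $k$, $\frac{dW_k}{dt}=-\eta_0^M\eta(t)\,U_kV_k^\top$ for a reduced SVD $A(G_k,c_M)(t)=U_k\Sigma_kV_k^\top$; * (Adam) for each coordinate $j$ of $u$, $\frac{du[j]}{dt}=-\eta_0^A\eta(t)\,\dfrac{(1-e^{-c_1t})^{-1}A(g^u[j],c_1)(t)}{\sqrt{(1-e^{-c_2t})^{-1}A(g^u[j]^2,c_2)(t)}}$. **Assumptions.** 1. For some real $L\ge1$, $f(x;\alpha\theta)=\alpha^Lf(x;\theta)$ for all $x\in\mathbb R^d$, $\theta\in\mathbb R^p$, $\alpha>0$. 2. Either (a) $f(x;\cdot)\in C^1(\mathbb R^p)$ for every $x$; or (b) for every $x$, $f(x;\cdot)$ is locally Lipschitz and Whitney $C^1$-stratifiable (its graph is partitioned into finitely many nonempty $C^1$ submanifolds satisfying the frontier condition and Whitney's condition (a)), and there are $h_i(t)\in\partial f(x_i;\theta_t)$ such that, with $z_i^t=y_if(x_i;\theta_t)$, $g_t=-\sum_i e^{-\varphi(z_i^t)}\varphi'(z_i^t)\,y_i\,h_i(t)$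 for all $t\ge0$ and $h_i(t)/\|\theta_t\|^{L-1}$ converges as $t\to\infty$ for each $i$. 3. $\eta:[0,\infty)\to(0,\infty)$ is non-increasing, $\int_0^\infty\eta=\infty$ and $\eta(t)=o(t^{1/L-1})$ as $t\to\infty$. 4. There are $N_{\min}>0$ and $t_0\ge0$ with $\|\theta_t\|\ge N_{\min}$ for all $t\ge t_0$. 5. $\theta_t/\|\theta_t\|$ converges as $t\to\infty$ to some $\bar\theta$ with $\gamma(\bar\theta)>0$. 6. There are $\tau,\rho>0$ such that for every coordinate $j\in\{1,\dots,p\}$, $g_t[j]^2>\rho$ for almost every $t\in[0,\tau]$. **Conclusion.** $\bar\theta$ is the direction of a KKT point of $$\min_{\theta\in\mathbb R^p}\ \tfrac12\|\theta\|^2\quad\text{s.t.}\quad y_if(x_i;\theta)\ge1\ \text{ for all } i,$$ i.e. there is $\theta^*\ne0$ with $\theta^*/\|\theta^*\|=\bar\theta$ and $y_if(x_i;\theta^*)\ge1$ for all $i$, for which there exist $k\in\partial\big(\tfrac12\|\cdot\|^2\big)(\theta^*)$, $\lambda_1,\dots,\lambda_m\ge0$ and $h_i\in\partial f(x_i;\theta^*)$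 with $\sum_i\lambda_iy_ih_i-k=0$ and $\sum_i\lambda_i\big(y_if(x_i;\theta^*)-1\big)=0$. -/

import Mathlib

open Filter Topology MeasureTheory
open scoped Matrix

noncomputable section

namespace MuonAdam

/-! ### Clarke subdifferential -/

section Clarke

variable {E : Type*} [NormedAddCommGroup E] [InnerProductSpace ℝ E] [CompleteSpace E]

/-- Clarke subdifferential of `F` at `x`: the convex hull of all limits of gradients of `F` along
sequences of points of differentiability that converge to `x`. -/
def clarkeSubdifferential (F : E → ℝ) (x : E) : Set E :=
  convexHull ℝ {g | ∃ s : ℕ → E, Tendsto s atTop (𝓝 x) ∧ (∀ n, DifferentiableAt ℝ F (s n)) ∧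
    Tendsto (fun n => gradient F (s n)) atTop (𝓝 g)}

end Clarke

/-! ### Whitney `C¹`-stratifiable functions -/

section Whitney

variable {H : Type*} [NormedAddCommGroup H] [InnerProductSpace ℝ H]

/-- `M` is an (embedded) `C¹` submanifold: for some codimension `r`, near each of its points `M` is
the zero set of a `C¹` map into `ℝ^r` whose derivative at the point is onto. -/
def IsC1Submanifold (M : Set H) : Prop :=
  ∃ r : ℕ, ∀ x ∈ M, ∃ U : Set H, IsOpen U ∧ x ∈ U ∧ ∃ F : H → EuclideanSpace ℝ (Fin r),
    ContDiffOn ℝ 1 F U ∧ Function.Surjective (fderiv ℝ F x) ∧ M ∩ U = {z ∈ U | F z = 0}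

/-- Normal space of `M` at `x`: the vectors orthogonal to all tangent vectors. (The tangent cone of
a `C¹` submanifold at one of its points is its tangent space, the kernel of the derivative of a
local defining map.) -/
def normalSpace (M : Set H) (x : H) : Set H :=
  {ν | ∀ w ∈ tangentConeAt ℝ M x, inner ℝ ν w = 0}

/-- `S` is a Whitney `C¹`-stratification of `Q`: a partition of `Q` into finitely many nonempty
`C¹` submanifolds with the frontier condition and Whitney's condition (a). -/
structure IsWhitneyC1Stratification {n : ℕ} (S : Fin n → Set H) (Q : Set H) : Prop where
  nonempty : ∀ i, (S i).Nonempty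
  submanifold : ∀ i, IsC1Submanifold (S i)
  disjoint : ∀ i j, i ≠ j → Disjoint (S i) (S j)
  cover : ⋃ i, S i = Q
  frontier_condition : ∀ i j, (S i ∩ closure (S j)).Nonempty → S i ⊆ closure (S j)
  whitney_a : ∀ i j, ∀ (z ν : ℕ → H) (z' ν' : H),
    (∀ k, z k ∈ S i) → z' ∈ S j → Tendsto z atTop (𝓝 z') →
    (∀ k, ν k ∈ normalSpace (S i) (z k)) → Tendsto ν atTop (𝓝 ν') → ν' ∈ normalSpace (S j) z'

/-- `F` is Whitney `C¹`-stratifiable: its graph, a subset of the Euclidean product `H × ℝ`, admits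
a Whitney `C¹`-stratification. -/
def IsWhitneyC1Stratifiable (F : H → ℝ) : Prop :=
  ∃ (n : ℕ) (S : Fin n → Set (WithLp 2 (H × ℝ))),
    IsWhitneyC1Stratification S (Set.range fun θ : H => WithLp.toLp 2 (θ, F θ))

end Whitney

/-! ### Parameters and norms -/

/-- Coordinates of `(W₁, …, W_K, u)`, where `W k` is a `rows k × cols k` matrix and `u ∈ ℝ^q`. -/
abbrev ParamIndex {K : ℕ} (rows cols : Fin K → ℕ) (q : ℕ) : Type :=
  (Σ k : Fin K, Fin (rows k) × Fin (cols k)) ⊕ Fin q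

/-- The parameter space `ℝ^p` with its standard inner product. -/
abbrev Param {K : ℕ} (rows cols : Fin K → ℕ) (q : ℕ) : Type :=
  EuclideanSpace ℝ (ParamIndex rows cols q)

section Params

variable {K : ℕ} {rows cols : Fin K → ℕ} {q : ℕ}

/-- The matrix `W k` of a parameter vector. -/
def matPart (θ : Param rows cols q) (k : Fin K) : Matrix (Fin (rows k)) (Fin (cols k)) ℝ :=
  Matrix.of fun i j => θ (Sum.inl ⟨k, (i, j)⟩)

/-- The remaining parameters `u` of a parameter vector. -/
def vecPart (θ : Param rows cols q) : Fin q → ℝ :=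
  fun j => θ (Sum.inr j)

open scoped Matrix.Norms.L2Operator in
/-- Spectral norm of a matrix: its operator norm between Euclidean spaces. -/
def spNorm {a b : ℕ} (W : Matrix (Fin a) (Fin b) ℝ) : ℝ := ‖W‖

/-- `max {α * max_k ‖W k‖_sp, ‖u‖_∞}`. (The norm of `Fin q → ℝ` is the sup norm; the maximum over
an empty family of matrices is `0`.) -/
def hybridNorm (α : ℝ) (θ : Param rows cols q) : ℝ :=
  max (α * ⨆ k, spNorm (matPart θ k)) ‖vecPart θ‖

end Params

/-! ### Loss, margin, KKT points -/

/-- Conditions on `φ` for the per-sample loss `ℓ(u) = exp (-φ u)`. -/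
structure IsLossExponent (φ : ℝ → ℝ) : Prop where
  contDiff : ContDiff ℝ 2 φ
  deriv_bounds : ∃ B : ℝ, ∀ u, 0 < deriv φ u ∧ deriv φ u ≤ B
  deriv2_bounds : ∃ B : ℝ, ∀ u, 0 ≤ deriv (deriv φ) u ∧ deriv (deriv φ) u ≤ B

section Problem

variable {X E : Type*} [NormedAddCommGroup E] [InnerProductSpace ℝ E] {m : ℕ}

/-- Training loss `∑ᵢ exp (-φ (yᵢ f(xᵢ; θ)))`. -/
def trainLoss (φ : ℝ → ℝ) (f : X → E → ℝ) (x : Fin m → X) (y : Fin m → ℝ) (θ : E) : ℝ :=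
  ∑ i, Real.exp (-φ (y i * f (x i) θ))

/-- Margin `minᵢ yᵢ f(xᵢ; θ / N θ)` with respect to the norm `N`. -/
def margin (N : E → ℝ) (f : X → E → ℝ) (x : Fin m → X) (y : Fin m → ℝ) (θ : E) : ℝ :=
  ⨅ i, y i * f (x i) ((N θ)⁻¹ • θ)

/-- `θ` is a KKT point of `min ½ (N θ)²` subject to `yᵢ f(xᵢ; θ) ≥ 1` for all `i`. -/
def IsKKTPoint [CompleteSpace E] (N : E → ℝ) (f : X → E → ℝ) (x : Fin m → X) (y : Fin m → ℝ)
    (θ : E) : Prop :=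
  (∀ i, 1 ≤ y i * f (x i) θ) ∧
  ∃ k ∈ clarkeSubdifferential (fun ϑ => 1 / 2 * N ϑ ^ 2) θ,
  ∃ lam : Fin m → ℝ, (∀ i, 0 ≤ lam i) ∧
  ∃ h : Fin m → E, (∀ i, h i ∈ clarkeSubdifferential (f (x i)) θ) ∧
    (∑ i, (lam i * y i) • h i) - k = 0 ∧
    ∑ i, lam i * (y i * f (x i) θ - 1) = 0

/-- The subgradients `g t` of the loss along `θ` decompose through subgradients `h i t` of the
model for which `h i t / (N (θ t))^(L-1)` converges as `t → ∞`. -/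
def ModelSubgradientsConverge [CompleteSpace E] (N : E → ℝ) (L : ℝ) (φ : ℝ → ℝ) (f : X → E → ℝ)
    (x : Fin m → X) (y : Fin m → ℝ) (θ g : ℝ → E) : Prop :=
  ∃ h : Fin m → ℝ → E,
    (∀ i, ∀ t, 0 ≤ t → h i t ∈ clarkeSubdifferential (f (x i)) (θ t)) ∧
    (∀ t, 0 ≤ t → g t = -∑ i, (Real.exp (-φ (y i * f (x i) (θ t))) *
      deriv φ (y i * f (x i) (θ t)) * y i) • h i t) ∧
    ∀ i, ∃ l : E, Tendsto (fun t => (N (θ t) ^ (L - 1))⁻¹ • h i t) atTop (𝓝 l)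

end Problem

/-! ### Learning rate and dynamics -/

/-- Positive non-increasing schedule on `[0, ∞)` with divergent integral and
`η(t) = o(t^(1/L - 1))` as `t → ∞`. -/
structure IsAdamSchedule (L : ℝ) (η : ℝ → ℝ) : Prop where
  pos : ∀ t, 0 ≤ t → 0 < η t
  antitone : AntitoneOn η (Set.Ici 0)
  integral_diverges : Tendsto (fun T => ∫ t in (0 : ℝ)..T, η t) atTop atTop
  decay : η =o[atTop] fun t : ℝ => t ^ (1 / L - 1)

/-- Momentum estimate: the solution `∫₀ᵗ c e^{-c(t-s)} g(s) ds` of `m' = c (g - m)`, `m 0 = 0`. -/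
def ema (c : ℝ) (g : ℝ → ℝ) (t : ℝ) : ℝ :=
  ∫ s in (0 : ℝ)..t, c * Real.exp (-c * (t - s)) * g s

/-- `θ` is an arc on `[0, ∞)` (absolutely continuous on compact intervals) with a.e. derivative
`v`. -/
def IsArc {E : Type*} [NormedAddCommGroup E] [NormedSpace ℝ E] (θ v : ℝ → E) : Prop :=
  LocallyIntegrableOn v (Set.Ici 0) ∧ ∀ t, 0 ≤ t → θ t = θ 0 + ∫ s in (0 : ℝ)..t, v s

/-- `P = U Vᵀ` for a reduced singular value decomposition `M = U Σ Vᵀ`: `U`, `V` have orthonormal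
columns and `Σ` is a square diagonal matrix with positive diagonal (of size `0` if `M = 0`). -/
def IsOrthogonalization {a b : ℕ} (M P : Matrix (Fin a) (Fin b) ℝ) : Prop :=
  ∃ (r : ℕ) (U : Matrix (Fin a) (Fin r) ℝ) (V : Matrix (Fin b) (Fin r) ℝ) (σ : Fin r → ℝ),
    Uᵀ * U = 1 ∧ Vᵀ * V = 1 ∧ (∀ i, 0 < σ i) ∧ M = U * Matrix.diagonal σ * Vᵀ ∧ P = U * Vᵀ

/-- The Adam ratio `m̂ / √v̂` at time `t` of a scalar gradient signal `g`, with bias correction. -/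
def adamRatio (c₁ c₂ : ℝ) (g : ℝ → ℝ) (t : ℝ) : ℝ :=
  ((1 - Real.exp (-c₁ * t))⁻¹ * ema c₁ g t) /
    Real.sqrt ((1 - Real.exp (-c₂ * t))⁻¹ * ema c₂ (fun s => g s ^ 2) t)

/-- `θ` is a trajectory of Muon on the matrices `W₁, …, W_K` (learning rate `ηM * η t`, momentum
parameter `cM`) and of Adam on `u` (learning rate `ηA * η t`, momentum parameters `c₁, c₂`) on the
objective `F`, driven by the measurable choice `g t ∈ ∂F(θ t)` of subgradients. -/
structure IsMuonAdamTrajectory {K : ℕ} {rows cols : Fin K → ℕ} {q : ℕ}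
    (F : Param rows cols q → ℝ) (ηM ηA cM c₁ c₂ : ℝ) (η : ℝ → ℝ)
    (θ g : ℝ → Param rows cols q) : Prop where
  subgradient : ∀ t, 0 ≤ t → g t ∈ clarkeSubdifferential F (θ t)
  measurable : AEStronglyMeasurable g (volume.restrict (Set.Ici 0))
  flow : ∃ v : ℝ → Param rows cols q, IsArc θ v ∧
    ∀ᵐ t ∂(volume.restrict (Set.Ioi (0 : ℝ))),
      (∀ k, ∃ P : Matrix (Fin (rows k)) (Fin (cols k)) ℝ,
        IsOrthogonalization
          (Matrix.of fun i j => ema cM (fun s => matPart (g s) k i j) t) P ∧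
        matPart (v t) k = -(ηM * η t) • P) ∧
      ∀ j, vecPart (v t) j = -(ηA * η t) * adamRatio c₁ c₂ (fun s => vecPart (g s) j) t

end MuonAdam

end

open MuonAdam

namespace MuonAdam

/-! ### Clarke subdifferentials in finite dimension. -/

section ClarkeTheory

variable {E : Type*} [NormedAddCommGroup E] [InnerProductSpace ℝ E]

/-! Write N for the hybrid norm of `θ t`, z_i for the signed outputs, b_i = e^{-φ(z_i)} φ'(z_i)
N^{L-1} for the scaled weights, B for their sum, and l_i for the limit of h_i / N^{L-1}. By
homogeneity the loss gradient is -p + o(B) with p = ∑ b_i y_i l_i. The proof shows that Muon-Adam is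
asymptotically steepest descent for the hybrid norm, and that a steepest descent whose direction
converges cannot keep a dual norm of p / B strictly above L γ, the value that stationarity requires.

Two facts make it steepest descent. First, N = O(t^{1/L}) and η = o(t^{1/L-1}) give N^{L-1} η → 0
(`tendsto_rpow_norm_mul`), so the outputs move at vanishing speed and log b_i has vanishing slope.
Moving averages with fixed time constants therefore track their signals: the first moments are -p +
o(B), the second moments p² + o(B²) coordinatewise (`tendsto_ema_sub_div`). Orthogonalization and
the Adam ratio then nearly attain the dual norm (`exists_alignment`). Second, N ≤ (1 + ε) ηA ∫ η +
C. For Muon this is immediate; an Adam ratio may be as large as √(c₁/c₂) at single times, but its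
excess over 1 has a time integral bounded above, by a logarithmic potential
(`exists_integral_ratio_sub_one_le`).

Let G be the negative log-loss and β the limit of φ'. Steepest descent bounds G' below by about β
N^{L-1} ηA η times the dual norm of p / B, and Euler's identity puts that dual norm at L γ or more,
so G → ∞. Moreover G is at most about β γ N^L. If the dual norm stayed above L γ + ε, then (G / (β
γ))^{1/L} would grow faster than ηA ∫ η by a fixed factor, although it is at most about N, hence
about ηA ∫ η. This is a contradiction (`frequently_inner_limitGradient_le`).

So along some times tending to infinity the dual norm of p / B tends to at most L γ. The weights b_i
/ B lie in a simplex and have a limit point μ, which is supported on the samples that attain the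
margin because the other weights are exponentially smaller (`exists_multipliers`). Then ∑ μ_i y_i
l_i has dual norm at most L γ and pairs with the limit direction to exactly L γ, so up to scale it
is a subgradient of the norm there; rescaling to margin 1 gives the KKT point
(`exists_isKKTPoint_of_multipliers`). For non-smooth models the derivative of each output along the
curve comes from the stratification (`ae_hasDerivAt_of_isWhitneyC1Stratifiable`). -/

theorem isCompact_convexHull_of_finiteDimensional [FiniteDimensional ℝ E] {S : Set E}
    (hS : IsCompact S) : IsCompact (convexHull ℝ S) := by
  classical
  rcases S.eq_empty_or_nonempty with rfl | ⟨z₀, hz₀⟩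
  · simp
  -- Carathéodory: dim + 1 points suffice for every convex combination, so the hull is the
  -- continuous image of the compact product of a simplex and dim + 1 copies of `S`.
  set n := Module.finrank ℝ E + 1 with hn
  have hK : IsCompact ((stdSimplex ℝ (Fin n)) ×ˢ (Set.univ.pi fun _ : Fin n => S)) :=
    (isCompact_stdSimplex ℝ (Fin n)).prod (isCompact_univ_pi fun _ => hS)
  have hcont : Continuous fun q : (Fin n → ℝ) × (Fin n → E) => ∑ i, q.1 i • q.2 i := by
    fun_prop
  convert! hK.image hcont using 1
  apply Set.Subset.antisymm
  · intro x hx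
    obtain ⟨ι, _, z, w, hz, hind, hw, hw1, rfl⟩ := eq_pos_convex_span_of_mem_convexHull hx
    have hcard : Fintype.card ι ≤ Fintype.card (Fin n) := by
      rw [Fintype.card_fin, hn]
      exact hind.card_le_finrank_succ.trans
        (Nat.succ_le_succ (Submodule.finrank_le _))
    obtain ⟨e⟩ := Function.Embedding.nonempty_of_card_le hcard
    have hext : ∀ (F : Fin n → E), (∀ i, i ∉ Set.range e → F i = 0) →
        ∑ i, F i = ∑ k, F (e k) := fun F hF => by
      rw [← Finset.sum_map Finset.univ e]
      refine (Finset.sum_subset (Finset.subset_univ _) fun i _ hi => hF i ?_).symm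
      simpa using hi
    have hext' : ∀ (F : Fin n → ℝ), (∀ i, i ∉ Set.range e → F i = 0) →
        ∑ i, F i = ∑ k, F (e k) := fun F hF => by
      rw [← Finset.sum_map Finset.univ e]
      refine (Finset.sum_subset (Finset.subset_univ _) fun i _ hi => hF i ?_).symm
      simpa using hi
    have hoff : ∀ i, i ∉ Set.range e → Function.extend e w 0 i = 0 := fun i hi =>
      Function.extend_apply' _ _ _ (by simpa using hi)
    -- Unused slots receive weight 0 and the arbitrary point `z₀` of `S`.
    refine ⟨(Function.extend e w 0, Function.extend e z fun _ => z₀), ⟨⟨fun i => ?_, ?_⟩, ?_⟩, ?_⟩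
    · by_cases hi : i ∈ Set.range e
      · obtain ⟨k, rfl⟩ := hi
        simpa [e.injective.extend_apply] using (hw k).le
      · simp [hoff i hi]
    · rw [hext' _ hoff]
      simpa [e.injective.extend_apply] using hw1
    · intro i _
      by_cases hi : i ∈ Set.range e
      · obtain ⟨k, rfl⟩ := hi
        simpa [e.injective.extend_apply] using hz ⟨k, rfl⟩
      · simpa [Function.extend_apply' _ _ _ (show ¬ ∃ a, e a = i by simpa using hi)] using hz₀
    · change ∑ i, Function.extend e w 0 i • Function.extend e z (fun _ => z₀) i = _
      rw [hext _ fun i hi => by rw [hoff i hi, zero_smul]]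
      simp [e.injective.extend_apply]
  · rintro _ ⟨⟨w, z⟩, ⟨⟨hw0, hw1⟩, hz⟩, rfl⟩
    exact (convex_convexHull ℝ S).sum_mem (fun i _ => hw0 i) hw1
      fun i _ => subset_convexHull ℝ S (hz i (Set.mem_univ i))

/-- Limits of gradients of `F` along sequences of points of differentiability tending to `x`. -/
def limitingGradients [CompleteSpace E] (F : E → ℝ) (x : E) : Set E :=
  {g | ∃ s : ℕ → E, Tendsto s atTop (𝓝 x) ∧ (∀ n, DifferentiableAt ℝ F (s n)) ∧
    Tendsto (fun n => gradient F (s n)) atTop (𝓝 g)}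

theorem clarkeSubdifferential_eq [CompleteSpace E] (F : E → ℝ) (x : E) :
    clarkeSubdifferential F x = convexHull ℝ (limitingGradients F x) := rfl

variable [FiniteDimensional ℝ E]

theorem mem_limitingGradients_iff {F : E → ℝ} {x g : E} : g ∈ limitingGradients F x ↔
    ∀ ε > 0, ∃ y, dist y x < ε ∧ DifferentiableAt ℝ F y ∧ dist (gradient F y) g < ε := by
  constructor
  · rintro ⟨s, hs, hd, hg⟩ ε hε
    obtain ⟨n, h1, h2⟩ := ((Metric.tendsto_nhds.1 hs ε hε).and (Metric.tendsto_nhds.1 hg ε hε)).exists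
    exact ⟨s n, h1, hd n, h2⟩
  · intro h
    choose s hs hd hg using fun n : ℕ => h (1 / ((n : ℝ) + 1)) Nat.one_div_pos_of_nat
    refine ⟨s, ?_, hd, ?_⟩
    · exact tendsto_iff_dist_tendsto_zero.2 (squeeze_zero (fun _ => dist_nonneg)
        (fun n => (hs n).le) tendsto_one_div_add_atTop_nhds_zero_nat)
    · exact tendsto_iff_dist_tendsto_zero.2 (squeeze_zero (fun _ => dist_nonneg)
        (fun n => (hg n).le) tendsto_one_div_add_atTop_nhds_zero_nat)

theorem isClosed_limitingGradients (F : E → ℝ) (x : E) : IsClosed (limitingGradients F x) := by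
  refine isClosed_of_closure_subset fun g hg => mem_limitingGradients_iff.2 fun ε hε => ?_
  obtain ⟨g', hg', hd⟩ := Metric.mem_closure_iff.1 hg (ε / 2) (half_pos hε)
  obtain ⟨y, h1, h2, h3⟩ := mem_limitingGradients_iff.1 hg' (ε / 2) (half_pos hε)
  refine ⟨y, h1.trans (half_lt_self hε), h2, ?_⟩
  rw [dist_comm] at hd
  linarith [dist_triangle (gradient F y) g' g]

theorem norm_gradient_le_of_lipschitzOn {F : E → ℝ} {K : NNReal} {s : Set E}
    (hF : LipschitzOnWith K F s) {y : E} (hy : s ∈ 𝓝 y) : ‖gradient F y‖ ≤ K := by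
  have := norm_fderiv_le_of_lipschitzOn ℝ hy hF
  rwa [gradient, LinearIsometryEquiv.norm_map]

theorem norm_le_of_mem_clarkeSubdifferential {F : E → ℝ} {K : NNReal} {s : Set E}
    (hF : LipschitzOnWith K F s) {x h : E} (hx : s ∈ 𝓝 x) (hh : h ∈ clarkeSubdifferential F x) :
    ‖h‖ ≤ K := by
  have : convexHull ℝ (limitingGradients F x) ⊆ Metric.closedBall 0 K := by
    refine convexHull_min ?_ (convex_closedBall _ _)
    rintro g ⟨u, hu, hd, hg⟩
    rw [mem_closedBall_zero_iff]
    refine le_of_tendsto hg.norm ?_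
    filter_upwards [hu.eventually (eventually_mem_nhds_iff.2 hx)] with n hn
    exact norm_gradient_le_of_lipschitzOn hF hn
  simpa using this hh

theorem isCompact_clarkeSubdifferential {F : E → ℝ} {K : NNReal} {s : Set E}
    (hF : LipschitzOnWith K F s) {x : E} (hx : s ∈ 𝓝 x) :
    IsCompact (clarkeSubdifferential F x) := by
  refine isCompact_convexHull_of_finiteDimensional
    (Metric.isCompact_of_isClosed_isBounded (isClosed_limitingGradients F x) ?_)
  refine (Metric.isBounded_closedBall (x := (0 : E)) (r := K)).subset fun g hg => ?_
  simpa using norm_le_of_mem_clarkeSubdifferential hF hx (subset_convexHull ℝ _ hg)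

/-- A vector all of whose pairings are approximately dominated by nearby gradients belongs to the
Clarke subdifferential. -/
theorem mem_clarkeSubdifferential_of_forall_inner {F : E → ℝ} {K : NNReal} {s : Set E}
    (hF : LipschitzOnWith K F s) {x c : E} (hx : s ∈ 𝓝 x)
    (h : ∀ d : E, ∀ ε > 0, ∃ y, dist y x < ε ∧ DifferentiableAt ℝ F y ∧
      inner ℝ c d - ε ≤ inner ℝ (gradient F y) d) : c ∈ clarkeSubdifferential F x := by
  by_contra hc
  -- Were `c` outside, some direction `d` would separate it strictly from the subdifferential. The
  -- gradients supplied for this `d` are bounded, so they accumulate at a limiting gradient whose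
  -- pairing with `d` is at least that of `c`.
  obtain ⟨l, u, hlu, hu⟩ := geometric_hahn_banach_closed_point (convex_convexHull ℝ _)
    (isCompact_clarkeSubdifferential hF hx).isClosed hc
  set d := (InnerProductSpace.toDual ℝ E).symm l with hd
  have hl : ∀ w, l w = inner ℝ w d := fun w => by
    rw [real_inner_comm, hd, InnerProductSpace.toDual_symm_apply]
  choose y hy hyd hyi using fun n : ℕ => h d (1 / ((n : ℝ) + 1)) Nat.one_div_pos_of_nat
  have hyx : Tendsto y atTop (𝓝 x) :=
    tendsto_iff_dist_tendsto_zero.2 (squeeze_zero (fun _ => dist_nonneg)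
        (fun n => (hy n).le) tendsto_one_div_add_atTop_nhds_zero_nat)
  have hb : ∀ᶠ n in atTop, gradient F (y n) ∈ Metric.closedBall (0 : E) K := by
    filter_upwards [hyx.eventually (eventually_mem_nhds_iff.2 hx)] with n hn
    simpa using norm_gradient_le_of_lipschitzOn hF hn
  obtain ⟨g, -, ψ, hψ, hg⟩ := (isCompact_closedBall (0 : E) (K : ℝ)).tendsto_subseq'
    hb.frequently
  have hgm : g ∈ clarkeSubdifferential F x :=
    subset_convexHull ℝ _ ⟨y ∘ ψ, hyx.comp hψ.tendsto_atTop, fun n => hyd _, hg⟩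
  have h1 := hlu g hgm
  have h2 : inner ℝ c d ≤ inner ℝ g d := by
    have e1 : Tendsto (fun n => inner ℝ c d - 1 / (((ψ n : ℕ) : ℝ) + 1)) atTop (𝓝 (inner ℝ c d - 0)) :=
      (tendsto_one_div_add_atTop_nhds_zero_nat.comp hψ.tendsto_atTop).const_sub _
    rw [sub_zero] at e1
    exact le_of_tendsto_of_tendsto' e1 (hg.inner tendsto_const_nhds) fun n => hyi (ψ n)
  rw [hl] at h1 hu
  linarith

/-- Otherwise the convex hull would lie in the open half-space where the pairing with `d` is below
that of `h`, and so would `h`. -/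
theorem exists_limitingGradient_le_inner {F : E → ℝ} {x h : E}
    (hh : h ∈ clarkeSubdifferential F x) (d : E) :
    ∃ g ∈ limitingGradients F x, inner ℝ h d ≤ inner ℝ g d := by
  by_contra! hcon
  have : convexHull ℝ (limitingGradients F x) ⊆ {g | inner ℝ g d < inner ℝ h d} := by
    refine convexHull_min (fun g hg => hcon g hg) ?_
    have := convex_halfSpace_lt (𝕜 := ℝ) (f := fun g : E => inner ℝ g d)
      ⟨fun a b => inner_add_left a b d, fun a b => by simp [inner_smul_left]⟩ (inner ℝ h d)
    exact this
  have hlt : inner ℝ h d < inner ℝ h d := this hh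
  exact lt_irrefl _ hlt

/-- The subdifferential has closed graph. In each direction `h n` is dominated by a limiting
gradient at `y n`, which is approximated by a true gradient at a point still close to `x`; the dual
test for membership then applies. -/
theorem mem_clarkeSubdifferential_of_tendsto {F : E → ℝ} (hF : LocallyLipschitz F) {α : Type*}
    {l : Filter α} [l.NeBot] {y h : α → E} {x c : E} (hy : Tendsto y l (𝓝 x))
    (hh : ∀ᶠ n in l, h n ∈ clarkeSubdifferential F (y n)) (hc : Tendsto h l (𝓝 c)) :
    c ∈ clarkeSubdifferential F x := by
  obtain ⟨K, s, hs, hK⟩ := hF x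
  refine mem_clarkeSubdifferential_of_forall_inner hK hs fun d ε hε => ?_
  have e1 : ∀ᶠ n in l, inner ℝ c d - ε / 2 < inner ℝ (h n) d :=
    (hc.inner tendsto_const_nhds).eventually (lt_mem_nhds (by linarith))
  obtain ⟨n, ⟨h1, h2⟩, h3⟩ :=
    ((hh.and e1).and (Metric.tendsto_nhds.1 hy (ε / 2) (half_pos hε))).exists
  obtain ⟨g, ⟨u, hu, hud, hug⟩, hgd⟩ := exists_limitingGradient_le_inner h1 d
  have e2 : ∀ᶠ k in atTop, inner ℝ g d - ε / 2 < inner ℝ (gradient F (u k)) d :=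
    (hug.inner tendsto_const_nhds).eventually (lt_mem_nhds (by linarith))
  obtain ⟨k, hk1, hk2⟩ := (e2.and (Metric.tendsto_nhds.1 hu (ε / 2) (half_pos hε))).exists
  exact ⟨u k, by linarith [dist_triangle (u k) (y n) x], hud k, by linarith⟩

theorem clarkeSubdifferential_of_contDiff {F : E → ℝ} (hF : ContDiff ℝ 1 F) (x : E) :
    clarkeSubdifferential F x = {gradient F x} := by
  have hcont : Continuous (gradient F) :=
    (InnerProductSpace.toDual ℝ E).symm.continuous.comp (hF.continuous_fderiv one_ne_zero)
  have : limitingGradients F x = {gradient F x} := by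
    refine Set.eq_singleton_iff_unique_mem.2 ⟨⟨fun _ => x, tendsto_const_nhds,
      fun _ => hF.differentiable one_ne_zero _, tendsto_const_nhds⟩, ?_⟩
    rintro g ⟨s, hs, -, hg⟩
    exact tendsto_nhds_unique hg ((hcont.tendsto x).comp hs)
  rw [clarkeSubdifferential_eq, this, convexHull_singleton]

theorem exists_norm_bound_clarkeSubdifferential {F : E → ℝ} (hF : LocallyLipschitz F) {Q : Set E}
    (hQ : IsCompact Q) : ∃ C, ∀ x ∈ Q, ∀ h ∈ clarkeSubdifferential F x, ‖h‖ ≤ C := by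
  refine hQ.induction_on (p := fun s => ∃ C, ∀ x ∈ s, ∀ h ∈ clarkeSubdifferential F x, ‖h‖ ≤ C)
    ⟨0, by simp⟩ ?_ ?_ ?_
  · rintro s t hst ⟨C, hC⟩
    exact ⟨C, fun x hx => hC x (hst hx)⟩
  · rintro s t ⟨C, hC⟩ ⟨D, hD⟩
    refine ⟨max C D, fun x hx h hh => ?_⟩
    rcases hx with hx | hx
    · exact (hC x hx h hh).trans (le_max_left _ _)
    · exact (hD x hx h hh).trans (le_max_right _ _)
  · intro x _
    obtain ⟨K, s, hs, hK⟩ := hF x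
    refine ⟨interior s, mem_nhdsWithin_of_mem_nhds (interior_mem_nhds.2 hs), K,
      fun y hy h hh => norm_le_of_mem_clarkeSubdifferential hK (mem_interior_iff_mem_nhds.1 hy) hh⟩

/-! ### Gradients of positively homogeneous functions. -/

section Homogeneous

variable {F : E → ℝ} {L : ℝ}

theorem gradient_smul_of_homogeneous (hhom : ∀ (x : E) (α : ℝ), 0 < α → F (α • x) = α ^ L * F x)
    {x : E} (hx : DifferentiableAt ℝ F x) {α : ℝ} (hα : 0 < α) :
    HasGradientAt F (α ^ (L - 1) • gradient F x) (α • x) := by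
  have hF : F = fun z => α ^ L * F (α⁻¹ • z) := by
    funext z
    rw [hhom _ _ (inv_pos.2 hα), ← mul_assoc, ← Real.mul_rpow hα.le (inv_nonneg.2 hα.le),
      mul_inv_cancel₀ hα.ne', Real.one_rpow, one_mul]
  have hx' : HasFDerivAt F (fderiv ℝ F x) (α⁻¹ • α • x) := by
    rw [inv_smul_smul₀ hα.ne']
    exact hx.hasFDerivAt
  have h1 : HasFDerivAt (fun z : E => α⁻¹ • z) (α⁻¹ • ContinuousLinearMap.id ℝ E) (α • x) :=
    (hasFDerivAt_id (α • x)).const_smul α⁻¹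
  have h2 := (hx'.comp (α • x) h1).const_mul (α ^ L)
  rw [hasGradientAt_iff_hasFDerivAt]
  have h3 : HasFDerivAt F (α ^ L • (fderiv ℝ F x).comp (α⁻¹ • ContinuousLinearMap.id ℝ E)) (α • x) :=
    h2.congr_of_eventuallyEq (Eventually.of_forall fun z => congrFun hF z)
  convert! h3 using 1
  rw [map_smul, gradient, LinearIsometryEquiv.apply_symm_apply]
  ext w
  simp [Real.rpow_sub_one hα.ne']
  ring

open scoped Pointwise in
theorem smul_mem_clarkeSubdifferential_of_homogeneous
    (hhom : ∀ (x : E) (α : ℝ), 0 < α → F (α • x) = α ^ L * F x) {x h : E}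
    (hh : h ∈ clarkeSubdifferential F x) {α : ℝ} (hα : 0 < α) :
    α ^ (L - 1) • h ∈ clarkeSubdifferential F (α • x) := by
  have h0 : α ^ (L - 1) • h ∈ α ^ (L - 1) • convexHull ℝ (limitingGradients F x) :=
    Set.smul_mem_smul_set hh
  rw [← convexHull_smul] at h0
  refine convexHull_mono ?_ h0
  rintro _ ⟨g, ⟨s, hs, hd, hg⟩, rfl⟩
  refine ⟨fun n => α • s n, hs.const_smul α, fun n =>
    (gradient_smul_of_homogeneous hhom (hd n) hα).differentiableAt, ?_⟩
  simp_rw [fun n => (gradient_smul_of_homogeneous hhom (hd n) hα).gradient]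
  exact hg.const_smul _

/-- Euler's identity. -/
theorem inner_gradient_of_homogeneous
    (hhom : ∀ (x : E) (α : ℝ), 0 < α → F (α • x) = α ^ L * F x)
    {x : E} (hx : DifferentiableAt ℝ F x) : inner ℝ (gradient F x) x = L * F x := by
  have h1 : HasDerivAt (fun α : ℝ => α • x) x 1 := by
    simpa using (hasDerivAt_id (1 : ℝ)).smul_const x
  have hx' : HasFDerivAt F (fderiv ℝ F x) ((1 : ℝ) • x) := by
    rw [one_smul]
    exact hx.hasFDerivAt
  have h2 : HasDerivAt (fun α : ℝ => F (α • x)) (fderiv ℝ F x x) 1 :=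
    hx'.comp_hasDerivAt (1 : ℝ) h1
  have h3 : HasDerivAt (fun α : ℝ => α ^ L * F x) (L * F x) 1 := by
    simpa using (Real.hasDerivAt_rpow_const (x := 1) (p := L) (Or.inl one_ne_zero)).mul_const (F x)
  have h4 : (fun α : ℝ => F (α • x)) =ᶠ[𝓝 1] fun α => α ^ L * F x := by
    filter_upwards [lt_mem_nhds (zero_lt_one' ℝ)] with α hα using hhom x α hα
  rw [inner_gradient_left]
  exact h2.unique (h3.congr_of_eventuallyEq h4)

/-- The vectors satisfying Euler's identity at `x` form a convex set, and the identity at points of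
differentiability survives the limit by continuity of `F`. -/
theorem inner_clarkeSubdifferential_of_homogeneous (hF : Continuous F)
    (hhom : ∀ (x : E) (α : ℝ), 0 < α → F (α • x) = α ^ L * F x) {x h : E}
    (hh : h ∈ clarkeSubdifferential F x) : inner ℝ h x = L * F x := by
  have : convexHull ℝ (limitingGradients F x) ⊆ {g | inner ℝ g x = L * F x} := by
    refine convexHull_min ?_ (convex_hyperplane (𝕜 := ℝ) (f := fun g : E => inner ℝ g x)
      ⟨fun a b => inner_add_left a b x, fun a b => by simp [inner_smul_left]⟩ _)
    rintro g ⟨s, hs, hd, hg⟩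
    refine tendsto_nhds_unique (hg.inner hs) ?_
    simp_rw [fun n => inner_gradient_of_homogeneous hhom (hd n)]
    exact ((hF.tendsto x).comp hs).const_mul L
  exact this hh

end Homogeneous

/-! ### Convex functions -/

theorem inner_gradient_le_of_convexOn {F : E → ℝ} (hF : ConvexOn ℝ Set.univ F) {y : E}
    (hy : DifferentiableAt ℝ F y) (x : E) : inner ℝ (gradient F y) (x - y) ≤ F x - F y := by
  have h1 : HasDerivAt (fun s : ℝ => y + s • (x - y)) (x - y) 0 := by
    simpa using ((hasDerivAt_id (0 : ℝ)).smul_const (x - y)).const_add y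
  have hy' : HasFDerivAt F (fderiv ℝ F y) (y + (0 : ℝ) • (x - y)) := by
    simpa using hy.hasFDerivAt
  have h2 : HasDerivAt (fun s : ℝ => F (y + s • (x - y))) (fderiv ℝ F y (x - y)) 0 :=
    hy'.comp_hasDerivAt (0 : ℝ) h1
  rw [inner_gradient_left]
  refine le_of_tendsto h2.tendsto_slope_zero_right ?_
  filter_upwards [Ioo_mem_nhdsGT (zero_lt_one' ℝ)] with s hs
  have h3 := hF.2 (Set.mem_univ y) (Set.mem_univ x) (sub_nonneg.2 hs.2.le) hs.1.le (by ring)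
  have h4 : (1 - s) • y + s • x = y + s • (x - y) := by
    rw [sub_smul, smul_sub, one_smul]; abel
  rw [h4] at h3
  simp only [zero_add, zero_smul, add_zero, smul_eq_mul] at h3 ⊢
  rw [inv_mul_le_iff₀ hs.1]
  linarith

/-- Convex subgradients are Clarke subgradients. -/
theorem mem_clarkeSubdifferential_of_convexOn {F : E → ℝ} (hF : ConvexOn ℝ Set.univ F) {x c : E}
    (hc : ∀ y, F x + inner ℝ c (y - x) ≤ F y) : c ∈ clarkeSubdifferential F x := by
  obtain ⟨K, s, hs, hK⟩ := hF.locallyLipschitz x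
  refine mem_clarkeSubdifferential_of_forall_inner hK hs fun d ε hε => ?_
  obtain ⟨r, hr, hrs⟩ := Metric.mem_nhds_iff.1 hs
  -- Relative radius of the ball around `x + t • d`: deviating from `d` by at most `a` changes the
  -- pairing with `gradient F y - c`, a vector of norm at most K + ‖c‖, by at most ε.
  set a : ℝ := ε / (K + ‖c‖ + 1) with ha
  have hKc : 0 < (K : ℝ) + ‖c‖ + 1 := by positivity
  have ha0 : 0 < a := by positivity
  obtain ⟨t, ht0, ht⟩ : ∃ t : ℝ, 0 < t ∧ t * (‖d‖ + a) < min ε r := by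
    have hda : 0 < ‖d‖ + a := by positivity
    refine ⟨min ε r / 2 / (‖d‖ + a), by positivity, ?_⟩
    rw [div_mul_cancel₀ _ hda.ne']
    exact half_lt_self (by positivity)
  borelize E
  have hae := hK.ae_differentiableWithinAt_of_mem (μ := (Measure.addHaar : Measure E))
  -- By Rademacher's theorem a ball, having positive measure, contains a suitable point.
  -- Monotonicity of subgradients then gives ⟨∇F(y) - c, y - x⟩ ≥ 0, and y - x is nearly a positive
  -- multiple of `d`.
  obtain ⟨y, hyb, hy⟩ : ∃ y ∈ Metric.ball (x + t • d) (t * a), y ∈ s → DifferentiableWithinAt ℝ F s y := by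
    by_contra! hcon
    have h0 : (Measure.addHaar : Measure E) (Metric.ball (x + t • d) (t * a)) = 0 :=
      measure_mono_null (fun z hz => by
        simpa using hcon z hz) (ae_iff.1 hae)
    exact (Metric.measure_ball_pos _ _ (by positivity)).ne' h0
  have hyx : dist y x < min ε r := by
    refine lt_of_le_of_lt (dist_triangle y (x + t • d) x) ?_
    rw [dist_eq_norm (x + t • d) x, add_sub_cancel_left, norm_smul, Real.norm_of_nonneg ht0.le]
    have := Metric.mem_ball.1 hyb
    linarith
  have hys : s ∈ 𝓝 y := mem_of_superset
    (Metric.isOpen_ball.mem_nhds (Metric.mem_ball.2 (hyx.trans_le (min_le_right _ _)))) hrs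
  have hyd : DifferentiableAt ℝ F y := (hy (mem_of_mem_nhds hys)).differentiableAt hys
  refine ⟨y, hyx.trans_le (min_le_left _ _), hyd, ?_⟩
  have h1 := inner_gradient_le_of_convexOn hF hyd x
  have h2 := hc y
  have h3 : 0 ≤ inner ℝ (gradient F y - c) (y - x) := by
    rw [inner_sub_left]
    rw [← neg_sub y x, inner_neg_right] at h1
    linarith
  set e := t⁻¹ • (y - x) - d with he
  have hye : y - x = t • (d + e) := by
    rw [he, add_sub_cancel, smul_inv_smul₀ ht0.ne']
  have hen : ‖e‖ ≤ a := by
    have : t • e = y - (x + t • d) := by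
      rw [he, smul_sub, smul_inv_smul₀ ht0.ne']; abel
    have h4 : t * ‖e‖ < t * a := by
      rw [← Real.norm_of_nonneg ht0.le, ← norm_smul, this, ← dist_eq_norm,
        Real.norm_of_nonneg ht0.le]
      exact hyb
    exact (lt_of_mul_lt_mul_left h4 ht0.le).le
  rw [hye, inner_smul_right, inner_add_right] at h3
  have h5 := nonneg_of_mul_nonneg_right h3 ht0
  have h6 : inner ℝ (gradient F y - c) e ≤ ε := by
    refine (real_inner_le_norm _ _).trans ?_
    have h7 : ‖gradient F y - c‖ ≤ K + ‖c‖ + 1 := by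
      linarith [norm_sub_le (gradient F y) c, norm_gradient_le_of_lipschitzOn hK hys]
    calc _ ≤ (K + ‖c‖ + 1) * a := mul_le_mul h7 hen (norm_nonneg _) hKc.le
      _ = ε := by rw [ha]; field_simp
  rw [inner_sub_left] at h5
  linarith

/-- A functional in the dual unit ball that norms `x` gives a subgradient of the half square: N(y)²
≥ ⟨c, y⟩² ≥ 2 N(x) ⟨c, y⟩ - N(x)². The half square is convex, so a convex subgradient is enough. -/
theorem smul_mem_clarkeSubdifferential_half_sq (N : Seminorm ℝ E) {x c : E}
    (hc : ∀ d, inner ℝ c d ≤ N d) (hx : inner ℝ c x = N x) :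
    N x • c ∈ clarkeSubdifferential (fun ϑ => 1 / 2 * N ϑ ^ 2) x := by
  refine mem_clarkeSubdifferential_of_convexOn ?_ fun y => ?_
  · have := (N.convexOn.pow (fun _ _ => apply_nonneg N _) 2).smul (show (0 : ℝ) ≤ 1 / 2 by norm_num)
    exact this
  · have h1 := hc y
    have h2 := hc (-y)
    rw [inner_neg_right, map_neg_eq_map] at h2
    have h3 : inner ℝ c y ^ 2 ≤ N y ^ 2 := sq_le_sq' (by linarith) h1
    rw [inner_smul_left, inner_sub_right, hx]
    simp only [conj_trivial]
    nlinarith [sq_nonneg (inner ℝ c y - N x)]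

end ClarkeTheory

/-! ### Chain rule for stratifiable functions -/

section ChainRule

/-- Each isolated time is singled out by a member of a countable basis. Applied to the times a curve
spends in one stratum, it shows that almost every such time is an accumulation point of others, so
that the velocity is tangent to the stratum. -/
theorem countable_setOf_isolated (A : Set ℝ) :
    {t ∈ A | ¬ ∃ᶠ s in 𝓝[≠] t, s ∈ A}.Countable := by
  have h : ∀ t ∈ {t ∈ A | ¬ ∃ᶠ s in 𝓝[≠] t, s ∈ A},
      ∃ O ∈ TopologicalSpace.countableBasis ℝ, t ∈ O ∧ O ∩ A ⊆ {t} := by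
    rintro t ⟨-, ht⟩
    rw [not_frequently, eventually_nhdsWithin_iff] at ht
    obtain ⟨O, hO, htO, hOs⟩ := (TopologicalSpace.isBasis_countableBasis ℝ).mem_nhds_iff.1 ht
    refine ⟨O, hO, htO, fun s hs => ?_⟩
    by_contra hne
    exact hOs hs.1 hne hs.2
  choose! O hO htO hOA using h
  refine Set.MapsTo.countable_of_injOn (f := O) hO (fun s hs t ht hst => ?_)
    (TopologicalSpace.countable_countableBasis ℝ)
  have : s ∈ O t ∩ A := ⟨hst ▸ htO s hs, hs.1⟩
  exact hOA t ht this

variable {E : Type*} [NormedAddCommGroup E] [InnerProductSpace ℝ E]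

/-- The function (θ, s) ↦ F(θ) - s vanishes on the graph, so its derivative at the point annihilates
every tangent vector of `M`. -/
theorem toLp_gradient_mem_normalSpace [CompleteSpace E] {F : E → ℝ} {x : E}
    (hF : DifferentiableAt ℝ F x) {M : Set (WithLp 2 (E × ℝ))}
    (hM : M ⊆ Set.range fun θ : E => WithLp.toLp 2 (θ, F θ)) :
    WithLp.toLp 2 (gradient F x, (-1 : ℝ)) ∈ normalSpace M (WithLp.toLp 2 (x, F x)) := by
  intro w hw
  set z : WithLp 2 (E × ℝ) := WithLp.toLp 2 (x, F x)
  have h1 : HasFDerivAt (fun q : WithLp 2 (E × ℝ) => F (WithLp.fstL 2 ℝ E ℝ q) - WithLp.sndL 2 ℝ E ℝ q)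
      ((fderiv ℝ F x).comp (WithLp.fstL 2 ℝ E ℝ) - WithLp.sndL 2 ℝ E ℝ) z :=
    (HasFDerivAt.comp z (g := F) hF.hasFDerivAt (WithLp.fstL 2 ℝ E ℝ).hasFDerivAt).sub
      (WithLp.sndL 2 ℝ E ℝ).hasFDerivAt
  have h2 : HasFDerivWithinAt (fun q : WithLp 2 (E × ℝ) => F (WithLp.fstL 2 ℝ E ℝ q) - WithLp.sndL 2 ℝ E ℝ q)
      (0 : WithLp 2 (E × ℝ) →L[ℝ] ℝ) M z := by
    refine (hasFDerivWithinAt_const (0 : ℝ) z M).congr (fun q hq => ?_) ?_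
    · obtain ⟨θ, rfl⟩ := hM hq
      simp
    · simp [z]
  have h3 := h1.hasFDerivWithinAt.unique_on h2 hw
  rw [WithLp.prod_inner_apply]
  simp only [sub_apply, ContinuousLinearMap.comp_apply,
    zero_apply] at h3
  rw [← inner_gradient_left] at h3
  simp at h3 ⊢
  linarith

/-- Among finitely many strata one contains infinitely many of the approximating graph points.
Normality of (∇F, -1) there passes to the limit by Whitney's condition (a), whatever stratum the
limit lies in, and is preserved by convex combinations. -/
theorem toLp_mem_normalSpace_of_mem_clarkeSubdifferential [CompleteSpace E] {F : E → ℝ}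
    (hF : Continuous F) {n : ℕ} {S : Fin n → Set (WithLp 2 (E × ℝ))}
    (hS : IsWhitneyC1Stratification S (Set.range fun θ : E => WithLp.toLp 2 (θ, F θ)))
    {x h : E} (hh : h ∈ clarkeSubdifferential F x) {j : Fin n}
    (hj : WithLp.toLp 2 (x, F x) ∈ S j) :
    WithLp.toLp 2 (h, (-1 : ℝ)) ∈ normalSpace (S j) (WithLp.toLp 2 (x, F x)) := by
  intro w hw
  have : convexHull ℝ (limitingGradients F x) ⊆
      {g | inner ℝ g w.fst = w.snd} := by
    refine convexHull_min ?_ (convex_hyperplane (𝕜 := ℝ) (f := fun g : E => inner ℝ g w.fst)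
      ⟨fun a b => inner_add_left a b _, fun a b => by simp [inner_smul_left]⟩ _)
    rintro g ⟨s, hs, hd, hg⟩
    have hmem : ∀ k, ∃ i, (WithLp.toLp 2 (s k, F (s k)) : WithLp 2 (E × ℝ)) ∈ S i := fun k => by
      have : (WithLp.toLp 2 (s k, F (s k)) : WithLp 2 (E × ℝ)) ∈ ⋃ i, S i := by
        rw [hS.cover]; exact ⟨s k, rfl⟩
      simpa using this
    choose i hi using hmem
    obtain ⟨i₀, hi₀⟩ : ∃ i₀, ∃ᶠ k in atTop, i k = i₀ := by
      by_contra! hcon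
      have h0 : ∀ᶠ k in atTop, ∀ i₀, i k ≠ i₀ :=
        eventually_all.2 fun i₀ => by simpa [not_frequently] using hcon i₀
      obtain ⟨k, hk⟩ := h0.exists
      exact hk _ rfl
    obtain ⟨ψ, hψ, hψi⟩ := extraction_of_frequently_atTop hi₀
    have hcv : Continuous fun q : E × ℝ => (WithLp.toLp 2 q : WithLp 2 (E × ℝ)) :=
      WithLp.prod_continuous_toLp 2 E ℝ
    have hz : Tendsto (fun k => (WithLp.toLp 2 (s (ψ k), F (s (ψ k))) : WithLp 2 (E × ℝ))) atTop
        (𝓝 (WithLp.toLp 2 (x, F x))) :=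
      (hcv.tendsto _).comp ((hs.comp hψ.tendsto_atTop).prodMk_nhds
        ((hF.tendsto x).comp (hs.comp hψ.tendsto_atTop)))
    have hν : Tendsto (fun k => (WithLp.toLp 2 (gradient F (s (ψ k)), (-1 : ℝ)) : WithLp 2 (E × ℝ)))
        atTop (𝓝 (WithLp.toLp 2 (g, -1))) :=
      (hcv.tendsto _).comp ((hg.comp hψ.tendsto_atTop).prodMk_nhds tendsto_const_nhds)
    have hfin := hS.whitney_a i₀ j _ _ _ _ (fun k => by rw [← hψi k]; exact hi _) hj hz
      (fun k => toLp_gradient_mem_normalSpace (hd (ψ k)) (hS.cover ▸ Set.subset_iUnion S i₀)) hν w hw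
    rw [WithLp.prod_inner_apply] at hfin
    simp at hfin ⊢
    linarith
  have h1 : inner ℝ h w.fst = w.snd := this hh
  rw [WithLp.prod_inner_apply]
  simp at h1 ⊢
  linarith

/-- Along a curve, almost every derivative of a Whitney stratifiable function is given by pairing
any Clarke subgradient with the velocity. -/
theorem ae_hasDerivAt_of_isWhitneyC1Stratifiable [CompleteSpace E] {F : E → ℝ} (hF : Continuous F)
    (hS : IsWhitneyC1Stratifiable F) {θ v h : ℝ → E} {A : Set ℝ}
    (hθ : ∀ᵐ t, t ∈ A → HasDerivAt θ (v t) t)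
    (hFθ : ∀ᵐ t, t ∈ A → DifferentiableAt ℝ (fun s => F (θ s)) t)
    (hh : ∀ t ∈ A, h t ∈ clarkeSubdifferential F (θ t)) :
    ∀ᵐ t, t ∈ A → HasDerivAt (fun s => F (θ s)) (inner ℝ (h t) (v t)) t := by
  obtain ⟨n, S, hS⟩ := hS
  set γ : ℝ → WithLp 2 (E × ℝ) := fun t => WithLp.toLp 2 (θ t, F (θ t)) with hγ
  have hiso : ∀ᵐ t, ∀ j, γ t ∈ S j → ∃ᶠ s in 𝓝[≠] t, γ s ∈ S j := by
    refine ae_all_iff.2 fun j => ?_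
    filter_upwards [(countable_setOf_isolated {t | γ t ∈ S j}).ae_notMem volume] with t ht hj
    by_contra hcon
    exact ht ⟨hj, hcon⟩
  filter_upwards [hθ, hFθ, hiso] with t h1 h2 h3 ht
  specialize h1 ht
  specialize h2 ht
  obtain ⟨j, hj⟩ : ∃ j, γ t ∈ S j := by
    have : γ t ∈ ⋃ i, S i := by rw [hS.cover]; exact ⟨θ t, rfl⟩
    simpa using this
  have hd : HasDerivAt γ (WithLp.toLp 2 (v t, deriv (fun s => F (θ s)) t)) t := by
    have := (WithLp.prodContinuousLinearEquiv 2 ℝ E ℝ).symm.hasFDerivAt.comp_hasDerivAt t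
      (h1.prodMk h2.hasDerivAt)
    exact this
  -- The curve returns to its stratum arbitrarily close to `t`, so difference quotients along the
  -- returns place the velocity in the tangent cone. Pairing with the normal vector (h, -1) then
  -- identifies the derivative.
  have htan : WithLp.toLp 2 (v t, deriv (fun s => F (θ s)) t) ∈ tangentConeAt ℝ (S j) (γ t) := by
    refine mem_tangentConeAt_of_frequently (𝓝[≠] t) (fun s => (s - t)⁻¹) (fun s => γ s - γ t)
      ?_ ?_ ?_
    · have := hd.continuousAt.tendsto.sub_const (γ t)
      rw [sub_self] at this
      exact this.mono_left nhdsWithin_le_nhds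
    · simpa using h3 j hj
    · exact hasDerivAt_iff_tendsto_slope.1 hd
  have := toLp_mem_normalSpace_of_mem_clarkeSubdifferential hF hS (hh t ht) hj _ htan
  rw [WithLp.prod_inner_apply] at this
  simp at this
  have h4 : inner ℝ (h t) (v t) = deriv (fun s => F (θ s)) t := by linarith
  rw [h4]
  exact h2.hasDerivAt

end ChainRule


/-! ### Integral inequalities for Lipschitz and monotone functions. -/

section RealAnalysis

theorem integral_le_sub_of_lipschitzOn {G κ : ℝ → ℝ} {a b : ℝ} {K : NNReal} (hab : a ≤ b)
    (hG : LipschitzOnWith K G (Set.Icc a b)) (hκ : IntervalIntegrable κ volume a b)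
    (h : ∀ᵐ t, t ∈ Set.Ioc a b → ∃ D, HasDerivAt G D t ∧ κ t ≤ D) :
    ∫ t in a..b, κ t ≤ G b - G a := by
  have hac : AbsolutelyContinuousOnInterval G a b :=
    LipschitzOnWith.absolutelyContinuousOnInterval (by rwa [Set.uIcc_of_le hab])
  rw [← hac.integral_deriv_eq_sub, intervalIntegral.integral_of_le hab,
    intervalIntegral.integral_of_le hab]
  refine integral_mono_ae hκ.1 hac.intervalIntegrable_deriv.1 ?_
  filter_upwards [(ae_restrict_iff' measurableSet_Ioc).2 h] with t ht
  obtain ⟨D, hD, hle⟩ := ht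
  rwa [hD.deriv]

theorem abs_sub_le_of_lipschitzOn {G : ℝ → ℝ} {a b ε : ℝ} {K : NNReal} (hab : a ≤ b)
    (hG : LipschitzOnWith K G (Set.Icc a b))
    (h : ∀ᵐ t, t ∈ Set.Ioc a b → ∃ D, HasDerivAt G D t ∧ |D| ≤ ε) :
    |G b - G a| ≤ ε * (b - a) := by
  rw [abs_le]
  constructor
  · have := integral_le_sub_of_lipschitzOn (κ := fun _ => -ε) hab hG (by simp) (by
      filter_upwards [h] with t ht hm
      obtain ⟨D, hD, hle⟩ := ht hm
      exact ⟨D, hD, (abs_le.1 hle).1⟩)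
    simp at this
    linarith
  · have := integral_le_sub_of_lipschitzOn (G := -G) (κ := fun _ => -ε) hab (by simpa using hG.neg)
      (by simp) (by
      filter_upwards [h] with t ht hm
      obtain ⟨D, hD, hle⟩ := ht hm
      exact ⟨-D, hD.neg, by linarith [(abs_le.1 hle).2]⟩)
    simp at this
    linarith

/-- A one-sided second mean value inequality. -/
theorem integral_mul_le_of_antitoneOn {η h : ℝ → ℝ} {T b C M : ℝ} (hTb : T ≤ b)
    (hη : AntitoneOn η (Set.Icc T b)) (hη0 : 0 ≤ η b)
    (hh : IntervalIntegrable h volume T b) (hM : ∀ t ∈ Set.Icc T b, |h t| ≤ M)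
    (hC : ∀ t ∈ Set.Icc T b, ∫ s in T..t, h s ≤ C) :
    ∫ t in T..b, η t * h t ≤ η T * C := by
  have hsub : ∀ {s t}, T ≤ s → s ≤ t → t ≤ b → Set.uIcc s t ⊆ Set.uIcc T b := fun h1 h2 h3 => by
    rw [Set.uIcc_of_le h2, Set.uIcc_of_le hTb]
    exact Set.Icc_subset_Icc h1 h3
  have hηi : IntervalIntegrable η volume T b := by
    refine AntitoneOn.intervalIntegrable ?_
    rwa [Set.uIcc_of_le hTb]
  have hηh : IntervalIntegrable (fun t => η t * h t) volume T b := by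
    rw [intervalIntegrable_iff_integrableOn_Ioc_of_le hTb] at hηi hh ⊢
    exact Integrable.mul_bdd (c := M) hηi hh.aestronglyMeasurable
      ((ae_restrict_iff' measurableSet_Ioc).2 (Eventually.of_forall fun t ht =>
        hM t (Set.Ioc_subset_Icc_self ht)))
  have hM0 : 0 ≤ M := (abs_nonneg _).trans (hM T (Set.left_mem_Icc.2 hTb))
  -- Formally Φ(t) = -∫ H dη with H the primitive of `h` from `T`, so H ≤ C yields Φ(b) ≤ C (η T - η
  -- b). As `η` need not be continuous, this is obtained by Abel summation over a partition.
  set Φ : ℝ → ℝ := fun t => (∫ s in T..t, η s * h s) - η t * ∫ s in T..t, h s with hΦ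
  have hstep : ∀ s t, T ≤ s → s ≤ t → t ≤ b → Φ t - Φ s ≤ (η s - η t) * (C + M * (t - s)) := by
    intro s t h1 h2 h3
    have hηst : η t ≤ η s := hη ⟨h1, h2.trans h3⟩ ⟨h1.trans h2, h3⟩ h2
    have i1 := hηh.mono_set (hsub le_rfl h1 (h2.trans h3))
    have i2 := hηh.mono_set (hsub h1 h2 h3)
    have j1 := hh.mono_set (hsub le_rfl h1 (h2.trans h3))
    have j2 := hh.mono_set (hsub h1 h2 h3)
    have e1 := intervalIntegral.integral_add_adjacent_intervals i1 i2
    have e2 := intervalIntegral.integral_add_adjacent_intervals j1 j2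
    have e3 : ∫ r in s..t, (η r - η t) * h r = (∫ r in s..t, η r * h r) - η t * ∫ r in s..t, h r := by
      rw [← intervalIntegral.integral_const_mul, ← intervalIntegral.integral_sub i2 (j2.const_mul _)]
      simp_rw [sub_mul]
    have e4 : Φ t - Φ s = (∫ r in s..t, (η r - η t) * h r) + (η s - η t) * ∫ r in T..s, h r := by
      simp only [hΦ]
      rw [e3, ← e1, ← e2]
      ring
    have e5 : ∫ r in s..t, (η r - η t) * h r ≤ (η s - η t) * M * (t - s) := by
      refine (le_abs_self _).trans ?_
      have := intervalIntegral.norm_integral_le_of_norm_le_const (a := s) (b := t)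
        (f := fun r => (η r - η t) * h r) (C := (η s - η t) * M) fun r hr => by
          rw [Set.uIoc_of_le h2] at hr
          have hr1 : r ∈ Set.Icc T b := ⟨h1.trans hr.1.le, hr.2.trans h3⟩
          rw [norm_mul]
          refine mul_le_mul ?_ (hM r hr1) (norm_nonneg _) (by linarith)
          rw [Real.norm_of_nonneg (sub_nonneg.2 (hη hr1 ⟨h1.trans h2, h3⟩ hr.2))]
          linarith [hη ⟨h1, h2.trans h3⟩ hr1 hr.1.le]
      rwa [abs_of_nonneg (sub_nonneg.2 h2)] at this
    have e6 := mul_le_mul_of_nonneg_left (hC s ⟨h1, h2.trans h3⟩) (sub_nonneg.2 hηst)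
    rw [e4]
    linarith
  -- The bound on the increments telescopes over n equal pieces; the error, M times the mesh,
  -- vanishes as n grows.
  have hpart : ∀ n : ℕ, 0 < n → Φ b ≤ (η T - η b) * (C + M * ((b - T) / n)) := by
    intro n hn
    have hn' : (0 : ℝ) < n := Nat.cast_pos.2 hn
    set δ := (b - T) / n with hδ
    have hδ0 : 0 ≤ δ := div_nonneg (sub_nonneg.2 hTb) hn'.le
    have hnδ : n * δ = b - T := by rw [hδ]; field_simp
    have hind : ∀ k : ℕ, k ≤ n → Φ (T + k * δ) ≤ (η T - η (T + k * δ)) * (C + M * δ) := by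
      intro k
      induction k with
      | zero => simp [hΦ]
      | succ k ih =>
        intro hk
        have hk' : ((k : ℝ) + 1) * δ ≤ n * δ :=
          mul_le_mul_of_nonneg_right (by exact_mod_cast hk) hδ0
        have h1 := ih (Nat.le_of_succ_le hk)
        have h2 := hstep (T + k * δ) (T + (k + 1) * δ)
          (by linarith [mul_nonneg (Nat.cast_nonneg (α := ℝ) k) hδ0]) (by linarith) (by linarith)
        push_cast
        have h3 : T + (k + 1) * δ - (T + k * δ) = δ := by ring
        rw [h3] at h2
        linarith
    have := hind n le_rfl
    rwa [hnδ, add_sub_cancel] at this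
  have hlim : Φ b ≤ (η T - η b) * C := by
    have h1 : Tendsto (fun n : ℕ => (η T - η b) * (C + M * ((b - T) / n))) atTop
        (𝓝 ((η T - η b) * (C + M * 0))) :=
      ((tendsto_const_div_atTop_nhds_zero_nat (b - T)).const_mul M |>.const_add C).const_mul _
    rw [mul_zero, add_zero] at h1
    exact ge_of_tendsto h1 ((eventually_gt_atTop 0).mono hpart)
  have h2 := mul_le_mul_of_nonneg_left (hC b ⟨hTb, le_rfl⟩) hη0
  simp only [hΦ] at hlim
  linarith

theorem exists_lipschitzOnWith_comp {E' : Type*} [NormedAddCommGroup E'] [NormedSpace ℝ E']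
    {G : ℝ → E'} {Φ : E' → ℝ} {a b : ℝ} {K : NNReal} (hG : LipschitzOnWith K G (Set.Icc a b))
    (hΦ : ∀ t ∈ Set.Icc a b, ContDiffAt ℝ 1 Φ (G t)) :
    ∃ K', LipschitzOnWith K' (fun t => Φ (G t)) (Set.Icc a b) := by
  have h1 : LocallyLipschitzOn (G '' Set.Icc a b) Φ := by
    rintro _ ⟨t, ht, rfl⟩
    obtain ⟨C, s, hs, hC⟩ := (hΦ t ht).exists_lipschitzOnWith
    exact ⟨C, s, mem_nhdsWithin_of_mem_nhds hs, hC⟩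
  obtain ⟨C, hC⟩ := h1.exists_lipschitzOnWith_of_compact (isCompact_Icc.image_of_continuousOn hG.continuousOn)
  exact ⟨C * K, hC.comp hG (Set.mapsTo_image _ _)⟩

end RealAnalysis

/-! ### Exponential moving averages -/

section Ema

variable {c : ℝ} {g : ℝ → ℝ}

theorem intervalIntegrable_emaKernel_mul (c t : ℝ) {a b : ℝ} (hg : IntervalIntegrable g volume a b) :
    IntervalIntegrable (fun s => c * Real.exp (-c * (t - s)) * g s) volume a b :=
  hg.continuousOn_mul (by fun_prop)

theorem ema_eq_exp_mul (c : ℝ) (g : ℝ → ℝ) (t : ℝ) :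
    ema c g t = Real.exp (-c * t) * ∫ s in (0 : ℝ)..t, c * Real.exp (c * s) * g s := by
  rw [ema, ← intervalIntegral.integral_const_mul]
  congr 1
  funext s
  rw [show -c * (t - s) = -c * t + c * s by ring, Real.exp_add]
  ring

/-- An exponential average remembers its past only through its value at time `s`, discounted by
e^{-c(t-s)}. -/
theorem ema_split {s t : ℝ} (h0 : IntervalIntegrable g volume 0 s)
    (h1 : IntervalIntegrable g volume s t) :
    ema c g t = Real.exp (-c * (t - s)) * ema c g s +
      ∫ r in s..t, c * Real.exp (-c * (t - r)) * g r := by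
  rw [ema, ← intervalIntegral.integral_add_adjacent_intervals
    (intervalIntegrable_emaKernel_mul c t h0) (intervalIntegrable_emaKernel_mul c t h1), ema,
    ← intervalIntegral.integral_const_mul]
  congr 2
  funext r
  rw [show -c * (t - r) = -c * (t - s) + -c * (s - r) by ring, Real.exp_add]
  ring

theorem integral_emaKernel (c : ℝ) (s t : ℝ) :
    ∫ r in s..t, c * Real.exp (-c * (t - r)) = 1 - Real.exp (-c * (t - s)) := by
  have : ∀ r ∈ Set.uIcc s t, HasDerivAt (fun r => Real.exp (-c * (t - r)))
      (c * Real.exp (-c * (t - r))) r := fun r _ => by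
    have h1 : HasDerivAt (fun r => -c * (t - r)) c r := by
      simpa using ((hasDerivAt_id r).const_sub t).const_mul (-c)
    simpa [mul_comm] using h1.exp
  rw [intervalIntegral.integral_eq_sub_of_hasDerivAt this
    (Continuous.intervalIntegrable (by fun_prop) _ _)]
  simp

theorem ema_neg (c : ℝ) (g : ℝ → ℝ) (t : ℝ) : ema c (fun s => -g s) t = -ema c g t := by
  simp [ema]

theorem ema_mono {t : ℝ} (hc : 0 ≤ c) (ht : 0 ≤ t) {g₁ g₂ : ℝ → ℝ}
    (h₁ : IntervalIntegrable g₁ volume 0 t) (h₂ : IntervalIntegrable g₂ volume 0 t)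
    (h : ∀ s ∈ Set.Icc 0 t, g₁ s ≤ g₂ s) : ema c g₁ t ≤ ema c g₂ t :=
  intervalIntegral.integral_mono_on ht (intervalIntegrable_emaKernel_mul c t h₁)
    (intervalIntegrable_emaKernel_mul c t h₂) fun s hs =>
      mul_le_mul_of_nonneg_left (h s hs) (mul_nonneg hc (Real.exp_nonneg _))

theorem ema_nonneg {t : ℝ} (hc : 0 ≤ c) (ht : 0 ≤ t) (h : ∀ s, 0 ≤ g s) : 0 ≤ ema c g t :=
  intervalIntegral.integral_nonneg ht fun s _ =>
    mul_nonneg (mul_nonneg hc (Real.exp_nonneg _)) (h s)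

/-- For an integrable signal the ODE of the moving average holds at almost every time, by Lebesgue
differentiation of the primitive. -/
theorem ae_hasDerivAt_ema (c : ℝ) (hg : ∀ T, 0 ≤ T → IntervalIntegrable g volume 0 T) :
    ∀ᵐ t, 0 < t → HasDerivAt (ema c g) (c * (g t - ema c g t)) t := by
  have h1 : ∀ᵐ t, ∀ n : ℕ, t ∈ Set.uIcc (0 : ℝ) n → ∀ a ∈ Set.uIcc (0 : ℝ) n,
      HasDerivAt (fun x => ∫ s in a..x, c * Real.exp (c * s) * g s) (c * Real.exp (c * t) * g t) t :=
    ae_all_iff.2 fun n => ((hg n n.cast_nonneg).continuousOn_mul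
      (g := fun s => c * Real.exp (c * s)) (by fun_prop)).ae_hasDerivAt_integral
  filter_upwards [h1] with t ht ht0
  obtain ⟨n, hn⟩ := exists_nat_ge t
  have h2 := ht n (by rw [Set.uIcc_of_le n.cast_nonneg]; exact ⟨ht0.le, hn⟩) 0 (by simp)
  have h3 : HasDerivAt (fun x : ℝ => Real.exp (-c * x)) (-c * Real.exp (-c * t)) t := by
    have := ((hasDerivAt_id t).const_mul (-c)).exp
    simpa [mul_comm] using this
  have h4 := h3.mul h2
  have h5 : (ema c g) = fun x => Real.exp (-c * x) * ∫ s in (0 : ℝ)..x, c * Real.exp (c * s) * g s :=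
    funext (ema_eq_exp_mul c g)
  rw [ema_eq_exp_mul c g t, h5]
  refine h4.congr_deriv ?_
  have h6 : Real.exp (-c * t) * Real.exp (c * t) = 1 := by
    rw [← Real.exp_add]; simp
  linear_combination c * g t * h6

theorem abs_ema_le {t M : ℝ} (hc : 0 ≤ c) (ht : 0 ≤ t) (hM : ∀ s, 0 ≤ s → |g s| ≤ M) :
    |ema c g t| ≤ M * (1 - Real.exp (-c * t)) := by
  have := intervalIntegral.norm_integral_le_of_norm_le (a := 0) (b := t) (μ := volume)
    (f := fun s => c * Real.exp (-c * (t - s)) * g s)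
    (g := fun s => M * (c * Real.exp (-c * (t - s)))) ht (Eventually.of_forall fun s hs => by
      rw [norm_mul, Real.norm_of_nonneg (mul_nonneg hc (Real.exp_nonneg _)), mul_comm]
      exact mul_le_mul_of_nonneg_right (hM s hs.1.le) (mul_nonneg hc (Real.exp_nonneg _)))
    (Continuous.intervalIntegrable (by fun_prop) _ _)
  rwa [intervalIntegral.integral_const_mul, integral_emaKernel, sub_zero] at this

theorem abs_ema_le' {t M : ℝ} (hc : 0 ≤ c) (ht : 0 ≤ t) (hM : ∀ s, 0 ≤ s → |g s| ≤ M) :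
    |ema c g t| ≤ M := by
  have hM0 : 0 ≤ M := (abs_nonneg _).trans (hM 0 le_rfl)
  exact (abs_ema_le hc ht hM).trans
    (mul_le_of_le_one_right hM0 (by linarith [Real.exp_nonneg (-c * t)]))

theorem lipschitzOnWith_ema {M : ℝ} (hc : 0 ≤ c)
    (hg : ∀ T, 0 ≤ T → IntervalIntegrable g volume 0 T) (hM : ∀ s, 0 ≤ s → |g s| ≤ M) :
    LipschitzOnWith (Real.toNNReal (2 * M * c)) (ema c g) (Set.Ici 0) := by
  have hM0 : 0 ≤ M := (abs_nonneg _).trans (hM 0 le_rfl)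
  have key : ∀ s t, 0 ≤ s → s ≤ t → |ema c g t - ema c g s| ≤ 2 * M * c * (t - s) := by
    intro s t hs hst
    have i1 : IntervalIntegrable g volume s t := (hg t (hs.trans hst)).mono_set (by
      rw [Set.uIcc_of_le hst, Set.uIcc_of_le (hs.trans hst)]
      exact Set.Icc_subset_Icc_left hs)
    rw [ema_split (c := c) (hg s hs) i1]
    have h1 : |∫ r in s..t, c * Real.exp (-c * (t - r)) * g r| ≤ M * (1 - Real.exp (-c * (t - s))) := by
      have := intervalIntegral.norm_integral_le_of_norm_le (a := s) (b := t) (μ := volume)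
        (f := fun s => c * Real.exp (-c * (t - s)) * g s)
        (g := fun s => M * (c * Real.exp (-c * (t - s)))) hst (Eventually.of_forall fun r hr => by
          rw [norm_mul, Real.norm_of_nonneg (mul_nonneg hc (Real.exp_nonneg _)), mul_comm]
          exact mul_le_mul_of_nonneg_right (hM r (hs.trans hr.1.le)) (mul_nonneg hc (Real.exp_nonneg _)))
        (Continuous.intervalIntegrable (by fun_prop) _ _)
      rwa [intervalIntegral.integral_const_mul, integral_emaKernel] at this
    have h2 := abs_ema_le' hc hs hM
    have h3 : 1 - Real.exp (-c * (t - s)) ≤ c * (t - s) := by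
      linarith [Real.add_one_le_exp (-c * (t - s))]
    have h4 : 0 ≤ 1 - Real.exp (-c * (t - s)) := by
      rw [sub_nonneg, Real.exp_le_one_iff, neg_mul, neg_nonpos]
      exact mul_nonneg hc (sub_nonneg.2 hst)
    calc _ = |(∫ r in s..t, c * Real.exp (-c * (t - r)) * g r)
          - (1 - Real.exp (-c * (t - s))) * ema c g s| := by congr 1; ring
      _ ≤ M * (1 - Real.exp (-c * (t - s))) + (1 - Real.exp (-c * (t - s))) * M := by
          refine (abs_sub _ _).trans (add_le_add h1 ?_)
          rw [abs_mul, abs_of_nonneg h4]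
          exact mul_le_mul_of_nonneg_left h2 h4
      _ ≤ _ := by nlinarith
  refine LipschitzOnWith.of_dist_le_mul fun x hx y hy => ?_
  rw [Real.coe_toNNReal _ (by positivity), Real.dist_eq, Real.dist_eq]
  rcases le_total x y with h | h
  · rw [abs_sub_comm, abs_sub_comm x y, abs_of_nonneg (sub_nonneg.2 h)]
    exact key x y hx h
  · rw [abs_of_nonneg (sub_nonneg.2 h)]
    exact key y x hy h

/-- Cauchy-Schwarz inequality for moving averages. -/
theorem sq_ema_le {t : ℝ} (hc : 0 < c) (ht : 0 < t) (hg : IntervalIntegrable g volume 0 t)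
    (hg2 : IntervalIntegrable (fun s => g s ^ 2) volume 0 t) :
    ema c g t ^ 2 ≤ (1 - Real.exp (-c * t)) * ema c (fun s => g s ^ 2) t := by
  set W := 1 - Real.exp (-c * t) with hW
  have hW0 : 0 < W := by
    rw [hW, sub_pos, Real.exp_lt_one_iff]
    nlinarith
  -- Averaging g² ≥ 2 x g - x²; the best choice x = m / W, with W the mass of the kernel, is
  -- inserted below.
  have h1 : ∀ x : ℝ, 2 * x * ema c g t - x ^ 2 * W ≤ ema c (fun s => g s ^ 2) t := by
    intro x
    have h2 : 2 * x * ema c g t - x ^ 2 * W =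
        ∫ s in (0 : ℝ)..t, c * Real.exp (-c * (t - s)) * (2 * x * g s - x ^ 2) := by
      have e1 : W = ∫ r in (0 : ℝ)..t, c * Real.exp (-c * (t - r)) := by
        rw [integral_emaKernel, sub_zero]
      rw [e1, ema, ← intervalIntegral.integral_const_mul, ← intervalIntegral.integral_const_mul,
        ← intervalIntegral.integral_sub ((intervalIntegrable_emaKernel_mul c t hg).const_mul _)
          (Continuous.intervalIntegrable (by fun_prop) _ _)]
      congr 1
      funext s
      ring
    rw [h2]
    refine ema_mono hc.le ht.le ((hg.const_mul _).sub (by simp)) hg2 fun s _ => ?_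
    nlinarith [sq_nonneg (g s - x)]
  have h3 := h1 (ema c g t / W)
  have h4 : 2 * (ema c g t / W) * ema c g t - (ema c g t / W) ^ 2 * W = ema c g t ^ 2 / W := by
    field_simp
    ring
  rw [h4, div_le_iff₀ hW0] at h3
  linarith

theorem ema_le_mul_ema {c₁ c₂ t : ℝ} (hc₂ : 0 < c₂) (hc : c₂ ≤ c₁) (ht : 0 ≤ t)
    (hg : IntervalIntegrable g volume 0 t) (h0 : ∀ s, 0 ≤ g s) :
    ema c₁ g t ≤ c₁ / c₂ * ema c₂ g t := by
  rw [ema, ema, ← intervalIntegral.integral_const_mul]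
  refine intervalIntegral.integral_mono_on ht (intervalIntegrable_emaKernel_mul _ t hg)
    ((intervalIntegrable_emaKernel_mul _ t hg).const_mul _) fun s hs => ?_
  have h1 : c₁ / c₂ * (c₂ * Real.exp (-c₂ * (t - s)) * g s) = c₁ * Real.exp (-c₂ * (t - s)) * g s := by
    field_simp
  rw [h1]
  have h2 : Real.exp (-c₁ * (t - s)) ≤ Real.exp (-c₂ * (t - s)) := by
    rw [Real.exp_le_exp]
    nlinarith [hs.2]
  exact mul_le_mul_of_nonneg_right (mul_le_mul_of_nonneg_left h2 (hc₂.le.trans hc)) (h0 s)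

/-- With W_j the bias masses and V_j the averages of g², Cauchy-Schwarz and comparison of kernels
give m² ≤ W₁ V₁ ≤ W₁ (c₁/c₂) V₂. Since c₂ ≤ c₁ implies W₂ ≤ W₁, the bias corrections only help. -/
theorem abs_adamRatio_le {c₁ c₂ t : ℝ} (hc₂ : 0 < c₂) (hc : c₂ ≤ c₁) (ht : 0 < t)
    (hg : IntervalIntegrable g volume 0 t)
    (hg2 : IntervalIntegrable (fun s => g s ^ 2) volume 0 t) :
    |adamRatio c₁ c₂ g t| ≤ Real.sqrt (c₁ / c₂) := by
  have hc₁ : 0 < c₁ := hc₂.trans_le hc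
  have hW : ∀ c : ℝ, 0 < c → 0 < 1 - Real.exp (-c * t) := fun c hc => by
    rw [sub_pos, Real.exp_lt_one_iff]; nlinarith
  have hW12 : 1 - Real.exp (-c₂ * t) ≤ 1 - Real.exp (-c₁ * t) := by
    have : Real.exp (-c₁ * t) ≤ Real.exp (-c₂ * t) := Real.exp_le_exp.2 (by nlinarith)
    linarith
  have hW1 := hW c₁ hc₁
  have hW2 := hW c₂ hc₂
  have hV0 : 0 ≤ ema c₂ (fun s => g s ^ 2) t := ema_nonneg hc₂.le ht.le fun s => sq_nonneg _
  have h1 := sq_ema_le hc₁ ht hg hg2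
  have h2 := ema_le_mul_ema hc₂ hc ht.le hg2 fun s => sq_nonneg _
  rw [adamRatio, abs_div, abs_of_nonneg (Real.sqrt_nonneg _)]
  refine div_le_of_le_mul₀ (Real.sqrt_nonneg _) (Real.sqrt_nonneg _) ?_
  rw [← Real.sqrt_mul (by positivity)]
  refine Real.abs_le_sqrt ?_
  rw [mul_pow, inv_pow, inv_mul_le_iff₀ (by positivity)]
  calc ema c₁ g t ^ 2 ≤ (1 - Real.exp (-c₁ * t)) * (c₁ / c₂ * ema c₂ (fun s => g s ^ 2) t) :=
        h1.trans (mul_le_mul_of_nonneg_left h2 hW1.le)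
    _ = (1 - Real.exp (-c₁ * t)) * ((1 - Real.exp (-c₂ * t)) *
          (c₁ / c₂ * ((1 - Real.exp (-c₂ * t))⁻¹ * ema c₂ (fun s => g s ^ 2) t))) := by
        generalize 1 - Real.exp (-c₂ * t) = W at hW2
        field_simp
    _ ≤ (1 - Real.exp (-c₁ * t)) * ((1 - Real.exp (-c₁ * t)) *
          (c₁ / c₂ * ((1 - Real.exp (-c₂ * t))⁻¹ * ema c₂ (fun s => g s ^ 2) t))) := by
        gcongr
    _ = _ := by ring

theorem ema_pos {t T : ℝ} (hc : 0 ≤ c) (hT : 0 ≤ T) (hTt : T ≤ t)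
    (hg : ∀ T, 0 ≤ T → IntervalIntegrable g volume 0 T) (h0 : ∀ s, 0 ≤ g s)
    (hpos : 0 < ema c g T) : 0 < ema c g t := by
  have i1 : IntervalIntegrable g volume T t := (hg t (hT.trans hTt)).mono_set (by
    rw [Set.uIcc_of_le hTt, Set.uIcc_of_le (hT.trans hTt)]
    exact Set.Icc_subset_Icc_left hT)
  rw [ema_split (c := c) (hg T hT) i1]
  have : 0 ≤ ∫ r in T..t, c * Real.exp (-c * (t - r)) * g r :=
    intervalIntegral.integral_nonneg hTt fun s _ =>
      mul_nonneg (mul_nonneg hc (Real.exp_nonneg _)) (h0 s)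
  have h2 := mul_pos (Real.exp_pos (-c * (t - T))) hpos
  linarith

theorem abs_ema_div_sqrt_le {c₁ c₂ t : ℝ} (hc₂ : 0 < c₂) (hc : c₂ ≤ c₁) (ht : 0 < t)
    (hg : IntervalIntegrable g volume 0 t)
    (hg2 : IntervalIntegrable (fun s => g s ^ 2) volume 0 t) :
    |ema c₁ g t / Real.sqrt (ema c₂ (fun s => g s ^ 2) t)| ≤ Real.sqrt (c₁ / c₂) := by
  have hc₁ : 0 < c₁ := hc₂.trans_le hc
  have hV0 : 0 ≤ ema c₁ (fun s => g s ^ 2) t := ema_nonneg hc₁.le ht.le fun s => sq_nonneg _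
  rw [abs_div, abs_of_nonneg (Real.sqrt_nonneg _)]
  refine div_le_of_le_mul₀ (Real.sqrt_nonneg _) (Real.sqrt_nonneg _) ?_
  rw [← Real.sqrt_mul (by positivity)]
  refine Real.abs_le_sqrt ?_
  refine (sq_ema_le hc₁ ht hg hg2).trans (le_trans ?_ (ema_le_mul_ema hc₂ hc ht.le hg2 fun s => sq_nonneg _))
  exact mul_le_of_le_one_left hV0 (by linarith [Real.exp_nonneg (-c₁ * t)])

/-- The ratio of two moving averages exceeds one by at most a bounded amount in time average: the
logarithm of `√v - (c₂ / c₁) m` is a potential. -/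
theorem exists_integral_ratio_sub_one_le {c₁ c₂ M T : ℝ} (hc₂ : 0 < c₂) (hc : c₂ ≤ c₁) (hT : 0 < T)
    (hg : ∀ T, 0 ≤ T → IntervalIntegrable g volume 0 T)
    (hg2 : ∀ T, 0 ≤ T → IntervalIntegrable (fun s => g s ^ 2) volume 0 T)
    (hM : ∀ s, 0 ≤ s → |g s| ≤ M) (hpos : 0 < ema c₂ (fun s => g s ^ 2) T) :
    ∃ C, ∀ t, T ≤ t →
      ∫ s in T..t, (ema c₁ g s / Real.sqrt (ema c₂ (fun s => g s ^ 2) s) - 1) ≤ C := by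
  have hc₁ : 0 < c₁ := hc₂.trans_le hc
  set m := ema c₁ g with hm
  set V := ema c₂ (fun s => g s ^ 2) with hVdef
  have hM2 : ∀ s, 0 ≤ s → |g s ^ 2| ≤ M ^ 2 := fun s hs => by
    rw [abs_pow]; exact pow_le_pow_left₀ (abs_nonneg _) (hM s hs) 2
  have hM0 : 0 ≤ M := (abs_nonneg _).trans (hM 0 le_rfl)
  have hVpos : ∀ t, T ≤ t → 0 < V t := fun t ht =>
    ema_pos hc₂.le hT.le ht hg2 (fun s => sq_nonneg _) hpos
  have hA : ∀ t, T ≤ t → |m t / Real.sqrt (V t)| ≤ Real.sqrt (c₁ / c₂) := fun t ht =>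
    abs_ema_div_sqrt_le hc₂ hc (hT.trans_le ht) (hg t (hT.le.trans ht)) (hg2 t (hT.le.trans ht))
  have hmL := lipschitzOnWith_ema (c := c₁) hc₁.le hg hM
  have hVL := lipschitzOnWith_ema (c := c₂) hc₂.le hg2 hM2
  have hsub : ∀ t, Set.Icc T t ⊆ Set.Ici (0 : ℝ) := fun t s hs => hT.le.trans hs.1
  have hcont : ∀ t, ContinuousOn (fun s => m s / Real.sqrt (V s) - 1) (Set.Icc T t) := fun t =>
    ((hmL.continuousOn.mono (hsub t)).div (hVL.continuousOn.mono (hsub t)).sqrt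
      fun s hs => (Real.sqrt_pos.2 (hVpos s hs.1)).ne').sub continuousOn_const
  -- For c₁ = c₂ the potential below may degenerate, but then the ratio is at most 1 at every time.
  rcases hc.eq_or_lt with heq | hlt
  · refine ⟨0, fun t ht => ?_⟩
    have hii : IntervalIntegrable (fun s => m s / Real.sqrt (V s) - 1) volume T t := by
      refine ContinuousOn.intervalIntegrable ?_
      rw [Set.uIcc_of_le ht]; exact hcont t
    have := intervalIntegral.integral_mono_on (g := fun _ => (0 : ℝ)) ht hii (by simp)
      fun s hs => by
        have := hA s hs.1
        rw [heq, div_self hc₁.ne', Real.sqrt_one] at this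
        linarith [le_abs_self (m s / Real.sqrt (V s))]
    simpa using this
  set r := c₂ / c₁ with hr
  have hr0 : 0 < r := div_pos hc₂ hc₁
  have hr1 : r < 1 := (div_lt_one hc₁).2 hlt
  have hrm : ∀ t, T ≤ t → r * (m t / Real.sqrt (V t)) ≤ Real.sqrt r := fun t ht => by
    have h1 := (le_abs_self _).trans (hA t ht)
    have h2 : r * Real.sqrt (c₁ / c₂) = Real.sqrt r := by
      have : c₁ / c₂ = r⁻¹ := by rw [hr, inv_div]
      rw [this, Real.sqrt_inv]
      nth_rewrite 1 [← Real.mul_self_sqrt hr0.le]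
      field_simp
    rw [← h2]
    exact mul_le_mul_of_nonneg_left h1 hr0.le
  have hsr : Real.sqrt r < 1 := by
    rw [Real.sqrt_lt' one_pos]; simpa using hr1
  -- Positive because the ratio A = m / √V satisfies r A ≤ √r < 1.
  set S : ℝ → ℝ := fun t => Real.sqrt (V t) - r * m t with hS
  have hSeq : ∀ t, T ≤ t → S t = Real.sqrt (V t) * (1 - r * (m t / Real.sqrt (V t))) := fun t ht => by
    have := (Real.sqrt_pos.2 (hVpos t ht)).ne'
    simp only [hS]
    field_simp
  have hSpos : ∀ t, T ≤ t → 0 < S t := fun t ht => by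
    rw [hSeq t ht]
    exact mul_pos (Real.sqrt_pos.2 (hVpos t ht)) (by linarith [hrm t ht])
  have hSle : ∀ t, T ≤ t → S t ≤ 2 * M := fun t ht => by
    have h0 := hT.le.trans ht
    have h1 : Real.sqrt (V t) ≤ M := by
      rw [Real.sqrt_le_left hM0]
      exact (le_abs_self _).trans (abs_ema_le' hc₂.le h0 hM2)
    have h2 : |m t| ≤ M := abs_ema_le' hc₁.le h0 hM
    have h3 : -(r * m t) ≤ M := by
      have h4 : |r * m t| ≤ M := by
        rw [abs_mul, abs_of_pos hr0]
        nlinarith [abs_nonneg (m t)]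
      linarith [neg_abs_le (r * m t)]
    simp only [hS]
    linarith
  -- The potential is (1 - r)/c₂ · log S. As S ≤ 2 M, its total increase is bounded, and its
  -- derivative is shown to dominate A - 1.
  refine ⟨(1 - r) / c₂ * (Real.log (2 * M) - Real.log (S T)), fun t ht => ?_⟩
  obtain ⟨K, hK⟩ := exists_lipschitzOnWith_comp (G := fun s => (V s, m s)) (a := T) (b := t)
    (Φ := fun p => (1 - r) / c₂ * Real.log (Real.sqrt p.1 - r * p.2))
    ((hVL.mono (hsub t)).prodMk (hmL.mono (hsub t))) fun s hs => by
      have h1 : ContDiffAt ℝ 1 (fun p : ℝ × ℝ => Real.sqrt p.1) (V s, m s) :=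
        contDiffAt_fst.sqrt (hVpos s hs.1).ne'
      exact contDiffAt_const.mul ((h1.sub (contDiffAt_const.mul contDiffAt_snd)).log
        (hSpos s hs.1).ne')
  have hii : IntervalIntegrable (fun s => m s / Real.sqrt (V s) - 1) volume T t := by
    refine ContinuousOn.intervalIntegrable ?_
    rw [Set.uIcc_of_le ht]; exact hcont t
  refine (integral_le_sub_of_lipschitzOn ht hK hii ?_).trans ?_
  · filter_upwards [ae_hasDerivAt_ema c₁ hg, ae_hasDerivAt_ema c₂ hg2] with s h1 h2 hs
    have hs0 : 0 < s := hT.trans hs.1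
    have hTs := hs.1.le
    have hV := hVpos s hTs
    have hSs := hSpos s hTs
    have d1 := ((((h2 hs0).sqrt hV.ne').sub ((h1 hs0).const_mul r)).log hSs.ne').const_mul ((1 - r) / c₂)
    refine ⟨_, d1, ?_⟩
    change m s / Real.sqrt (V s) - 1 ≤ (1 - r) / c₂ * ((c₂ * (g s ^ 2 - V s) / (2 * Real.sqrt (V s))
      - r * (c₁ * (g s - m s))) / S s)
    set R := Real.sqrt (V s) with hR
    have hR0 : 0 < R := Real.sqrt_pos.2 hV
    have hVR : V s = R ^ 2 := (Real.sq_sqrt hV.le).symm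
    have hrc : r * c₁ = c₂ := by rw [hr]; field_simp
    set A := m s / R with hAd
    have hmA : m s = A * R := by rw [hAd]; field_simp
    have hSA : S s = R * (1 - r * A) := hSeq s hTs
    have hrA : 0 < 1 - r * A := by linarith [hrm s hTs]
    -- The weight r = c₂/c₁ is chosen so that the terms linear in `g` combine with g² into a
    -- nonnegative square, leaving c₂ (A - 1) R.
    have e1 : c₂ * (g s ^ 2 - V s) / (2 * R) - r * (c₁ * (g s - m s)) =
        c₂ * ((g s - R) ^ 2 / (2 * R) + (A - 1) * R) := by
      rw [hVR, ← mul_assoc, hrc, hmA]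
      field_simp
      ring
    have e2 : (1 - r) / c₂ * (c₂ * ((g s - R) ^ 2 / (2 * R) + (A - 1) * R) / (R * (1 - r * A))) =
        (1 - r) * ((g s - R) ^ 2 / (2 * R)) / (R * (1 - r * A)) + (1 - r) * (A - 1) / (1 - r * A) := by
      field_simp
    rw [e1, hSA, e2]
    have e3 : 0 ≤ (1 - r) * ((g s - R) ^ 2 / (2 * R)) / (R * (1 - r * A)) := by
      have : 0 ≤ 1 - r := by linarith
      positivity
    -- After clearing the denominator the difference of the two sides is r (A - 1)².
    have e4 : A - 1 ≤ (1 - r) * (A - 1) / (1 - r * A) := by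
      rw [le_div_iff₀ hrA]
      nlinarith [mul_nonneg hr0.le (sq_nonneg (A - 1))]
    linarith
  · rw [← mul_sub]
    refine mul_le_mul_of_nonneg_left (sub_le_sub_right ?_ _) (div_nonneg (by linarith) hc₂.le)
    exact Real.log_le_log (hSpos t ht) (hSle t ht)

end Ema

/-! ### Slowly varying functions -/

/-- Positive functions whose logarithm has slope tending to zero, in integrated form. -/
def SlowlyVarying (b : ℝ → ℝ) : Prop :=
  ∀ ε > 0, ∃ T, ∀ s t, T ≤ s → s ≤ t → 0 < b s ∧ |b s - b t| ≤ (Real.exp (ε * (t - s)) - 1) * b t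

namespace SlowlyVarying

theorem eventually_pos {b : ℝ → ℝ} (h : SlowlyVarying b) : ∀ᶠ t in atTop, 0 < b t := by
  obtain ⟨T, hT⟩ := h 1 one_pos
  exact eventually_atTop.2 ⟨T, fun t ht => (hT t t ht le_rfl).1⟩

theorem sum {ι : Type*} {s : Finset ι} {b : ι → ℝ → ℝ} (hs : s.Nonempty)
    (h : ∀ i ∈ s, SlowlyVarying (b i)) : SlowlyVarying fun t => ∑ i ∈ s, b i t := by
  intro ε hε
  choose! T hT using fun i hi => h i hi ε hε
  obtain ⟨T', hT'⟩ := (s.finite_toSet.image T).bddAbove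
  refine ⟨T', fun r t hr ht => ?_⟩
  have h1 : ∀ i ∈ s, T i ≤ r := fun i hi => (hT' ⟨i, hi, rfl⟩).trans hr
  refine ⟨Finset.sum_pos (fun i hi => (hT i hi r t (h1 i hi) ht).1) hs, ?_⟩
  rw [← Finset.sum_sub_distrib, Finset.mul_sum]
  exact (Finset.abs_sum_le_sum_abs _ _).trans
    (Finset.sum_le_sum fun i hi => (hT i hi r t (h1 i hi) ht).2)

theorem le_exp_mul {b : ℝ → ℝ} {ε s t : ℝ}
    (h : |b s - b t| ≤ (Real.exp (ε * (t - s)) - 1) * b t) : b s ≤ Real.exp (ε * (t - s)) * b t := by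
  linarith [le_abs_self (b s - b t)]

theorem sq {b : ℝ → ℝ} (h : SlowlyVarying b) : SlowlyVarying fun t => b t ^ 2 := by
  intro ε hε
  obtain ⟨T, hT⟩ := h (ε / 2) (half_pos hε)
  refine ⟨T, fun s t hs ht => ⟨pow_pos (hT s t hs ht).1 2, ?_⟩⟩
  obtain ⟨h1, h2⟩ := hT s t hs ht
  have h3 := (hT t t (hs.trans ht) le_rfl).1
  have h4 := le_exp_mul h2
  have h5 : Real.exp (ε * (t - s)) = Real.exp (ε / 2 * (t - s)) ^ 2 := by
    rw [← Real.exp_nat_mul]; congr 1; push_cast; ring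
  rw [h5, sq_sub_sq, abs_mul, abs_of_pos (add_pos h1 h3)]
  calc _ ≤ ((Real.exp (ε / 2 * (t - s)) + 1) * b t) * ((Real.exp (ε / 2 * (t - s)) - 1) * b t) := by
        refine mul_le_mul (by linarith) h2 (abs_nonneg _) (by positivity)
    _ = _ := by ring

end SlowlyVarying

/-- A moving average of a signal that stays close, relative to a slowly varying scale, to its past
values is asymptotic to the signal. -/
theorem tendsto_ema_sub_div {c A : ℝ} (hc : 0 < c) (hA : 0 ≤ A) {B p r : ℝ → ℝ}
    (hB : SlowlyVarying B) (hp : ∀ᶠ t in atTop, |p t| ≤ A * B t)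
    (hr : ∀ T, 0 ≤ T → IntervalIntegrable r volume 0 T)
    (hrp : ∀ ε > 0, ∃ T, ∀ s t, T ≤ s → s ≤ t →
      |r s - p t| ≤ A * (Real.exp (ε * (1 + (t - s))) - 1) * B t) :
    Tendsto (fun t => (ema c r t - p t) / B t) atTop (𝓝 0) := by
  rw [Metric.tendsto_nhds]
  intro ε₀ hε₀
  -- c e^ε / (c - ε) is the total mass of the kernel c e^{-cs} weighted by the drift bound
  -- e^{ε(1+s)}; it tends to 1 as ε → 0.
  obtain ⟨ε, hε, hεc, hεA⟩ : ∃ ε : ℝ, 0 < ε ∧ ε < c ∧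
      A * (c * Real.exp ε / (c - ε) - 1) < ε₀ / 2 := by
    have h1 : Tendsto (fun ε : ℝ => A * (c * Real.exp ε / (c - ε) - 1)) (𝓝[>] 0)
        (𝓝 (A * (c * Real.exp 0 / (c - 0) - 1))) := by
      refine Tendsto.mono_left ?_ nhdsWithin_le_nhds
      refine ContinuousAt.tendsto (f := fun ε : ℝ => A * (c * Real.exp ε / (c - ε) - 1)) ?_
      have : c - 0 ≠ 0 := by simpa using hc.ne'
      fun_prop (disch := assumption)
    rw [Real.exp_zero, sub_zero, mul_one, div_self hc.ne', sub_self, mul_zero] at h1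
    obtain ⟨ε, h2, h3⟩ := ((h1.eventually (gt_mem_nhds (half_pos hε₀))).and
      (Ioo_mem_nhdsGT hc)).exists
    exact ⟨ε, h3.1, h3.2, h2⟩
  obtain ⟨T₁, hT₁⟩ := hB ε hε
  obtain ⟨T₂, hT₂⟩ := hrp ε hε
  set T := max 0 (max T₁ T₂) with hT
  have hT0 : 0 ≤ T := le_max_left _ _
  have hTT₁ : T₁ ≤ T := (le_max_left _ _).trans (le_max_right _ _)
  have hTT₂ : T₂ ≤ T := (le_max_right _ _).trans (le_max_right _ _)
  have hlim : Tendsto (fun t => Real.exp (-(c - ε) * (t - T)) * (|ema c r T| / B T) +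
      Real.exp (-c * (t - T)) * (2 * A)) atTop (𝓝 (0 * (|ema c r T| / B T) + 0 * (2 * A))) := by
    have h1 : ∀ a : ℝ, 0 < a → Tendsto (fun t => Real.exp (-a * (t - T))) atTop (𝓝 0) := fun a ha =>
      Real.tendsto_exp_atBot.comp ((tendsto_const_mul_atBot_of_neg (neg_lt_zero.2 ha)).2
        (tendsto_atTop_add_const_right atTop (-T) tendsto_id))
    exact ((h1 _ (sub_pos.2 hεc)).mul_const _).add ((h1 _ hc).mul_const _)
  rw [zero_mul, zero_mul, add_zero] at hlim
  filter_upwards [hlim.eventually (gt_mem_nhds (half_pos hε₀)), eventually_ge_atTop T, hp]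
    with t h1 ht hpt
  have hBt := (hT₁ t t (hTT₁.trans ht) le_rfl).1
  have hBT := hT₁ T t hTT₁ ht
  have i1 : IntervalIntegrable r volume T t := (hr t (hT0.trans ht)).mono_set (by
    rw [Set.uIcc_of_le ht, Set.uIcc_of_le (hT0.trans ht)]
    exact Set.Icc_subset_Icc_left hT0)
  set x := Real.exp (-c * (t - T)) with hx
  have hx0 : 0 < x := Real.exp_pos _
  -- Three errors: the memory of time `T`, the kernel mass missing before `T`, and the drift of the
  -- signal since `T`.
  have e1 : ema c r t - p t = x * ema c r T - x * p t +
      ∫ s in T..t, c * Real.exp (-c * (t - s)) * (r s - p t) := by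
    have : ∫ s in T..t, c * Real.exp (-c * (t - s)) * (r s - p t) =
        (∫ s in T..t, c * Real.exp (-c * (t - s)) * r s) - (1 - x) * p t := by
      rw [hx, ← integral_emaKernel c T t, ← intervalIntegral.integral_mul_const,
        ← intervalIntegral.integral_sub (intervalIntegrable_emaKernel_mul c t i1)
          (Continuous.intervalIntegrable (by fun_prop) _ _)]
      congr 1
      funext s
      ring
    rw [this, ema_split (c := c) (hr T hT0) i1]
    ring
  have e2 : |∫ s in T..t, c * Real.exp (-c * (t - s)) * (r s - p t)| ≤
      A * B t * (c * Real.exp ε / (c - ε) - 1 + x) := by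
    have h2 := intervalIntegral.norm_integral_le_of_norm_le (a := T) (b := t) (μ := volume)
      (f := fun s => c * Real.exp (-c * (t - s)) * (r s - p t))
      (g := fun s => A * B t * (c * Real.exp ε * Real.exp (-(c - ε) * (t - s)) -
        c * Real.exp (-c * (t - s)))) ht (Eventually.of_forall fun s hs => by
          rw [norm_mul, Real.norm_of_nonneg (mul_nonneg hc.le (Real.exp_nonneg _))]
          have h3 := mul_le_mul_of_nonneg_left (hT₂ s t (hTT₂.trans hs.1.le) hs.2)
            (mul_nonneg hc.le (Real.exp_nonneg (-c * (t - s))))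
          refine h3.trans (le_of_eq ?_)
          have h4 : Real.exp ε * Real.exp (-(c - ε) * (t - s)) =
              Real.exp (-c * (t - s)) * Real.exp (ε * (1 + (t - s))) := by
            rw [← Real.exp_add, ← Real.exp_add]; congr 1; ring
          linear_combination -A * B t * c * h4)
      (Continuous.intervalIntegrable (by fun_prop) _ _)
    refine h2.trans ?_
    rw [intervalIntegral.integral_const_mul]
    refine mul_le_mul_of_nonneg_left ?_ (mul_nonneg hA hBt.le)
    rw [intervalIntegral.integral_sub (Continuous.intervalIntegrable (by fun_prop) _ _)
      (Continuous.intervalIntegrable (by fun_prop) _ _), integral_emaKernel]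
    have h5 : ∫ s in T..t, c * Real.exp ε * Real.exp (-(c - ε) * (t - s)) =
        c * Real.exp ε / (c - ε) * (1 - Real.exp (-(c - ε) * (t - T))) := by
      rw [← integral_emaKernel, ← intervalIntegral.integral_const_mul]
      congr 1
      funext s
      have := (sub_pos.2 hεc).ne'
      field_simp
    rw [h5]
    have h6 : 0 ≤ c * Real.exp ε / (c - ε) * Real.exp (-(c - ε) * (t - T)) := by
      have := (sub_pos.2 hεc).le
      positivity
    linarith
  -- The memory decays like e^{-ct}, while a slowly varying `B` loses at most a factor e^{-εt} with
  -- ε < c.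
  have e3 : x * (|ema c r T|) ≤ Real.exp (-(c - ε) * (t - T)) * (|ema c r T| / B T) * B t := by
    have h2 := SlowlyVarying.le_exp_mul hBT.2
    have h3 : x = Real.exp (-(c - ε) * (t - T)) * Real.exp (-(ε * (t - T))) := by
      rw [hx, ← Real.exp_add]; congr 1; ring
    have h4 : Real.exp (-(ε * (t - T))) * B T ≤ B t := by
      rw [Real.exp_neg, inv_mul_le_iff₀ (Real.exp_pos _)]
      exact h2
    have h5 : Real.exp (-(ε * (t - T))) ≤ B t / B T := by rwa [le_div_iff₀ hBT.1]
    rw [h3]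
    calc _ ≤ Real.exp (-(c - ε) * (t - T)) * (B t / B T) * |ema c r T| := by gcongr
      _ = _ := by ring
  rw [Real.dist_eq, sub_zero, abs_div, abs_of_pos hBt, div_lt_iff₀ hBt, e1]
  have e4 : |x * ema c r T - x * p t + ∫ s in T..t, c * Real.exp (-c * (t - s)) * (r s - p t)| ≤
      x * |ema c r T| + x * (A * B t) + A * B t * (c * Real.exp ε / (c - ε) - 1 + x) := by
    refine (abs_add_le _ _).trans (add_le_add ((abs_sub _ _).trans ?_) e2)
    rw [abs_mul, abs_mul, abs_of_pos hx0]
    gcongr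
  have e5 := mul_lt_mul_of_pos_right h1 hBt
  have e6 := mul_lt_mul_of_pos_right hεA hBt
  nlinarith


/-! ### Spectral norm -/

section SpectralNorm

variable {a b : ℕ}

open scoped Matrix.Norms.L2Operator

theorem spNorm_add_le (W W' : Matrix (Fin a) (Fin b) ℝ) : spNorm (W + W') ≤ spNorm W + spNorm W' :=
  norm_add_le _ _

theorem spNorm_smul (r : ℝ) (W : Matrix (Fin a) (Fin b) ℝ) : spNorm (r • W) = |r| * spNorm W :=
  norm_smul r W

theorem abs_apply_le_spNorm (W : Matrix (Fin a) (Fin b) ℝ) (i : Fin a) (j : Fin b) :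
    |W i j| ≤ spNorm W := by
  have h1 := W.l2_opNorm_mulVec (EuclideanSpace.single j (1 : ℝ))
  rw [PiLp.norm_single, norm_one, mul_one] at h1
  refine le_trans ?_ h1
  have h2 := PiLp.norm_apply_le ((EuclideanSpace.equiv (Fin a) ℝ).symm
    (W *ᵥ (EuclideanSpace.single j (1 : ℝ)))) i
  simpa using h2

theorem spNorm_le_one_of_transpose_mul_self {U : Matrix (Fin a) (Fin b) ℝ} (hU : Uᵀ * U = 1) :
    spNorm U ≤ 1 := by
  have h1 := U.l2_opNorm_conjTranspose_mul_self
  rw [Matrix.conjTranspose_eq_transpose_of_trivial, hU] at h1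
  have h2 : ‖(1 : Matrix (Fin b) (Fin b) ℝ)‖ ≤ 1 := by
    rw [← Matrix.diagonal_one, Matrix.l2_opNorm_diagonal]
    exact (pi_norm_le_iff_of_nonneg zero_le_one).2 fun _ => by simp
  rw [h1] at h2
  change ‖U‖ ≤ 1
  nlinarith [norm_nonneg U]

theorem spNorm_mul_transpose_le {r : ℕ} {U : Matrix (Fin a) (Fin r) ℝ} {V : Matrix (Fin b) (Fin r) ℝ}
    (hU : Uᵀ * U = 1) (hV : Vᵀ * V = 1) : spNorm (U * Vᵀ) ≤ 1 := by
  refine (Matrix.l2_opNorm_mul U Vᵀ).trans ?_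
  have h1 : ‖Vᵀ‖ = ‖V‖ := by
    rw [← Matrix.conjTranspose_eq_transpose_of_trivial]
    exact V.l2_opNorm_conjTranspose
  rw [h1]
  exact mul_le_one₀ (spNorm_le_one_of_transpose_mul_self hU) (norm_nonneg _)
    (spNorm_le_one_of_transpose_mul_self hV)

theorem IsOrthogonalization.spNorm_le_one {M P : Matrix (Fin a) (Fin b) ℝ}
    (h : IsOrthogonalization M P) : spNorm P ≤ 1 := by
  obtain ⟨r, U, V, σ, hU, hV, -, -, rfl⟩ := h
  exact spNorm_mul_transpose_le hU hV

/-- The orthogonalization attains the dual norm of the spectral norm. -/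
theorem IsOrthogonalization.trace_le {M P : Matrix (Fin a) (Fin b) ℝ}
    (h : IsOrthogonalization M P) {D : Matrix (Fin a) (Fin b) ℝ} {ρ : ℝ} (hD : spNorm D ≤ ρ) :
    (Mᵀ * D).trace ≤ ρ * (Mᵀ * P).trace := by
  obtain ⟨r, U, V, σ, hU, hV, hσ, rfl, rfl⟩ := h
  have key : ∀ D' : Matrix (Fin a) (Fin b) ℝ,
      ((U * Matrix.diagonal σ * Vᵀ)ᵀ * D').trace = ∑ i, σ i * (Uᵀ * D' * V) i i := by
    intro D'
    rw [Matrix.transpose_mul, Matrix.transpose_transpose, Matrix.transpose_mul,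
      Matrix.diagonal_transpose, Matrix.mul_assoc, Matrix.trace_mul_comm, Matrix.mul_assoc,
      Matrix.mul_assoc, ← Matrix.mul_assoc Uᵀ D' V]
    simp [Matrix.trace, Matrix.diagonal_mul]
  rw [key, key, Finset.mul_sum]
  refine Finset.sum_le_sum fun i _ => ?_
  have h1 : Uᵀ * (U * Vᵀ) * V = 1 := by
    rw [← Matrix.mul_assoc, hU, Matrix.one_mul, hV]
  rw [h1, Matrix.one_apply_eq, mul_one, mul_comm]
  refine mul_le_mul_of_nonneg_right ?_ (hσ i).le
  have h2 : ‖Uᵀ‖ ≤ 1 := by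
    rw [← Matrix.conjTranspose_eq_transpose_of_trivial, U.l2_opNorm_conjTranspose]
    exact spNorm_le_one_of_transpose_mul_self hU
  have h3 : ‖V‖ ≤ 1 := spNorm_le_one_of_transpose_mul_self hV
  calc (Uᵀ * D * V) i i ≤ ‖Uᵀ * D * V‖ := (le_abs_self _).trans (abs_apply_le_spNorm _ i i)
    _ ≤ ‖Uᵀ‖ * ‖D‖ * ‖V‖ := (Matrix.l2_opNorm_mul _ _).trans
        (mul_le_mul_of_nonneg_right (Matrix.l2_opNorm_mul _ _) (norm_nonneg _))
    _ ≤ 1 * ‖D‖ * 1 := by gcongr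
    _ ≤ ρ := by rw [one_mul, mul_one]; exact hD

theorem trace_transpose_mul (M D : Matrix (Fin a) (Fin b) ℝ) :
    (Mᵀ * D).trace = ∑ ij : Fin a × Fin b, M ij.1 ij.2 * D ij.1 ij.2 := by
  rw [Fintype.sum_prod_type_right]
  simp [Matrix.trace, Matrix.mul_apply]

/-- Triangle inequality for the spectral norm of an integral. -/
theorem spNorm_add_integral_le {W : ℝ → Matrix (Fin a) (Fin b) ℝ} {κ : ℝ → ℝ} {s t : ℝ} (hst : s ≤ t)
    {W₀ W₁ : Matrix (Fin a) (Fin b) ℝ}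
    (hW : ∀ i j, IntervalIntegrable (fun r => W r i j) volume s t)
    (hW₁ : ∀ i j, W₁ i j = W₀ i j + ∫ r in s..t, W r i j)
    (hκ : IntervalIntegrable κ volume s t)
    (hle : ∀ᵐ r, r ∈ Set.Ioc s t → spNorm (W r) ≤ κ r) :
    spNorm W₁ ≤ spNorm W₀ + ∫ r in s..t, κ r := by
  -- Expansion in matrix units turns the entrywise integrals into one matrix-valued integral, to
  -- which the norm inequality applies.
  have hdec : ∀ A : Matrix (Fin a) (Fin b) ℝ,
      A = ∑ ij : Fin a × Fin b, A ij.1 ij.2 • Matrix.single ij.1 ij.2 (1 : ℝ) := fun A => by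
    conv_lhs => rw [Matrix.matrix_eq_sum_single A]
    rw [Fintype.sum_prod_type]
    simp [Matrix.smul_single]
  have hint : ∀ ij ∈ (Finset.univ : Finset (Fin a × Fin b)),
      IntervalIntegrable (fun r => W r ij.1 ij.2 • Matrix.single ij.1 ij.2 (1 : ℝ)) volume s t :=
    fun ij _ => ⟨(hW _ _).1.smul_const _, (hW _ _).2.smul_const _⟩
  have hW₁' : W₁ = W₀ + ∫ r in s..t, W r := by
    have e1 : ∫ r in s..t, W r =
        ∫ r in s..t, ∑ ij : Fin a × Fin b, W r ij.1 ij.2 • Matrix.single ij.1 ij.2 (1 : ℝ) :=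
      intervalIntegral.integral_congr fun r _ => hdec (W r)
    rw [e1, intervalIntegral.integral_finsetSum hint]
    simp_rw [intervalIntegral.integral_smul_const]
    conv_lhs => rw [hdec W₁]
    conv_rhs => rw [hdec W₀]
    rw [← Finset.sum_add_distrib]
    exact Finset.sum_congr rfl fun ij _ => by rw [hW₁, add_smul]
  rw [hW₁']
  refine (spNorm_add_le _ _).trans (add_le_add_right ?_ _)
  exact intervalIntegral.norm_integral_le_of_norm_le hst hle hκ

end SpectralNorm

/-! ### The hybrid norm -/

section HybridNorm

variable {K : ℕ} {rows cols : Fin K → ℕ} {q : ℕ} {α : ℝ}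

theorem matPart_add (θ θ' : Param rows cols q) (k : Fin K) :
    matPart (θ + θ') k = matPart θ k + matPart θ' k := rfl

theorem matPart_smul (r : ℝ) (θ : Param rows cols q) (k : Fin K) :
    matPart (r • θ) k = r • matPart θ k := rfl

/-- Reduces norm bounds to separate bounds per block. Nonnegativity of `r` covers the cases with no
matrix or no vector coordinate, where the suprema are 0. -/
theorem hybridNorm_le_iff (hα : 0 ≤ α) {θ : Param rows cols q} {r : ℝ} (hr : 0 ≤ r) :
    hybridNorm α θ ≤ r ↔ (∀ k, α * spNorm (matPart θ k) ≤ r) ∧ ∀ j, |vecPart θ j| ≤ r := by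
  rw [hybridNorm, max_le_iff, pi_norm_le_iff_of_nonneg hr, Real.mul_iSup_of_nonneg hα]
  refine and_congr ⟨fun h k => ?_, fun h => Real.iSup_le h hr⟩ Iff.rfl
  exact (le_ciSup (f := fun k => α * spNorm (matPart θ k)) (Set.finite_range _).bddAbove k).trans h

theorem hybridNorm_nonneg (α : ℝ) (θ : Param rows cols q) : 0 ≤ hybridNorm α θ :=
  (norm_nonneg _).trans (le_max_right _ _)

theorem mul_spNorm_le_hybridNorm (hα : 0 ≤ α) (θ : Param rows cols q) (k : Fin K) :
    α * spNorm (matPart θ k) ≤ hybridNorm α θ :=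
  ((hybridNorm_le_iff hα (hybridNorm_nonneg α θ)).1 le_rfl).1 k

theorem abs_vecPart_le_hybridNorm (hα : 0 ≤ α) (θ : Param rows cols q) (j : Fin q) :
    |vecPart θ j| ≤ hybridNorm α θ :=
  ((hybridNorm_le_iff hα (hybridNorm_nonneg α θ)).1 le_rfl).2 j

/-- The hybrid norm as a seminorm. -/
noncomputable def hybridSeminorm (hα : 0 ≤ α) : Seminorm ℝ (Param rows cols q) :=
  Seminorm.ofSMulLE (hybridNorm α)
    (le_antisymm ((hybridNorm_le_iff hα le_rfl).2 ⟨fun k => by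
      have : matPart (0 : Param rows cols q) k = (0 : ℝ) • 0 := by
        rw [zero_smul]; rfl
      rw [this, spNorm_smul]; simp, fun j => by simp [vecPart]⟩) (hybridNorm_nonneg α _))
    (fun θ θ' => (hybridNorm_le_iff hα (add_nonneg (hybridNorm_nonneg α _)
      (hybridNorm_nonneg α _))).2 ⟨fun k => by
        rw [matPart_add]
        have h1 := mul_spNorm_le_hybridNorm hα θ k
        have h2 := mul_spNorm_le_hybridNorm hα θ' k
        have h3 := mul_le_mul_of_nonneg_left (spNorm_add_le (matPart θ k) (matPart θ' k)) hα
        linarith, fun j => (abs_add_le _ _).trans (add_le_add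
          (abs_vecPart_le_hybridNorm hα θ j) (abs_vecPart_le_hybridNorm hα θ' j))⟩)
    (fun r θ => (hybridNorm_le_iff hα (mul_nonneg (norm_nonneg _) (hybridNorm_nonneg α _))).2
      ⟨fun k => by
        rw [matPart_smul, spNorm_smul, Real.norm_eq_abs, mul_left_comm]
        exact mul_le_mul_of_nonneg_left (mul_spNorm_le_hybridNorm hα θ k) (abs_nonneg r),
      fun j => by
        have : vecPart (r • θ) j = r * vecPart θ j := rfl
        rw [this, abs_mul]
        exact mul_le_mul_of_nonneg_left (abs_vecPart_le_hybridNorm hα θ j) (abs_nonneg r)⟩)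

theorem coe_hybridSeminorm (hα : 0 ≤ α) :
    ⇑(hybridSeminorm hα : Seminorm ℝ (Param rows cols q)) = hybridNorm α := rfl

theorem abs_apply_le_hybridNorm (hα : 0 < α) (θ : Param rows cols q) (idx : ParamIndex rows cols q) :
    |θ idx| ≤ (1 + α⁻¹) * hybridNorm α θ := by
  have h0 := hybridNorm_nonneg α θ
  rcases idx with ⟨k, i, j⟩ | j
  · have h1 : |θ (Sum.inl ⟨k, i, j⟩)| ≤ spNorm (matPart θ k) := abs_apply_le_spNorm (matPart θ k) i j
    have h2 := mul_spNorm_le_hybridNorm hα.le θ k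
    have h3 : spNorm (matPart θ k) ≤ α⁻¹ * hybridNorm α θ := by
      rwa [le_inv_mul_iff₀ hα]
    linarith
  · have h1 := abs_vecPart_le_hybridNorm hα.le θ j
    have h2 : 0 ≤ α⁻¹ * hybridNorm α θ := by positivity
    change |vecPart θ j| ≤ _
    linarith

theorem exists_norm_le_mul_hybridNorm (hα : 0 < α) :
    ∃ C, 0 < C ∧ ∀ θ : Param rows cols q, ‖θ‖ ≤ C * hybridNorm α θ := by
  refine ⟨(Fintype.card (ParamIndex rows cols q) + 1) * (1 + α⁻¹), by positivity, fun θ => ?_⟩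
  have h1 : ‖θ‖ ≤ ∑ idx, |θ idx| := by
    conv_lhs => rw [← (EuclideanSpace.basisFun (ParamIndex rows cols q) ℝ).sum_repr θ]
    refine (norm_sum_le _ _).trans (le_of_eq (Finset.sum_congr rfl fun idx _ => ?_))
    rw [norm_smul, (EuclideanSpace.basisFun (ParamIndex rows cols q) ℝ).orthonormal.1 idx, mul_one]
    simp
  have h3 := Finset.sum_le_card_nsmul Finset.univ _ _ fun idx _ => abs_apply_le_hybridNorm hα θ idx
  rw [nsmul_eq_mul, Finset.card_univ] at h3
  have h4 := hybridNorm_nonneg α θ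
  have h5 : 0 ≤ (1 + α⁻¹) * hybridNorm α θ := by positivity
  linarith

theorem continuous_hybridNorm (hα : 0 ≤ α) :
    Continuous (hybridNorm α : Param rows cols q → ℝ) := by
  rw [← coe_hybridSeminorm hα]
  exact (hybridSeminorm hα).convexOn.locallyLipschitz.continuous

theorem exists_hybridNorm_le_mul_norm (hα : 0 ≤ α) :
    ∃ C, 0 < C ∧ ∀ θ : Param rows cols q, hybridNorm α θ ≤ C * ‖θ‖ := by
  obtain ⟨C, hC, h⟩ := Seminorm.bound_of_continuous_normedSpace
    (hybridSeminorm hα : Seminorm ℝ (Param rows cols q)) (continuous_hybridNorm hα)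
  exact ⟨C, hC, h⟩

theorem inner_eq_sum_trace_add_sum (p d : Param rows cols q) :
    inner ℝ p d = ∑ k, ((matPart p k)ᵀ * matPart d k).trace + ∑ j, vecPart p j * vecPart d j := by
  rw [PiLp.inner_apply, Fintype.sum_sum_type, Fintype.sum_sigma]
  simp_rw [trace_transpose_mul]
  simp [matPart, vecPart, mul_comm]

end HybridNorm


/-! ### Muon-Adam trajectories -/

/-- Trajectories of Muon and Adam driven by a locally bounded signal `g`, with velocity `v`. -/
structure MuonAdamFlow {K : ℕ} {rows cols : Fin K → ℕ} {q : ℕ} (ηM ηA cM c₁ c₂ : ℝ) (η : ℝ → ℝ)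
    (θ v g : ℝ → Param rows cols q) : Prop where
  ηM_pos : 0 < ηM
  ηA_pos : 0 < ηA
  cM_pos : 0 < cM
  c₂_pos : 0 < c₂
  c₂_le : c₂ ≤ c₁
  η_pos : ∀ t, 0 ≤ t → 0 < η t
  η_antitone : AntitoneOn η (Set.Ici 0)
  arc : IsArc θ v
  measurable : AEStronglyMeasurable g (volume.restrict (Set.Ici 0))
  bounded : ∀ T, ∃ M, ∀ t ∈ Set.Icc 0 T, ‖g t‖ ≤ M
  update : ∀ᵐ t ∂(volume.restrict (Set.Ioi (0 : ℝ))),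
      (∀ k, ∃ P : Matrix (Fin (rows k)) (Fin (cols k)) ℝ,
        IsOrthogonalization
          (Matrix.of fun i j => ema cM (fun s => matPart (g s) k i j) t) P ∧
        matPart (v t) k = -(ηM * η t) • P) ∧
      ∀ j, vecPart (v t) j = -(ηA * η t) * adamRatio c₁ c₂ (fun s => vecPart (g s) j) t

namespace MuonAdamFlow

variable {K : ℕ} {rows cols : Fin K → ℕ} {q : ℕ} {ηM ηA cM c₁ c₂ : ℝ} {η : ℝ → ℝ}
  {θ v g : ℝ → Param rows cols q}

theorem integrableOn_apply (hF : MuonAdamFlow ηM ηA cM c₁ c₂ η θ v g) (idx : ParamIndex rows cols q)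
    {T : ℝ} (hT : 0 ≤ T) : IntervalIntegrable (fun t => g t idx) volume 0 T := by
  obtain ⟨M, hM⟩ := hF.bounded T
  rw [intervalIntegrable_iff_integrableOn_Ioc_of_le hT]
  have hsub : Set.Ioc 0 T ⊆ Set.Ici (0 : ℝ) := fun t ht => ht.1.le
  have hmeas : AEStronglyMeasurable (fun t => g t idx) (volume.restrict (Set.Ioc 0 T)) :=
    (EuclideanSpace.proj (𝕜 := ℝ) idx).continuous.comp_aestronglyMeasurable
      (hF.measurable.mono_measure (Measure.restrict_mono hsub le_rfl))
  refine Integrable.of_bound hmeas M ?_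
  refine (ae_restrict_iff' measurableSet_Ioc).2 (Eventually.of_forall fun t ht => ?_)
  exact (PiLp.norm_apply_le (g t) idx).trans (hM t (Set.Ioc_subset_Icc_self ht))

theorem integrableOn_apply_sq (hF : MuonAdamFlow ηM ηA cM c₁ c₂ η θ v g)
    (idx : ParamIndex rows cols q) {T : ℝ} (hT : 0 ≤ T) :
    IntervalIntegrable (fun t => g t idx ^ 2) volume 0 T := by
  obtain ⟨M, hM⟩ := hF.bounded T
  have h1 := hF.integrableOn_apply idx hT
  rw [intervalIntegrable_iff_integrableOn_Ioc_of_le hT] at h1 ⊢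
  refine Integrable.of_bound (h1.aestronglyMeasurable.pow 2) (M ^ 2) ?_
  refine (ae_restrict_iff' measurableSet_Ioc).2 (Eventually.of_forall fun t ht => ?_)
  rw [norm_pow]
  exact pow_le_pow_left₀ (norm_nonneg _)
    ((PiLp.norm_apply_le (g t) idx).trans (hM t (Set.Ioc_subset_Icc_self ht))) 2

theorem intervalIntegrable_η (hF : MuonAdamFlow ηM ηA cM c₁ c₂ η θ v g) {s t : ℝ} (hs : 0 ≤ s)
    (hst : s ≤ t) : IntervalIntegrable η volume s t :=
  AntitoneOn.intervalIntegrable (hF.η_antitone.mono (by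
    rw [Set.uIcc_of_le hst]; exact fun r hr => hs.trans hr.1))

theorem intervalIntegrable_velocity (hF : MuonAdamFlow ηM ηA cM c₁ c₂ η θ v g) {s t : ℝ} (hs : 0 ≤ s)
    (hst : s ≤ t) : IntervalIntegrable v volume s t := by
  rw [intervalIntegrable_iff_integrableOn_Icc_of_le hst]
  exact hF.arc.1.integrableOn_compact_subset (fun r hr => hs.trans hr.1) isCompact_Icc

theorem intervalIntegrable_velocity_apply (hF : MuonAdamFlow ηM ηA cM c₁ c₂ η θ v g)
    (idx : ParamIndex rows cols q) {s t : ℝ} (hs : 0 ≤ s) (hst : s ≤ t) :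
    IntervalIntegrable (fun r => v r idx) volume s t := by
  have h1 := hF.intervalIntegrable_velocity hs hst
  exact ⟨(EuclideanSpace.proj (𝕜 := ℝ) idx).integrable_comp h1.1,
    (EuclideanSpace.proj (𝕜 := ℝ) idx).integrable_comp h1.2⟩

theorem eq_add_integral (hF : MuonAdamFlow ηM ηA cM c₁ c₂ η θ v g) {s t : ℝ} (hs : 0 ≤ s)
    (hst : s ≤ t) : θ t = θ s + ∫ r in s..t, v r := by
  rw [hF.arc.2 t (hs.trans hst), hF.arc.2 s hs, add_assoc,
    intervalIntegral.integral_add_adjacent_intervals (hF.intervalIntegrable_velocity le_rfl hs)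
      (hF.intervalIntegrable_velocity hs hst)]

theorem apply_eq_add_integral (hF : MuonAdamFlow ηM ηA cM c₁ c₂ η θ v g)
    (idx : ParamIndex rows cols q) {s t : ℝ} (hs : 0 ≤ s) (hst : s ≤ t) :
    θ t idx = θ s idx + ∫ r in s..t, v r idx := by
  rw [hF.eq_add_integral hs hst]
  have : ∫ r in s..t, v r idx = (∫ r in s..t, v r) idx :=
    (EuclideanSpace.proj (𝕜 := ℝ) idx).intervalIntegral_comp_comm
      (hF.intervalIntegrable_velocity hs hst)
  rw [this]
  rfl

theorem ae_hasDerivAt (hF : MuonAdamFlow ηM ηA cM c₁ c₂ η θ v g) :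
    ∀ᵐ t, 0 < t → HasDerivAt θ (v t) t := by
  have h1 : ∀ᵐ t, ∀ n : ℕ, t ∈ Set.uIcc (0 : ℝ) n → ∀ a ∈ Set.uIcc (0 : ℝ) n,
      HasDerivAt (fun x => ∫ s in a..x, v s) (v t) t :=
    ae_all_iff.2 fun n => (hF.intervalIntegrable_velocity le_rfl n.cast_nonneg).ae_hasDerivAt_integral
  filter_upwards [h1] with t ht ht0
  obtain ⟨n, hn⟩ := exists_nat_ge t
  have h2 := ht n (by rw [Set.uIcc_of_le n.cast_nonneg]; exact ⟨ht0.le, hn⟩) 0 (by simp)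
  refine (h2.const_add (θ 0)).congr_of_eventuallyEq ?_
  filter_upwards [lt_mem_nhds ht0] with s hs using hF.arc.2 s hs.le

/-- Muon steps have spectral norm at most 1 and Adam ratios are at most √(c₁/c₂), regardless of the
gradient, so the speed is controlled by η alone. -/
theorem exists_velocity_bound (hF : MuonAdamFlow ηM ηA cM c₁ c₂ η θ v g) :
    ∃ R, 0 < R ∧ ∀ᵐ t, 0 < t → ‖v t‖ ≤ R * η t := by
  have hα : 0 < ηA / ηM := div_pos hF.ηA_pos hF.ηM_pos
  obtain ⟨C, hC, hN⟩ := exists_norm_le_mul_hybridNorm (rows := rows) (cols := cols) (q := q) hα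
  refine ⟨C * (ηA * (1 + Real.sqrt (c₁ / c₂))), by have := hF.ηA_pos; positivity, ?_⟩
  filter_upwards [(ae_restrict_iff' measurableSet_Ioi).1 hF.update] with t ht ht0
  obtain ⟨h1, h2⟩ := ht ht0
  have hη := hF.η_pos t ht0.le
  have hηA := hF.ηA_pos
  have hηM := hF.ηM_pos
  have hs := Real.sqrt_nonneg (c₁ / c₂)
  refine (hN _).trans ?_
  rw [mul_assoc]
  refine mul_le_mul_of_nonneg_left ((hybridNorm_le_iff hα.le (by positivity)).2
    ⟨fun k => ?_, fun j => ?_⟩) hC.le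
  · obtain ⟨P, hP, hv⟩ := h1 k
    rw [hv, spNorm_smul, abs_neg, abs_of_pos (by positivity)]
    have h3 : ηA / ηM * (ηM * η t * spNorm P) = ηA * η t * spNorm P := by field_simp
    rw [h3]
    have h4 : ηA * η t * spNorm P ≤ ηA * η t * 1 :=
      mul_le_mul_of_nonneg_left hP.spNorm_le_one (by positivity)
    nlinarith [mul_pos hηA hη]
  · rw [h2 j, abs_mul, abs_neg, abs_of_pos (by positivity)]
    have h4 : ηA * η t * |adamRatio c₁ c₂ (fun s => vecPart (g s) j) t| ≤
        ηA * η t * Real.sqrt (c₁ / c₂) :=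
      mul_le_mul_of_nonneg_left (abs_adamRatio_le hF.c₂_pos hF.c₂_le ht0
        (hF.integrableOn_apply (Sum.inr j) ht0.le) (hF.integrableOn_apply_sq (Sum.inr j) ht0.le))
        (by positivity)
    nlinarith [mul_pos hηA hη]

theorem norm_sub_le (hF : MuonAdamFlow ηM ηA cM c₁ c₂ η θ v g) {R : ℝ}
    (hR : 0 < R) (hv : ∀ᵐ t, 0 < t → ‖v t‖ ≤ R * η t) {s t : ℝ} (hs : 0 ≤ s) (hst : s ≤ t) :
    ‖θ t - θ s‖ ≤ R * η s * (t - s) := by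
  rw [hF.eq_add_integral hs hst, add_sub_cancel_left]
  have := intervalIntegral.norm_integral_le_of_norm_le_const_ae (a := s) (b := t) (f := v)
    (C := R * η s) (by
      filter_upwards [hv] with r hr hr'
      rw [Set.uIoc_of_le hst] at hr'
      exact (hr (hs.trans_lt hr'.1)).trans
        (mul_le_mul_of_nonneg_left (hF.η_antitone hs (hs.trans hr'.1.le) hr'.1.le) hR.le))
  rwa [abs_of_nonneg (sub_nonneg.2 hst)] at this

theorem lipschitzOnWith (hF : MuonAdamFlow ηM ηA cM c₁ c₂ η θ v g) {R : ℝ}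
    (hR : 0 < R) (hv : ∀ᵐ t, 0 < t → ‖v t‖ ≤ R * η t) :
    LipschitzOnWith (Real.toNNReal (R * η 0)) θ (Set.Ici 0) := by
  have h0 := hF.η_pos 0 le_rfl
  have key : ∀ s t, 0 ≤ s → s ≤ t → ‖θ t - θ s‖ ≤ R * η 0 * (t - s) := fun s t hs hst =>
    (hF.norm_sub_le hR hv hs hst).trans (mul_le_mul_of_nonneg_right
      (mul_le_mul_of_nonneg_left (hF.η_antitone (Set.mem_Ici.2 le_rfl) hs hs) hR.le)
      (sub_nonneg.2 hst))
  refine LipschitzOnWith.of_dist_le_mul fun x hx y hy => ?_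
  rw [Real.coe_toNNReal _ (by positivity), dist_eq_norm, Real.dist_eq]
  rcases le_total x y with h | h
  · rw [norm_sub_rev, abs_sub_comm, abs_of_nonneg (sub_nonneg.2 h)]
    exact key x y hx h
  · rw [abs_of_nonneg (sub_nonneg.2 h)]
    exact key y x hy h

end MuonAdamFlow

/-! ### Growth of Adam coordinates -/

section AdamGrowth

variable {c₁ c₂ : ℝ} {g : ℝ → ℝ}

theorem tendsto_one_sub_exp_neg {c : ℝ} (hc : 0 < c) :
    Tendsto (fun t => 1 - Real.exp (-c * t)) atTop (𝓝 1) := by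
  have : Tendsto (fun t => Real.exp (-c * t)) atTop (𝓝 0) :=
    Real.tendsto_exp_atBot.comp ((tendsto_const_mul_atBot_of_neg (neg_lt_zero.2 hc)).2 tendsto_id)
  simpa using this.const_sub 1

theorem adamRatio_eq_mul {t : ℝ} (hc₂ : 0 ≤ c₂) (ht : 0 ≤ t) :
    adamRatio c₁ c₂ g t = ((1 - Real.exp (-c₁ * t))⁻¹ * Real.sqrt (1 - Real.exp (-c₂ * t))) *
      (ema c₁ g t / Real.sqrt (ema c₂ (fun s => g s ^ 2) t)) := by
  have h : 0 ≤ 1 - Real.exp (-c₂ * t) := by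
    rw [sub_nonneg, Real.exp_le_one_iff]
    nlinarith [mul_nonneg hc₂ ht]
  rw [adamRatio, Real.sqrt_mul (inv_nonneg.2 h), Real.sqrt_inv]
  simp only [div_eq_mul_inv, mul_inv, inv_inv]
  ring

theorem adamRatio_neg (c₁ c₂ : ℝ) (g : ℝ → ℝ) (t : ℝ) :
    adamRatio c₁ c₂ (fun s => -g s) t = -adamRatio c₁ c₂ g t := by
  simp only [adamRatio, ema_neg, neg_sq]
  ring

/-- The accumulated Adam update is at most the accumulated learning rate, up to lower order. -/
theorem eventually_integral_mul_adamRatio_le {η : ℝ → ℝ} {M τ ε : ℝ} (hc₂ : 0 < c₂) (hc : c₂ ≤ c₁)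
    (hη0 : ∀ t, 0 ≤ t → 0 < η t) (hη : AntitoneOn η (Set.Ici 0))
    (hg : ∀ T, 0 ≤ T → IntervalIntegrable g volume 0 T)
    (hg2 : ∀ T, 0 ≤ T → IntervalIntegrable (fun s => g s ^ 2) volume 0 T)
    (hM : ∀ s, 0 ≤ s → |g s| ≤ M) (hτ : 0 < τ) (hpos : 0 < ema c₂ (fun s => g s ^ 2) τ)
    (hε : 0 < ε) :
    ∀ᶠ T in atTop, ∃ C, ∀ t, T ≤ t →
      ∫ s in T..t, η s * adamRatio c₁ c₂ g s ≤ (1 + ε) * (∫ s in T..t, η s) + C := by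
  have hc₁ : 0 < c₁ := hc₂.trans_le hc
  set ρ := Real.sqrt (c₁ / c₂) with hρ
  set A : ℝ → ℝ := fun s => ema c₁ g s / Real.sqrt (ema c₂ (fun s => g s ^ 2) s) with hAdef
  set β : ℝ → ℝ := fun s => (1 - Real.exp (-c₁ * s))⁻¹ * Real.sqrt (1 - Real.exp (-c₂ * s)) with hβ
  have hβ1 : Tendsto (fun s => |β s - 1| * ρ) atTop (𝓝 0) := by
    have h1 : Tendsto β atTop (𝓝 (1⁻¹ * Real.sqrt 1)) :=
      ((tendsto_one_sub_exp_neg hc₁).inv₀ one_ne_zero).mul (tendsto_one_sub_exp_neg hc₂).sqrt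
    rw [inv_one, Real.sqrt_one, mul_one] at h1
    simpa using ((h1.sub_const 1).abs).mul_const ρ
  -- `T` is taken so late that replacing the bias-corrected ratio β A by A costs at most ε.
  filter_upwards [eventually_forall_ge_atTop.2 (hβ1.eventually (gt_mem_nhds hε)), eventually_ge_atTop τ]
    with T hT1 hT2
  have hT0 : 0 < T := hτ.trans_le hT2
  have hVT : ∀ t, T ≤ t → 0 < ema c₂ (fun s => g s ^ 2) t := fun t ht =>
    ema_pos hc₂.le hτ.le (hT2.trans ht) hg2 (fun s => sq_nonneg _) hpos
  obtain ⟨C, hC⟩ := exists_integral_ratio_sub_one_le hc₂ hc hT0 hg hg2 hM (hVT T le_rfl)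
  have hA : ∀ t, T ≤ t → |A t| ≤ ρ := fun t ht =>
    abs_ema_div_sqrt_le hc₂ hc (hT0.trans_le ht) (hg t (hT0.le.trans ht)) (hg2 t (hT0.le.trans ht))
  have hM2 : ∀ s, 0 ≤ s → |g s ^ 2| ≤ M ^ 2 := fun s hs => by
    rw [abs_pow]; exact pow_le_pow_left₀ (abs_nonneg _) (hM s hs) 2
  refine ⟨η T * C, fun t ht => ?_⟩
  have hsub : Set.Icc T t ⊆ Set.Ici (0 : ℝ) := fun s hs => hT0.le.trans hs.1
  have hAc : ContinuousOn A (Set.Icc T t) :=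
    ((lipschitzOnWith_ema hc₁.le hg hM).continuousOn.mono hsub).div
      ((lipschitzOnWith_ema hc₂.le hg2 hM2).continuousOn.mono hsub).sqrt
      fun s hs => (Real.sqrt_pos.2 (hVT s hs.1)).ne'
  have hβc : ContinuousOn β (Set.Icc T t) := by
    refine ContinuousOn.mul (ContinuousOn.inv₀ (by fun_prop) fun s hs => ?_)
      (Continuous.continuousOn (by fun_prop))
    have : Real.exp (-c₁ * s) < 1 := by
      rw [Real.exp_lt_one_iff]
      nlinarith [hT0.trans_le hs.1]
    linarith
  have hηi : IntervalIntegrable η volume T t :=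
    AntitoneOn.intervalIntegrable (hη.mono (by rw [Set.uIcc_of_le ht]; exact hsub))
  have hAi : IntervalIntegrable (fun s => A s - 1) volume T t := by
    refine ContinuousOn.intervalIntegrable ?_
    rw [Set.uIcc_of_le ht]; exact hAc.sub continuousOn_const
  -- The potential bounds the unweighted integrals of A - 1; monotonicity of η transfers the bound
  -- to the weighted integral.
  have h1 : ∫ s in T..t, η s * (A s - 1) ≤ η T * C := by
    refine integral_mul_le_of_antitoneOn ht (hη.mono hsub) (hη0 t (hT0.le.trans ht)).le hAi
      (M := ρ + 1) (fun s hs => (abs_sub _ _).trans (by simpa using hA s hs.1)) fun s hs => hC s hs.1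
  have i1 : IntervalIntegrable (fun s => η s * (A s - 1)) volume T t :=
    hηi.mul_continuousOn (by rw [Set.uIcc_of_le ht]; exact hAc.sub continuousOn_const)
  have i2 : IntervalIntegrable (fun s => η s * adamRatio c₁ c₂ g s) volume T t := by
    refine hηi.mul_continuousOn ?_
    rw [Set.uIcc_of_le ht]
    exact (hβc.mul hAc).congr fun s hs => adamRatio_eq_mul hc₂.le (hsub hs)
  have h2 : ∫ s in T..t, η s * adamRatio c₁ c₂ g s ≤
      ∫ s in T..t, (η s * (A s - 1) + (1 + ε) * η s) := by
    refine intervalIntegral.integral_mono_on ht i2 (i1.add (hηi.const_mul _)) fun s hs => ?_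
    rw [adamRatio_eq_mul hc₂.le (hsub hs)]
    change η s * (β s * A s) ≤ _
    have h3 : (β s - 1) * A s ≤ ε := by
      refine (le_abs_self _).trans ?_
      rw [abs_mul]
      exact (mul_le_mul_of_nonneg_left (hA s hs.1) (abs_nonneg _)).trans (hT1 s hs.1).le
    nlinarith [hη0 s (hsub hs)]
  rw [intervalIntegral.integral_add i1 (hηi.const_mul _), intervalIntegral.integral_const_mul] at h2
  linarith

end AdamGrowth

namespace MuonAdamFlow

variable {K : ℕ} {rows cols : Fin K → ℕ} {q : ℕ} {ηM ηA cM c₁ c₂ : ℝ} {η : ℝ → ℝ}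
  {θ v g : ℝ → Param rows cols q}

/-- Keeps the denominator of the Adam ratio positive from time `τ` on, as the logarithmic potential
requires. -/
theorem ema_sq_pos (hF : MuonAdamFlow ηM ηA cM c₁ c₂ η θ v g) {τ ρ : ℝ} (hτ : 0 < τ) (hρ : 0 < ρ)
    (idx : ParamIndex rows cols q)
    (h : ∀ᵐ t ∂(volume.restrict (Set.Icc (0 : ℝ) τ)), ρ < g t idx ^ 2) :
    0 < ema c₂ (fun s => g s idx ^ 2) τ := by
  have hc := hF.c₂_pos
  have h1 : ∫ s in (0 : ℝ)..τ, ρ * (c₂ * Real.exp (-c₂ * (τ - s))) ≤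
      ema c₂ (fun s => g s idx ^ 2) τ := by
    refine intervalIntegral.integral_mono_ae_restrict hτ.le
      (Continuous.intervalIntegrable (by fun_prop) _ _)
      (intervalIntegrable_emaKernel_mul _ _ (hF.integrableOn_apply_sq idx hτ.le)) ?_
    filter_upwards [h] with s hs
    rw [mul_comm]
    exact mul_le_mul_of_nonneg_left hs.le (mul_nonneg hc.le (Real.exp_nonneg _))
  rw [intervalIntegral.integral_const_mul, integral_emaKernel, sub_zero] at h1
  refine lt_of_lt_of_le (mul_pos hρ ?_) h1
  rw [sub_pos, Real.exp_lt_one_iff]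
  nlinarith

/-- The norm of the parameters is asymptotically at most the accumulated learning rate. -/
theorem exists_hybridNorm_le (hF : MuonAdamFlow ηM ηA cM c₁ c₂ η θ v g) {τ ρ M : ℝ} (hτ : 0 < τ)
    (hρ : 0 < ρ)
    (h : ∀ j, ∀ᵐ t ∂(volume.restrict (Set.Icc (0 : ℝ) τ)), ρ < g t j ^ 2)
    (hM : ∀ t, 0 ≤ t → ‖g t‖ ≤ M) {ε : ℝ} (hε : 0 < ε) :
    ∃ T C, 0 ≤ T ∧ ∀ t, T ≤ t →
      hybridNorm (ηA / ηM) (θ t) ≤ (1 + ε) * (ηA * ∫ s in (0 : ℝ)..t, η s) + C := by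
  have hα : 0 < ηA / ηM := div_pos hF.ηA_pos hF.ηM_pos
  have hηA := hF.ηA_pos
  have hηM := hF.ηM_pos
  have hMj : ∀ (j : Fin q) (s : ℝ), 0 ≤ s → |g s (Sum.inr j)| ≤ M := fun j s hs =>
    (PiLp.norm_apply_le (g s) (Sum.inr j)).trans (hM s hs)
  have hev1 : ∀ᶠ T in atTop, ∀ j : Fin q, ∃ C, ∀ t, T ≤ t →
      ∫ s in T..t, η s * adamRatio c₁ c₂ (fun s => g s (Sum.inr j)) s ≤
        (1 + ε) * (∫ s in T..t, η s) + C :=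
    eventually_all.2 fun j => eventually_integral_mul_adamRatio_le hF.c₂_pos hF.c₂_le hF.η_pos
      hF.η_antitone (fun T => hF.integrableOn_apply _) (fun T => hF.integrableOn_apply_sq _) (hMj j)
      hτ (hF.ema_sq_pos hτ hρ (Sum.inr j) (h _)) hε
  -- The one-sided bound for the negated signal gives the lower bound on the displacement, the Adam
  -- ratio being odd.
  have hev2 : ∀ᶠ T in atTop, ∀ j : Fin q, ∃ C, ∀ t, T ≤ t →
      ∫ s in T..t, η s * adamRatio c₁ c₂ (fun s => -g s (Sum.inr j)) s ≤
        (1 + ε) * (∫ s in T..t, η s) + C :=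
    eventually_all.2 fun j => eventually_integral_mul_adamRatio_le hF.c₂_pos hF.c₂_le hF.η_pos
      hF.η_antitone (fun T hT => (hF.integrableOn_apply _ hT).neg)
      (fun T hT => by simpa using hF.integrableOn_apply_sq (Sum.inr j) hT)
      (by simpa using hMj j)
      hτ (by simpa using hF.ema_sq_pos hτ hρ (Sum.inr j) (h _)) hε
  obtain ⟨T, ⟨h1, h2⟩, hT0⟩ := ((hev1.and hev2).and (eventually_ge_atTop 0)).exists
  choose C₁ hC₁ using h1
  choose C₂ hC₂ using h2
  set D := ∑ j, (|C₁ j| + |C₂ j|) with hD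
  have hDj : ∀ j, |C₁ j| + |C₂ j| ≤ D := fun j =>
    Finset.single_le_sum (f := fun j => |C₁ j| + |C₂ j|) (fun _ _ => by positivity)
      (Finset.mem_univ j)
  have hD0 : 0 ≤ D := Finset.sum_nonneg fun _ _ => by positivity
  have hN0 := hybridNorm_nonneg (ηA / ηM) (θ T)
  refine ⟨T, hybridNorm (ηA / ηM) (θ T) + ηA * D, hT0, fun t ht => ?_⟩
  have hηi := hF.intervalIntegrable_η hT0 ht
  have hI0 : 0 ≤ ∫ s in T..t, η s := intervalIntegral.integral_nonneg ht fun s hs =>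
    (hF.η_pos s (hT0.trans hs.1)).le
  have hI1 : ∫ s in T..t, η s ≤ ∫ s in (0 : ℝ)..t, η s := by
    rw [← intervalIntegral.integral_add_adjacent_intervals
      (hF.intervalIntegrable_η le_rfl hT0) hηi]
    have : 0 ≤ ∫ s in (0 : ℝ)..T, η s := intervalIntegral.integral_nonneg hT0 fun s hs =>
      (hF.η_pos s hs.1).le
    linarith
  have hupd := (ae_restrict_iff' measurableSet_Ioi).1 hF.update
  suffices hsuff : hybridNorm (ηA / ηM) (θ t) ≤
      (1 + ε) * (ηA * ∫ s in T..t, η s) + (hybridNorm (ηA / ηM) (θ T) + ηA * D) by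
    refine hsuff.trans (add_le_add_left ?_ _)
    gcongr
  refine (hybridNorm_le_iff hα.le (by positivity)).2 ⟨fun k => ?_, fun j => ?_⟩
  · have h3 := spNorm_add_integral_le (W := fun r => matPart (v r) k) (κ := fun r => ηM * η r) ht
      (W₀ := matPart (θ T) k) (W₁ := matPart (θ t) k)
      (fun i j => hF.intervalIntegrable_velocity_apply _ hT0 ht)
      (fun i j => hF.apply_eq_add_integral _ hT0 ht) (hηi.const_mul _) (by
        filter_upwards [hupd] with r hr hrm
        have hr0 : 0 < r := hT0.trans_lt hrm.1
        obtain ⟨P, hP, hv⟩ := (hr hr0).1 k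
        have := hF.η_pos r hr0.le
        rw [hv, spNorm_smul, abs_neg, abs_of_pos (by positivity)]
        exact mul_le_of_le_one_right (by positivity) hP.spNorm_le_one)
    rw [intervalIntegral.integral_const_mul] at h3
    have h4 := mul_le_mul_of_nonneg_left h3 hα.le
    -- The weight ηA / ηM in the norm converts the Muon rate into the Adam rate, so all blocks grow
    -- at most at the same speed ηA η.
    have h5 : ηA / ηM * (spNorm (matPart (θ T) k) + ηM * ∫ r in T..t, η r) =
        ηA / ηM * spNorm (matPart (θ T) k) + ηA * ∫ r in T..t, η r := by
      field_simp
    have h6 := mul_spNorm_le_hybridNorm hα.le (θ T) k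
    have h7 : 0 ≤ ε * (ηA * ∫ s in T..t, η s) := by positivity
    have h8 : 0 ≤ ηA * D := by positivity
    linarith
  · have h3 : vecPart (θ t) j = vecPart (θ T) j + ∫ s in T..t, v s (Sum.inr j) :=
      hF.apply_eq_add_integral _ hT0 ht
    have h4 : ∫ s in T..t, v s (Sum.inr j) =
        -(ηA * ∫ s in T..t, η s * adamRatio c₁ c₂ (fun s => g s (Sum.inr j)) s) := by
      rw [← intervalIntegral.integral_const_mul, ← intervalIntegral.integral_neg]
      refine intervalIntegral.integral_congr_ae ?_
      filter_upwards [hupd] with r hr hrm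
      rw [Set.uIoc_of_le ht] at hrm
      have := (hr (hT0.trans_lt hrm.1)).2 j
      change vecPart (v r) j = _
      rw [this]
      change _ * adamRatio c₁ c₂ (fun s => g s (Sum.inr j)) r = _
      ring
    have h5 := hC₁ j t ht
    have h6 := hC₂ j t ht
    simp_rw [adamRatio_neg, mul_neg, intervalIntegral.integral_neg] at h6
    set I := ∫ s in T..t, η s * adamRatio c₁ c₂ (fun s => g s (Sum.inr j)) s
    have h7 : |I| ≤ (1 + ε) * (∫ s in T..t, η s) + D := by
      rw [abs_le]
      have := hDj j
      have := abs_nonneg (C₁ j)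
      have := abs_nonneg (C₂ j)
      constructor <;> linarith [le_abs_self (C₁ j), le_abs_self (C₂ j)]
    rw [h3, h4]
    refine (abs_add_le _ _).trans ?_
    rw [abs_neg, abs_mul, abs_of_pos hηA]
    have h8 := mul_le_mul_of_nonneg_left h7 hηA.le
    have h9 := abs_vecPart_le_hybridNorm hα.le (θ T) j
    linarith

end MuonAdamFlow


/-! ### Asymptotic steepest descent -/

theorem abs_trace_transpose_mul_le {a b : ℕ} (X : Matrix (Fin a) (Fin b) ℝ)
    {D : Matrix (Fin a) (Fin b) ℝ} {r : ℝ} (hD : spNorm D ≤ r) :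
    |(Xᵀ * D).trace| ≤ r * ∑ ij : Fin a × Fin b, |X ij.1 ij.2| := by
  rw [trace_transpose_mul, Finset.mul_sum]
  refine (Finset.abs_sum_le_sum_abs _ _).trans (Finset.sum_le_sum fun ij _ => ?_)
  rw [abs_mul, mul_comm]
  exact mul_le_mul_of_nonneg_right ((abs_apply_le_spNorm D _ _).trans hD) (abs_nonneg _)

/-- A normalized ratio `a / w` with `a ≈ -s` and `w² ≈ s²` is nearly aligned with `-s`. -/
theorem abs_le_neg_mul_div_add {a w s ρ : ℝ} (hw : 0 ≤ w) (hρ : |a / w| ≤ ρ) :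
    |s| ≤ -(s * (a / w)) + ((2 + ρ) * |a + s| + Real.sqrt |w ^ 2 - s ^ 2|) := by
  have hρ0 : 0 ≤ ρ := (abs_nonneg _).trans hρ
  have hsq := Real.sq_sqrt (abs_nonneg (w ^ 2 - s ^ 2))
  have hsq0 := Real.sqrt_nonneg |w ^ 2 - s ^ 2|
  set x := Real.sqrt |w ^ 2 - s ^ 2|
  rcases hw.eq_or_lt with h0 | h0
  -- For w = 0 the quotient is 0 by convention, and |s| is controlled by the discrepancy of the
  -- squares alone.
  · have h1 : |s| ≤ x := by
      refine abs_le_of_sq_le_sq ?_ hsq0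
      rw [hsq, ← h0]
      simp
    rw [← h0, div_zero, mul_zero, neg_zero, zero_add]
    have : 0 ≤ (2 + ρ) * |a + s| := by positivity
    linarith
  · have h1 : w ≤ |s| + x := by
      refine le_of_sq_le_sq ?_ (by positivity)
      have : w ^ 2 - s ^ 2 ≤ x ^ 2 := by rw [hsq]; exact le_abs_self _
      nlinarith [sq_abs s, mul_nonneg (abs_nonneg s) hsq0]
    -- This is (|a| - w)² ≥ 0 divided by w.
    have h2 : 2 * |a| - w ≤ a * (a / w) := by
      rw [← mul_div_assoc, le_div_iff₀ h0]
      nlinarith [sq_nonneg (|a| - w), sq_abs a]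
    have h3 : |(a + s) * (a / w)| ≤ ρ * |a + s| := by
      rw [abs_mul, mul_comm]
      exact mul_le_mul_of_nonneg_right hρ (abs_nonneg _)
    have h4 : |s| ≤ |a| + |a + s| := by
      calc |s| = |(a + s) - a| := by congr 1; ring
        _ ≤ |a + s| + |a| := abs_sub _ _
        _ = _ := add_comm _ _
    have h5 := (abs_le.1 h3).2
    nlinarith [abs_nonneg (a + s)]

namespace MuonAdamFlow

variable {K : ℕ} {rows cols : Fin K → ℕ} {q : ℕ} {ηM ηA cM c₁ c₂ : ℝ} {η : ℝ → ℝ}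
  {θ v g : ℝ → Param rows cols q}

/-- Orthogonalization attains the dual of the spectral norm at the momentum, and m̂ / √v̂ is nearly
a sign vector when the moments are close to -p and p². The quantity `δ` collects the moment errors
in units of `B`; it is uniform over the unit ball of directions `d`. -/
theorem exists_alignment (hF : MuonAdamFlow ηM ηA cM c₁ c₂ η θ v g) {B : ℝ → ℝ}
    {p : ℝ → Param rows cols q} {A : ℝ}
    (hpA : ∀ idx, ∀ᶠ t in atTop, |p t idx / B t| ≤ A)
    (h1 : ∀ c, 0 < c → ∀ idx,
      Tendsto (fun t => (ema c (fun s => g s idx) t + p t idx) / B t) atTop (𝓝 0))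
    (h2 : ∀ idx,
      Tendsto (fun t => (ema c₂ (fun s => g s idx ^ 2) t - p t idx ^ 2) / B t ^ 2) atTop (𝓝 0)) :
    ∃ δ : ℝ → ℝ, Tendsto δ atTop (𝓝 0) ∧ ∀ᵐ t, 0 < t → 0 < B t →
      ∀ d, hybridNorm (ηA / ηM) d ≤ 1 →
        ηA * η t * inner ℝ (p t) d ≤ inner ℝ (p t) (v t) + ηA * η t * (δ t * B t) := by
  have hα : 0 < ηA / ηM := div_pos hF.ηA_pos hF.ηM_pos
  have hηA := hF.ηA_pos
  have hηM := hF.ηM_pos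
  have hc₂ := hF.c₂_pos
  have hc₁ : 0 < c₁ := hc₂.trans_le hF.c₂_le
  set ρ := Real.sqrt (c₁ / c₂) with hρ
  -- `e` is the Muon momentum error, and `a`, `w2` are Adam's bias-corrected moments, in units of
  -- `B` and `B²` respectively.
  set e : ParamIndex rows cols q → ℝ → ℝ := fun idx t =>
    |(ema cM (fun s => g s idx) t + p t idx) / B t| with he
  set a : Fin q → ℝ → ℝ := fun j t =>
    (1 - Real.exp (-c₁ * t))⁻¹ * ema c₁ (fun s => g s (Sum.inr j)) t / B t with ha
  set w2 : Fin q → ℝ → ℝ := fun j t =>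
    (1 - Real.exp (-c₂ * t))⁻¹ * ema c₂ (fun s => g s (Sum.inr j) ^ 2) t / B t ^ 2 with hw2
  have hbd : ∀ {u x : ℝ → ℝ} {C : ℝ}, Tendsto u atTop (𝓝 0) → (∀ᶠ t in atTop, |x t| ≤ C) →
      Tendsto (fun t => u t * x t) atTop (𝓝 0) := fun hu hx =>
    hu.zero_mul_isBoundedUnder_le ⟨_, eventually_map.2 hx⟩
  have hbias : ∀ c, 0 < c → Tendsto (fun t => (1 - Real.exp (-c * t))⁻¹) atTop (𝓝 1) := fun c hc => by
    simpa using (tendsto_one_sub_exp_neg hc).inv₀ one_ne_zero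
  have hbias' : ∀ c, 0 < c → Tendsto (fun t => (1 - Real.exp (-c * t))⁻¹ - 1) atTop (𝓝 0) :=
    fun c hc => by simpa using (hbias c hc).sub_const 1
  have ha0 : ∀ j, Tendsto (fun t => |a j t + p t (Sum.inr j) / B t|) atTop (𝓝 0) := fun j => by
    have h3 := ((hbias c₁ hc₁).mul (h1 c₁ hc₁ (Sum.inr j))).sub (hbd (hbias' c₁ hc₁) (hpA (Sum.inr j)))
    rw [mul_zero, sub_zero] at h3
    rw [← abs_zero]
    refine Tendsto.abs (h3.congr fun t => ?_)
    simp only [ha]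
    ring
  have hw0 : ∀ j, Tendsto (fun t => Real.sqrt |w2 j t - (p t (Sum.inr j) / B t) ^ 2|) atTop (𝓝 0) :=
    fun j => by
      have h4 : ∀ᶠ t in atTop, |(p t (Sum.inr j) / B t) ^ 2| ≤ A ^ 2 := by
        filter_upwards [hpA (Sum.inr j)] with t ht
        rw [abs_pow]; exact pow_le_pow_left₀ (abs_nonneg _) ht 2
      have h3 := ((hbias c₂ hc₂).mul (h2 (Sum.inr j))).add (hbd (hbias' c₂ hc₂) h4)
      rw [mul_zero, zero_add] at h3
      have h5 : Tendsto (fun t => w2 j t - (p t (Sum.inr j) / B t) ^ 2) atTop (𝓝 0) := by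
        refine h3.congr fun t => ?_
        simp only [hw2]
        ring
      simpa using h5.abs.sqrt
  have he0 : ∀ idx, Tendsto (e idx) atTop (𝓝 0) := fun idx => by
    simpa using (h1 cM hF.cM_pos idx).abs
  refine ⟨fun t => (∑ k, ∑ ij : Fin (rows k) × Fin (cols k),
      2 * (ηM / ηA) * e (Sum.inl ⟨k, ij⟩) t) +
    ∑ j, ((2 + ρ) * |a j t + p t (Sum.inr j) / B t| +
      Real.sqrt |w2 j t - (p t (Sum.inr j) / B t) ^ 2|), ?_, ?_⟩
  · have t1 : Tendsto (fun t => (∑ k, ∑ ij : Fin (rows k) × Fin (cols k),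
        2 * (ηM / ηA) * e (Sum.inl ⟨k, ij⟩) t)) atTop
        (𝓝 (∑ k : Fin K, ∑ ij : Fin (rows k) × Fin (cols k), 2 * (ηM / ηA) * 0)) :=
      tendsto_finsetSum _ fun k _ => tendsto_finsetSum _ fun ij _ => (he0 _).const_mul _
    have t2 : Tendsto (fun t => ∑ j, ((2 + ρ) * |a j t + p t (Sum.inr j) / B t| +
        Real.sqrt |w2 j t - (p t (Sum.inr j) / B t) ^ 2|)) atTop
        (𝓝 (∑ j : Fin q, ((2 + ρ) * 0 + 0))) :=
      tendsto_finsetSum _ fun j _ => ((ha0 j).const_mul _).add (hw0 j)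
    simpa using t1.add t2
  · filter_upwards [(ae_restrict_iff' measurableSet_Ioi).1 hF.update] with t ht ht0 hBt d hd
    obtain ⟨hmat, hvec⟩ := ht ht0
    have hη := hF.η_pos t ht0.le
    obtain ⟨hd1, hd2⟩ := (hybridNorm_le_iff hα.le zero_le_one).1 hd
    rw [inner_eq_sum_trace_add_sum, inner_eq_sum_trace_add_sum, mul_add]
    have hM : ∀ k, ηA * η t * ((matPart (p t) k)ᵀ * matPart d k).trace ≤
        ((matPart (p t) k)ᵀ * matPart (v t) k).trace + ηA * η t *
          ((∑ ij : Fin (rows k) × Fin (cols k), 2 * (ηM / ηA) * e (Sum.inl ⟨k, ij⟩) t) * B t) := by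
      intro k
      obtain ⟨P, hP, hv⟩ := hmat k
      set M : Matrix (Fin (rows k)) (Fin (cols k)) ℝ :=
        Matrix.of fun i j => ema cM (fun s => matPart (g s) k i j) t with hMdef
      set X := M + matPart (p t) k with hX
      have hpX : matPart (p t) k = X - M := by rw [hX, add_sub_cancel_left]
      have hXe : ∀ ij : Fin (rows k) × Fin (cols k),
          |X ij.1 ij.2| = e (Sum.inl ⟨k, ij⟩) t * B t := fun ij => by
        simp only [he]
        rw [abs_div, abs_of_pos hBt, div_mul_cancel₀ _ hBt.ne']
        rfl
      have hdk : spNorm (matPart d k) ≤ ηM / ηA := by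
        have h3 := hd1 k
        have h5 := mul_le_mul_of_nonneg_left h3 (div_pos hηM hηA).le
        calc spNorm (matPart d k) = ηM / ηA * (ηA / ηM * spNorm (matPart d k)) := by field_simp
          _ ≤ _ := h5
          _ = _ := mul_one _
      have t1 : -(Mᵀ * matPart d k).trace ≤ ηM / ηA * (Mᵀ * P).trace := by
        have h3 : spNorm (-matPart d k) ≤ ηM / ηA := by
          have := spNorm_smul (-1) (matPart d k)
          rw [neg_one_smul, abs_neg, abs_one, one_mul] at this
          rwa [this]
        have := hP.trace_le h3
        rwa [Matrix.mul_neg, Matrix.trace_neg] at this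
      have t2 := (abs_le.1 (abs_trace_transpose_mul_le X hdk)).2
      have t3 := (abs_le.1 (abs_trace_transpose_mul_le X hP.spNorm_le_one)).2
      simp_rw [hXe] at t2 t3
      rw [← Finset.mul_sum, ← Finset.sum_mul] at *
      rw [hv, hpX, Matrix.transpose_sub, Matrix.sub_mul, Matrix.sub_mul, Matrix.trace_sub,
        Matrix.trace_sub, Matrix.mul_smul, Matrix.mul_smul, Matrix.trace_smul, Matrix.trace_smul,
        smul_eq_mul, smul_eq_mul]
      set E := ∑ ij : Fin (rows k) × Fin (cols k), e (Sum.inl ⟨k, ij⟩) t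
      have u1 := mul_le_mul_of_nonneg_left t1 (mul_pos hηA hη).le
      have u2 := mul_le_mul_of_nonneg_left t2 (mul_pos hηA hη).le
      have u3 := mul_le_mul_of_nonneg_left t3 (mul_pos hηM hη).le
      have u4 : ηA * η t * (ηM / ηA * (Mᵀ * P).trace) = ηM * η t * (Mᵀ * P).trace := by field_simp
      have u5 : ηA * η t * (ηM / ηA * (E * B t)) = ηM * η t * (E * B t) := by field_simp
      have u6 : ηA * η t * (2 * (ηM / ηA) * E * B t) = 2 * (ηM * η t * (E * B t)) := by field_simp
      rw [u6]
      linarith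
    have hV : ∀ j, ηA * η t * (vecPart (p t) j * vecPart d j) ≤ vecPart (p t) j * vecPart (v t) j +
        ηA * η t * (((2 + ρ) * |a j t + p t (Sum.inr j) / B t| +
          Real.sqrt |w2 j t - (p t (Sum.inr j) / B t) ^ 2|) * B t) := by
      intro j
      set s := p t (Sum.inr j) / B t with hs
      have hps : vecPart (p t) j = s * B t := (div_mul_cancel₀ _ hBt.ne').symm
      have hw2nn : 0 ≤ w2 j t := by
        have h3 : 0 ≤ 1 - Real.exp (-c₂ * t) := by
          rw [sub_nonneg, Real.exp_le_one_iff]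
          nlinarith [mul_pos hc₂ ht0]
        have h4 : 0 ≤ ema c₂ (fun s => g s (Sum.inr j) ^ 2) t :=
          ema_nonneg hc₂.le ht0.le fun _ => sq_nonneg _
        simp only [hw2]
        positivity
      have hratio : adamRatio c₁ c₂ (fun s => vecPart (g s) j) t = a j t / Real.sqrt (w2 j t) := by
        simp only [ha, hw2, adamRatio]
        rw [Real.sqrt_div' _ (by positivity), Real.sqrt_sq hBt.le, div_div_div_cancel_right₀ hBt.ne']
        rfl
      have hle := abs_adamRatio_le hc₂ hF.c₂_le ht0 (hF.integrableOn_apply (Sum.inr j) ht0.le)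
        (hF.integrableOn_apply_sq (Sum.inr j) ht0.le)
      change |adamRatio c₁ c₂ (fun s => vecPart (g s) j) t| ≤ ρ at hle
      rw [hratio] at hle
      have hkey := abs_le_neg_mul_div_add (s := s) (Real.sqrt_nonneg _) hle
      rw [Real.sq_sqrt hw2nn] at hkey
      rw [hvec j, hratio, hps]
      have hsd : s * vecPart d j ≤ |s| := by
        refine (le_abs_self _).trans ?_
        rw [abs_mul]
        exact mul_le_of_le_one_right (abs_nonneg _) (hd2 j)
      have u1 := mul_le_mul_of_nonneg_left (hsd.trans hkey) (mul_pos (mul_pos hηA hη) hBt).le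
      linarith
    have hM' := Finset.sum_le_sum fun k (_ : k ∈ Finset.univ) => hM k
    have hV' := Finset.sum_le_sum fun j (_ : j ∈ Finset.univ) => hV j
    rw [Finset.sum_add_distrib, ← Finset.mul_sum, ← Finset.mul_sum, ← Finset.sum_mul] at hM' hV'
    linarith

end MuonAdamFlow


/-! ### The loss exponent -/

namespace IsLossExponent

variable {φ : ℝ → ℝ}

theorem deriv_pos (hφ : IsLossExponent φ) (u : ℝ) : 0 < deriv φ u := by
  obtain ⟨B, hB⟩ := hφ.deriv_bounds
  exact (hB u).1

theorem differentiable (hφ : IsLossExponent φ) : Differentiable ℝ φ :=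
  hφ.contDiff.differentiable two_ne_zero

theorem contDiff_deriv (hφ : IsLossExponent φ) : ContDiff ℝ 1 (deriv φ) :=
  (contDiff_succ_iff_deriv.1 (show ContDiff ℝ (1 + 1) φ by
    rw [one_add_one_eq_two]; exact hφ.contDiff)).2.2

theorem differentiable_deriv (hφ : IsLossExponent φ) : Differentiable ℝ (deriv φ) :=
  hφ.contDiff_deriv.differentiable one_ne_zero

theorem strictMono (hφ : IsLossExponent φ) : StrictMono φ :=
  strictMono_of_deriv_pos hφ.deriv_pos

theorem monotone_deriv (hφ : IsLossExponent φ) : Monotone (deriv φ) := by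
  obtain ⟨B, hB⟩ := hφ.deriv2_bounds
  exact monotone_of_deriv_nonneg hφ.differentiable_deriv fun u => (hB u).1

theorem exists_tendsto_deriv (hφ : IsLossExponent φ) :
    ∃ β, 0 < β ∧ Tendsto (deriv φ) atTop (𝓝 β) ∧ ∀ u, deriv φ u ≤ β := by
  obtain ⟨B, hB⟩ := hφ.deriv_bounds
  have hbdd : BddAbove (Set.range (deriv φ)) := ⟨B, by rintro _ ⟨u, rfl⟩; exact (hB u).2⟩
  exact ⟨⨆ u, deriv φ u, (hφ.deriv_pos 0).trans_le (le_ciSup hbdd 0),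
    tendsto_atTop_ciSup hφ.monotone_deriv hbdd, le_ciSup hbdd⟩

theorem add_mul_le (hφ : IsLossExponent φ) {u v : ℝ} (hu : 0 ≤ u) (huv : u ≤ v) :
    φ u + deriv φ 0 * (v - u) ≤ φ v := by
  have := (convex_Ici (0 : ℝ)).mul_sub_le_image_sub_of_le_deriv
    hφ.differentiable.continuous.continuousOn hφ.differentiable.differentiableOn
    (C := deriv φ 0) (fun w hw => hφ.monotone_deriv (interior_subset hw)) u hu v (hu.trans huv) huv
  linarith

theorem sub_le_mul (hφ : IsLossExponent φ) {β : ℝ} (hβ : ∀ u, deriv φ u ≤ β) {u v : ℝ}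
    (huv : u ≤ v) : φ v - φ u ≤ β * (v - u) :=
  image_sub_le_mul_sub_of_deriv_le hφ.differentiable hβ huv

theorem abs_sub_le (hφ : IsLossExponent φ) {β : ℝ} (hβ : ∀ u, deriv φ u ≤ β) (u v : ℝ) :
    |φ u - φ v| ≤ β * |u - v| := by
  rcases le_total u v with h | h
  · rw [abs_sub_comm, abs_sub_comm u v, abs_of_nonneg (sub_nonneg.2 (hφ.strictMono.monotone h)),
      abs_of_nonneg (sub_nonneg.2 h)]
    exact hφ.sub_le_mul hβ h
  · rw [abs_of_nonneg (sub_nonneg.2 (hφ.strictMono.monotone h)),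
      abs_of_nonneg (sub_nonneg.2 h)]
    exact hφ.sub_le_mul hβ h

end IsLossExponent

theorem abs_log_sub_log_le {a b c : ℝ} (hc : 0 < c) (ha : c ≤ a) (hb : c ≤ b) :
    |Real.log a - Real.log b| ≤ |a - b| / c := by
  have key : ∀ {a b : ℝ}, c ≤ a → c ≤ b → Real.log a - Real.log b ≤ |a - b| / c := by
    intro a b ha hb
    have ha0 := hc.trans_le ha
    have hb0 := hc.trans_le hb
    rw [← Real.log_div ha0.ne' hb0.ne']
    refine (Real.log_le_sub_one_of_pos (div_pos ha0 hb0)).trans ?_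
    rw [div_sub_one hb0.ne']
    refine (div_le_div_of_nonneg_right (le_abs_self _) hb0.le).trans ?_
    exact div_le_div_of_nonneg_left (abs_nonneg _) hc hb
  rw [abs_le]
  refine ⟨?_, key ha hb⟩
  have := key hb ha
  rw [abs_sub_comm] at this
  linarith

/-- On [0, ∞) monotonicity keeps φ' above φ'(0) > 0, so a bounded φ'' makes log φ' Lipschitz there.
-/
theorem IsLossExponent.exists_abs_log_deriv_sub_le {φ : ℝ → ℝ} (hφ : IsLossExponent φ) :
    ∃ C, 0 ≤ C ∧ ∀ u v, 0 ≤ u → 0 ≤ v →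
      |Real.log (deriv φ u) - Real.log (deriv φ v)| ≤ C * |u - v| := by
  obtain ⟨B, hB⟩ := hφ.deriv2_bounds
  have h0 := hφ.deriv_pos 0
  have hB0 : 0 ≤ B := (hB 0).1.trans (hB 0).2
  refine ⟨B / deriv φ 0, by positivity, fun u v hu hv => ?_⟩
  refine (abs_log_sub_log_le h0 (hφ.monotone_deriv hu) (hφ.monotone_deriv hv)).trans ?_
  rw [div_mul_eq_mul_div]
  refine div_le_div_of_nonneg_right ?_ h0.le
  rcases le_total u v with h | h
  · rw [abs_sub_comm, abs_sub_comm u v, abs_of_nonneg (sub_nonneg.2 (hφ.monotone_deriv h)),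
      abs_of_nonneg (sub_nonneg.2 h)]
    exact image_sub_le_mul_sub_of_deriv_le hφ.differentiable_deriv (fun w => (hB w).2) h
  · rw [abs_of_nonneg (sub_nonneg.2 (hφ.monotone_deriv h)), abs_of_nonneg (sub_nonneg.2 h)]
    exact image_sub_le_mul_sub_of_deriv_le hφ.differentiable_deriv (fun w => (hB w).2) h

/-- From |e^x - 1| ≤ e^{|x|} - 1, applied to the increment x of the logarithm. -/
theorem SlowlyVarying.of_log {b : ℝ → ℝ} (h : ∀ ε > 0, ∃ T, ∀ s t, T ≤ s → s ≤ t →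
    0 < b s ∧ |Real.log (b s) - Real.log (b t)| ≤ ε * (t - s)) : SlowlyVarying b := by
  intro ε hε
  obtain ⟨T, hT⟩ := h ε hε
  refine ⟨T, fun s t hs ht => ⟨(hT s t hs ht).1, ?_⟩⟩
  obtain ⟨h1, h2⟩ := hT s t hs ht
  have h3 := (hT t t (hs.trans ht) le_rfl).1
  have h4 : b s = Real.exp (Real.log (b s) - Real.log (b t)) * b t := by
    rw [Real.exp_sub, Real.exp_log h1, Real.exp_log h3, div_mul_cancel₀ _ h3.ne']
  have h5 : |Real.exp (Real.log (b s) - Real.log (b t)) - 1| ≤ Real.exp (ε * (t - s)) - 1 := by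
    set x := Real.log (b s) - Real.log (b t)
    have h6 := Real.exp_le_exp.2 (abs_le.1 h2).2
    have h7 := Real.exp_le_exp.2 (abs_le.1 h2).1
    have h8 := Real.exp_pos (ε * (t - s))
    have h9 : Real.exp (-(ε * (t - s))) * Real.exp (ε * (t - s)) = 1 := by
      rw [← Real.exp_add]; simp
    have h10 := Real.exp_pos (-(ε * (t - s)))
    rw [abs_le]
    constructor
    · nlinarith [sq_nonneg (Real.exp (ε * (t - s)) - 1)]
    · linarith
  calc |b s - b t| = |(Real.exp (Real.log (b s) - Real.log (b t)) - 1) * b t| := by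
        rw [sub_mul, ← h4, one_mul]
    _ = |Real.exp (Real.log (b s) - Real.log (b t)) - 1| * b t := by rw [abs_mul, abs_of_pos h3]
    _ ≤ _ := mul_le_mul_of_nonneg_right h5 h3.le

theorem hybridNorm_eq_one_of_tendsto {K : ℕ} {rows cols : Fin K → ℕ} {q : ℕ} {α : ℝ} (hα : 0 ≤ α)
    {θ : ℝ → Param rows cols q} {θbar : Param rows cols q}
    (hN : ∀ᶠ t in atTop, 0 < hybridNorm α (θ t))
    (hθ : Tendsto (fun t => (hybridNorm α (θ t))⁻¹ • θ t) atTop (𝓝 θbar)) :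
    hybridNorm α θbar = 1 := by
  have h1 := ((continuous_hybridNorm hα).tendsto θbar).comp hθ
  refine tendsto_nhds_unique h1 (tendsto_const_nhds.congr' ?_)
  filter_upwards [hN] with t ht
  have h2 := map_smul_eq_mul (hybridSeminorm hα : Seminorm ℝ (Param rows cols q))
    (hybridNorm α (θ t))⁻¹ (θ t)
  rw [coe_hybridSeminorm] at h2
  rw [Function.comp_apply, h2, Real.norm_of_nonneg (inv_nonneg.2 ht.le), inv_mul_cancel₀ ht.ne']

theorem MuonAdamFlow.exists_lipschitzOnWith_comp {K : ℕ} {rows cols : Fin K → ℕ} {q : ℕ}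
    {ηM ηA cM c₁ c₂ : ℝ} {η : ℝ → ℝ} {θ v g : ℝ → Param rows cols q}
    (hF : MuonAdamFlow ηM ηA cM c₁ c₂ η θ v g) {F : Param rows cols q → ℝ} (hL : LocallyLipschitz F)
    {s t : ℝ} (hs : 0 ≤ s) : ∃ C, LipschitzOnWith C (fun r => F (θ r)) (Set.Icc s t) := by
  obtain ⟨R, hR, hv⟩ := hF.exists_velocity_bound
  have h1 := (hF.lipschitzOnWith hR hv).mono (fun r (hr : r ∈ Set.Icc s t) => hs.trans hr.1)
  obtain ⟨C, hC⟩ := (hL.locallyLipschitzOn (s := θ '' Set.Icc s t)).exists_lipschitzOnWith_of_compact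
    (isCompact_Icc.image_of_continuousOn h1.continuousOn)
  exact ⟨_, hC.comp h1 (Set.mapsTo_image _ _)⟩

/-! ### Trajectories converging in direction -/

/-- A Muon-Adam trajectory on homogeneous models `F i` that converges in direction to `θbar` with
margin `γ > 0`, whose model subgradients `h i` obey the chain rule and stabilize to `l i`. -/
structure StableMarginFlow {m K : ℕ} {rows cols : Fin K → ℕ} {q : ℕ} (ηM ηA cM c₁ c₂ : ℝ)
    (η : ℝ → ℝ) (θ v g : ℝ → Param rows cols q) (L : ℝ) (φ : ℝ → ℝ)
    (F : Fin m → Param rows cols q → ℝ) (y : Fin m → ℝ) (h : Fin m → ℝ → Param rows cols q)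
    (l : Fin m → Param rows cols q) (θbar : Param rows cols q) (γ : ℝ) : Prop where
  flow : MuonAdamFlow ηM ηA cM c₁ c₂ η θ v g
  abs_y : ∀ i, |y i| = 1
  lossExponent : IsLossExponent φ
  one_le : 1 ≤ L
  homogeneous : ∀ i (ϑ : Param rows cols q) (α : ℝ), 0 < α → F i (α • ϑ) = α ^ L * F i ϑ
  locallyLipschitz : ∀ i, LocallyLipschitz (F i)
  chain_rule : ∀ i, ∀ᵐ t, 0 < t → HasDerivAt (fun s => F i (θ s)) (inner ℝ (h i t) (v t)) t
  gradient_eq : ∀ t, 0 ≤ t → g t = -∑ i, (Real.exp (-φ (y i * F i (θ t))) *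
      deriv φ (y i * F i (θ t)) * y i) • h i t
  tendsto_subgradient : ∀ i,
    Tendsto (fun t => (hybridNorm (ηA / ηM) (θ t) ^ (L - 1))⁻¹ • h i t) atTop (𝓝 (l i))
  inner_limit : ∀ i, inner ℝ (l i) θbar = L * F i θbar
  integral_diverges : Tendsto (fun T => ∫ t in (0 : ℝ)..T, η t) atTop atTop
  decay : η =o[atTop] fun t : ℝ => t ^ (1 / L - 1)
  norm_bounded_below : ∃ Nmin > 0, ∃ t₀ ≥ 0, ∀ t ≥ t₀, Nmin ≤ hybridNorm (ηA / ηM) (θ t)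
  tendsto_direction : Tendsto (fun t => (hybridNorm (ηA / ηM) (θ t))⁻¹ • θ t) atTop (𝓝 θbar)
  γ_pos : 0 < γ
  γ_le : ∀ i, γ ≤ y i * F i θbar
  γ_attained : ∃ i, γ = y i * F i θbar
  initial_gradient : ∃ τ > 0, ∃ ρ > 0, ∀ j, ∀ᵐ t ∂(volume.restrict (Set.Icc (0 : ℝ) τ)),
    ρ < g t j ^ 2

/-- The weight `e^{-φ(z)} φ'(z)` of a sample with signed output `z` in the loss gradient. -/
noncomputable def lossWeight (φ : ℝ → ℝ) (z : ℝ) : ℝ := Real.exp (-φ z) * deriv φ z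

/-- The weight of a sample, scaled by the size of the model gradients at norm `r`. -/
noncomputable def scaledWeight (φ : ℝ → ℝ) (L z r : ℝ) : ℝ := lossWeight φ z * r ^ (L - 1)

namespace StableMarginFlow

variable {m K : ℕ} {rows cols : Fin K → ℕ} {q : ℕ} {ηM ηA cM c₁ c₂ : ℝ}
    {η : ℝ → ℝ} {θ v g : ℝ → Param rows cols q} {L : ℝ} {φ : ℝ → ℝ}
    {F : Fin m → Param rows cols q → ℝ} {y : Fin m → ℝ} {h : Fin m → ℝ → Param rows cols q}
    {l : Fin m → Param rows cols q} {θbar : Param rows cols q} {γ : ℝ}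

local notation "N" => hybridNorm (ηA / ηM)

theorem α_pos (hS : StableMarginFlow ηM ηA cM c₁ c₂ η θ v g L φ F y h l θbar γ) : 0 < ηA / ηM :=
  div_pos hS.flow.ηA_pos hS.flow.ηM_pos

theorem exists_eventually_le_norm (hS : StableMarginFlow ηM ηA cM c₁ c₂ η θ v g L φ F y h l θbar γ) :
    ∃ r, 0 < r ∧ ∀ᶠ t in atTop, r ≤ N (θ t) := by
  obtain ⟨r, hr, t₀, -, h⟩ := hS.norm_bounded_below
  exact ⟨r, hr, eventually_atTop.2 ⟨t₀, h⟩⟩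

theorem eventually_norm_pos (hS : StableMarginFlow ηM ηA cM c₁ c₂ η θ v g L φ F y h l θbar γ) :
    ∀ᶠ t in atTop, 0 < N (θ t) := by
  obtain ⟨r, hr, h⟩ := hS.exists_eventually_le_norm
  exact h.mono fun t ht => hr.trans_le ht

theorem norm_direction (hS : StableMarginFlow ηM ηA cM c₁ c₂ η θ v g L φ F y h l θbar γ) :
    N θbar = 1 :=
  hybridNorm_eq_one_of_tendsto hS.α_pos.le hS.eventually_norm_pos hS.tendsto_direction

theorem tendsto_normalized_output
    (hS : StableMarginFlow ηM ηA cM c₁ c₂ η θ v g L φ F y h l θbar γ) (i : Fin m) :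
    Tendsto (fun t => y i * F i (θ t) / N (θ t) ^ L) atTop (𝓝 (y i * F i θbar)) := by
  have h1 := (((hS.locallyLipschitz i).continuous.tendsto θbar).comp hS.tendsto_direction).const_mul
    (y i)
  refine h1.congr' ?_
  filter_upwards [hS.eventually_norm_pos] with t ht
  rw [Function.comp_apply, hS.homogeneous i _ _ (inv_pos.2 ht), Real.inv_rpow ht.le]
  ring

theorem eventually_output_ge
    (hS : StableMarginFlow ηM ηA cM c₁ c₂ η θ v g L φ F y h l θbar γ) (i : Fin m) :
    ∀ᶠ t in atTop, γ / 2 * N (θ t) ^ L ≤ y i * F i (θ t) := by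
  have h1 : γ / 2 < y i * F i θbar := by linarith [hS.γ_le i, hS.γ_pos]
  filter_upwards [(hS.tendsto_normalized_output i).eventually (lt_mem_nhds h1), hS.eventually_norm_pos]
    with t ht hN
  exact ((lt_div_iff₀ (Real.rpow_pos_of_pos hN L)).1 ht).le

theorem eventually_output_nonneg
    (hS : StableMarginFlow ηM ηA cM c₁ c₂ η θ v g L φ F y h l θbar γ) (i : Fin m) :
    ∀ᶠ t in atTop, 0 ≤ y i * F i (θ t) := by
  filter_upwards [hS.eventually_output_ge i] with t ht
  exact le_trans (mul_nonneg (half_pos hS.γ_pos).le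
    (Real.rpow_nonneg (hybridNorm_nonneg _ _) _)) ht

theorem exists_subgradient_bound
    (hS : StableMarginFlow ηM ηA cM c₁ c₂ η θ v g L φ F y h l θbar γ) :
    ∃ C, 0 < C ∧ ∀ᶠ t in atTop, ∀ i, ‖h i t‖ ≤ C * N (θ t) ^ (L - 1) := by
  refine ⟨∑ i, (‖l i‖ + 1) + 1, by positivity, ?_⟩
  refine eventually_all.2 fun i => ?_
  filter_upwards [(hS.tendsto_subgradient i).norm.eventually (gt_mem_nhds (lt_add_one ‖l i‖)),
    hS.eventually_norm_pos] with t ht hN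
  have hp := Real.rpow_pos_of_pos hN (L - 1)
  rw [norm_smul, Real.norm_of_nonneg (inv_nonneg.2 hp.le), inv_mul_lt_iff₀ hp] at ht
  have h2 : ‖l i‖ + 1 ≤ ∑ i, (‖l i‖ + 1) :=
    Finset.single_le_sum (f := fun i => ‖l i‖ + 1) (fun _ _ => by positivity) (Finset.mem_univ i)
  nlinarith

/-- Convexity gives e^{-φ(z)} ≤ e^{-φ(0)} / (φ'(0) z), and the margin gives z ≥ (γ/2) N^L. Hence the
factor N^{L-1} is compensated up to 1/N, which is bounded because N stays away from 0. -/
theorem eventually_scaledWeight_le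
    (hS : StableMarginFlow ηM ηA cM c₁ c₂ η θ v g L φ F y h l θbar γ) :
    ∃ C, 0 < C ∧ ∀ᶠ t in atTop, ∀ i, scaledWeight φ L (y i * F i (θ t)) (N (θ t)) ≤ C := by
  obtain ⟨β, hβ0, -, hβ⟩ := hS.lossExponent.exists_tendsto_deriv
  obtain ⟨r, hr, hN⟩ := hS.exists_eventually_le_norm
  have hd := hS.lossExponent.deriv_pos 0
  have hγ := hS.γ_pos
  refine ⟨Real.exp (-φ 0) * (2 / (γ * deriv φ 0 * r)) * β, by positivity, ?_⟩
  refine eventually_all.2 fun i => ?_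
  filter_upwards [hN, hS.eventually_output_ge i] with t h1 h2
  set z := y i * F i (θ t)
  have hNt := hr.trans_le h1
  have hp := Real.rpow_pos_of_pos hNt (L - 1)
  have hNL : N (θ t) ^ L = N (θ t) ^ (L - 1) * N (θ t) := by
    rw [Real.rpow_sub_one hNt.ne']; field_simp
  have hNL0 := Real.rpow_pos_of_pos hNt L
  have hz : 0 < z := lt_of_lt_of_le (by positivity) h2
  have h3 := hS.lossExponent.add_mul_le le_rfl hz.le
  rw [sub_zero] at h3
  have h4 : Real.exp (-φ z) ≤ Real.exp (-φ 0) * (1 / (deriv φ 0 * z)) := by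
    have h5 : Real.exp (-φ z) ≤ Real.exp (-φ 0) * Real.exp (-(deriv φ 0 * z)) := by
      rw [← Real.exp_add, Real.exp_le_exp]; linarith
    refine h5.trans (mul_le_mul_of_nonneg_left ?_ (Real.exp_nonneg _))
    rw [Real.exp_neg, inv_eq_one_div]
    exact one_div_le_one_div_of_le (by positivity) (by linarith [Real.add_one_le_exp (deriv φ 0 * z)])
  have h6 : 1 / (deriv φ 0 * z) * N (θ t) ^ (L - 1) ≤ 2 / (γ * deriv φ 0 * r) := by
    rw [div_mul_eq_mul_div, one_mul, div_le_div_iff₀ (by positivity) (by positivity)]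
    rw [hNL] at h2
    have h7 : N (θ t) ^ (L - 1) * r ≤ N (θ t) ^ (L - 1) * N (θ t) :=
      mul_le_mul_of_nonneg_left h1 hp.le
    have h8 : γ * (N (θ t) ^ (L - 1) * r) ≤ 2 * z := by nlinarith
    nlinarith
  rw [scaledWeight, lossWeight]
  calc Real.exp (-φ z) * deriv φ z * N (θ t) ^ (L - 1)
      ≤ Real.exp (-φ 0) * (1 / (deriv φ 0 * z)) * β * N (θ t) ^ (L - 1) := by
        have := (hS.lossExponent.deriv_pos z).le
        have := hβ z
        gcongr
    _ = Real.exp (-φ 0) * (1 / (deriv φ 0 * z) * N (θ t) ^ (L - 1)) * β := by ring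
    _ ≤ _ := by gcongr

theorem scaledWeight_pos (hφ : IsLossExponent φ) {z r : ℝ} (hr : 0 < r) :
    0 < scaledWeight φ L z r :=
  mul_pos (mul_pos (Real.exp_pos _) (hφ.deriv_pos z)) (Real.rpow_pos_of_pos hr _)

/-- A global bound on the signal is needed by the logarithmic potential, hence by the growth
estimate of the norm. It uses only the margin and the lower bound on N, so there is no circularity.
-/
theorem exists_gradient_bound
    (hS : StableMarginFlow ηM ηA cM c₁ c₂ η θ v g L φ F y h l θbar γ) :
    ∃ M, ∀ t, 0 ≤ t → ‖g t‖ ≤ M := by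
  obtain ⟨C, hC, h1⟩ := hS.exists_subgradient_bound
  obtain ⟨D, hD, h2⟩ := hS.eventually_scaledWeight_le
  obtain ⟨T, hT⟩ := eventually_atTop.1 (h1.and h2)
  obtain ⟨M, hM⟩ := hS.flow.bounded T
  refine ⟨max M (∑ _i : Fin m, D * C), fun t ht => ?_⟩
  rcases le_total t T with h3 | h3
  · exact (hM t ⟨ht, h3⟩).trans (le_max_left _ _)
  · refine le_trans ?_ (le_max_right _ _)
    rw [hS.gradient_eq t ht, norm_neg]
    refine (norm_sum_le _ _).trans (Finset.sum_le_sum fun i _ => ?_)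
    obtain ⟨h4, h5⟩ := hT t h3
    rw [norm_smul, norm_mul, Real.norm_eq_abs (y i), hS.abs_y i, mul_one, Real.norm_of_nonneg
      (mul_nonneg (Real.exp_nonneg _) (hS.lossExponent.deriv_pos _).le)]
    calc _ ≤ lossWeight φ (y i * F i (θ t)) * (C * N (θ t) ^ (L - 1)) :=
          mul_le_mul_of_nonneg_left (h4 i)
            (mul_nonneg (Real.exp_nonneg _) (hS.lossExponent.deriv_pos _).le)
      _ = scaledWeight φ L (y i * F i (θ t)) (N (θ t)) * C := by rw [scaledWeight]; ring
      _ ≤ D * C := mul_le_mul_of_nonneg_right (h5 i) hC.le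

theorem eventually_norm_le
    (hS : StableMarginFlow ηM ηA cM c₁ c₂ η θ v g L φ F y h l θbar γ) {ε : ℝ} (hε : 0 < ε) :
    ∃ C, ∀ᶠ t in atTop, N (θ t) ≤ (1 + ε) * (ηA * ∫ s in (0 : ℝ)..t, η s) + C := by
  obtain ⟨M, hM⟩ := hS.exists_gradient_bound
  obtain ⟨τ, hτ, ρ, hρ, hg⟩ := hS.initial_gradient
  obtain ⟨T, C, -, hT⟩ := hS.flow.exists_hybridNorm_le hτ hρ hg hM hε
  exact ⟨C, eventually_atTop.2 ⟨T, hT⟩⟩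

/-- Eventually η(t) ≤ t^{1/L-1}, whose primitive is L t^{1/L}. -/
theorem exists_norm_le_rpow (hS : StableMarginFlow ηM ηA cM c₁ c₂ η θ v g L φ F y h l θbar γ) :
    ∃ C, 0 < C ∧ ∀ᶠ t in atTop, N (θ t) ≤ C * t ^ (1 / L) := by
  obtain ⟨C, hC⟩ := hS.eventually_norm_le one_pos
  have hL : 0 < L := zero_lt_one.trans_le hS.one_le
  have hηA := hS.flow.ηA_pos
  obtain ⟨T₀, hT₀⟩ := eventually_atTop.1 (hS.decay.bound one_pos)
  set T := max T₀ 1 with hTdef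
  have hT1 : 1 ≤ T := le_max_right _ _
  have hT0 : 0 ≤ T := zero_le_one.trans hT1
  set D := |∫ s in (0 : ℝ)..T, η s| with hD
  refine ⟨(1 + 1) * (ηA * (D + L)) + |C|, by positivity, ?_⟩
  filter_upwards [hC, eventually_ge_atTop T] with t h1 ht
  have ht0 := hT0.trans ht
  have hpow : 1 ≤ t ^ (1 / L) := Real.one_le_rpow (hT1.trans ht) (by positivity)
  have hr : -1 < 1 / L - 1 := by linarith [one_div_pos.2 hL]
  have h2 : ∫ s in T..t, η s ≤ ∫ s in T..t, s ^ (1 / L - 1) := by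
    refine intervalIntegral.integral_mono_on ht (hS.flow.intervalIntegrable_η hT0 ht)
      (intervalIntegral.intervalIntegrable_rpow' hr) fun s hs => ?_
    have h3 := hT₀ s ((le_max_left _ _).trans hs.1)
    rw [one_mul, Real.norm_of_nonneg (hS.flow.η_pos s (hT0.trans hs.1)).le,
      Real.norm_of_nonneg (Real.rpow_nonneg (hT0.trans hs.1) _)] at h3
    exact h3
  rw [integral_rpow (Or.inl hr), sub_add_cancel, div_div_eq_mul_div, div_one] at h2
  have h4 : ∫ s in (0 : ℝ)..t, η s ≤ D + L * t ^ (1 / L) := by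
    rw [← intervalIntegral.integral_add_adjacent_intervals
      (hS.flow.intervalIntegrable_η le_rfl hT0) (hS.flow.intervalIntegrable_η hT0 ht)]
    have h5 : 0 ≤ T ^ (1 / L) * L := by positivity
    have h6 := le_abs_self (∫ s in (0 : ℝ)..T, η s)
    nlinarith
  have h7 : D + L * t ^ (1 / L) ≤ (D + L) * t ^ (1 / L) := by
    have : 0 ≤ D := abs_nonneg _
    nlinarith
  have h8 : C ≤ |C| * t ^ (1 / L) := (le_abs_self C).trans
    (le_mul_of_one_le_right (abs_nonneg C) hpow)
  refine h1.trans ?_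
  have h9 := mul_le_mul_of_nonneg_left (h4.trans h7) hηA.le
  linarith

/-- N^{L-1} η controls the speed of the outputs. The exponents cancel exactly: (t^{1/L})^{L-1} is
the inverse of t^{1/L-1}. -/
theorem tendsto_rpow_norm_mul (hS : StableMarginFlow ηM ηA cM c₁ c₂ η θ v g L φ F y h l θbar γ) :
    Tendsto (fun t => N (θ t) ^ (L - 1) * η t) atTop (𝓝 0) := by
  obtain ⟨C, hC, h1⟩ := hS.exists_norm_le_rpow
  have hL : 0 < L := zero_lt_one.trans_le hS.one_le
  have h2 : Tendsto (fun t => C ^ (L - 1) * (η t / t ^ (1 / L - 1))) atTop (𝓝 0) := by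
    simpa using hS.decay.tendsto_div_nhds_zero.const_mul (C ^ (L - 1))
  refine squeeze_zero' ?_ ?_ h2
  · filter_upwards [eventually_ge_atTop 0] with t ht
    exact mul_nonneg (Real.rpow_nonneg (hybridNorm_nonneg _ _) _) (hS.flow.η_pos t ht).le
  · filter_upwards [h1, eventually_gt_atTop 0] with t h3 ht
    have h4 : N (θ t) ^ (L - 1) ≤ (C * t ^ (1 / L)) ^ (L - 1) :=
      Real.rpow_le_rpow (hybridNorm_nonneg _ _) h3 (by linarith [hS.one_le])
    refine (mul_le_mul_of_nonneg_right h4 (hS.flow.η_pos t ht.le).le).trans (le_of_eq ?_)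
    rw [Real.mul_rpow hC.le (by positivity), ← Real.rpow_mul ht.le,
      show 1 / L * (L - 1) = -(1 / L - 1) by field_simp; ring, Real.rpow_neg ht.le]
    ring

theorem tendsto_η (hS : StableMarginFlow ηM ηA cM c₁ c₂ η θ v g L φ F y h l θbar γ) :
    Tendsto η atTop (𝓝 0) := by
  obtain ⟨r, hr, h1⟩ := hS.exists_eventually_le_norm
  have hp := Real.rpow_pos_of_pos hr (L - 1)
  have h2 : Tendsto (fun t => (r ^ (L - 1))⁻¹ * (N (θ t) ^ (L - 1) * η t)) atTop (𝓝 0) := by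
    simpa using hS.tendsto_rpow_norm_mul.const_mul (r ^ (L - 1))⁻¹
  refine squeeze_zero' ?_ ?_ h2
  · filter_upwards [eventually_ge_atTop 0] with t ht using (hS.flow.η_pos t ht).le
  · filter_upwards [h1, eventually_ge_atTop 0] with t h3 ht
    rw [← mul_assoc]
    refine le_mul_of_one_le_left (hS.flow.η_pos t ht).le ?_
    rw [le_inv_mul_iff₀ hp, mul_one]
    exact Real.rpow_le_rpow hr.le h3 (by linarith [hS.one_le])

end StableMarginFlow


/-! ### Slow variation of the weights and tracking by moving averages. -/

section Weights

variable {m K : ℕ} {rows cols : Fin K → ℕ} {q : ℕ}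

/-- The scaled weight of sample `i` along a trajectory. -/
noncomputable def sampleWeight (α L : ℝ) (φ : ℝ → ℝ) (F : Fin m → Param rows cols q → ℝ)
    (y : Fin m → ℝ) (θ : ℝ → Param rows cols q) (i : Fin m) (t : ℝ) : ℝ :=
  scaledWeight φ L (y i * F i (θ t)) (hybridNorm α (θ t))

/-- The sum of the scaled weights. -/
noncomputable def totalWeight (α L : ℝ) (φ : ℝ → ℝ) (F : Fin m → Param rows cols q → ℝ)
    (y : Fin m → ℝ) (θ : ℝ → Param rows cols q) (t : ℝ) : ℝ :=
  ∑ i, sampleWeight α L φ F y θ i t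

/-- The negative loss gradient, with model subgradients replaced by their limits. -/
noncomputable def limitGradient (α L : ℝ) (φ : ℝ → ℝ) (F : Fin m → Param rows cols q → ℝ)
    (y : Fin m → ℝ) (θ : ℝ → Param rows cols q) (l : Fin m → Param rows cols q) (t : ℝ) :
    Param rows cols q :=
  ∑ i, (sampleWeight α L φ F y θ i t * y i) • l i

end Weights

namespace StableMarginFlow

variable {m K : ℕ} {rows cols : Fin K → ℕ} {q : ℕ} {ηM ηA cM c₁ c₂ : ℝ}
    {η : ℝ → ℝ} {θ v g : ℝ → Param rows cols q} {L : ℝ} {φ : ℝ → ℝ}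
    {F : Fin m → Param rows cols q → ℝ} {y : Fin m → ℝ} {h : Fin m → ℝ → Param rows cols q}
    {l : Fin m → Param rows cols q} {θbar : Param rows cols q} {γ : ℝ}

local notation "N" => hybridNorm (ηA / ηM)
local notation "𝔟" => sampleWeight (ηA / ηM) L φ F y θ
local notation "𝔅" => totalWeight (ηA / ηM) L φ F y θ
local notation "𝔭" => limitGradient (ηA / ηM) L φ F y θ l

theorem nonempty (hS : StableMarginFlow ηM ηA cM c₁ c₂ η θ v g L φ F y h l θbar γ) :
    Nonempty (Fin m) := ⟨hS.γ_attained.choose⟩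

theorem exists_lipschitzOnWith_output
    (hS : StableMarginFlow ηM ηA cM c₁ c₂ η θ v g L φ F y h l θbar γ) (i : Fin m) {s t : ℝ}
    (hs : 0 ≤ s) : ∃ C, LipschitzOnWith C (fun r => F i (θ r)) (Set.Icc s t) :=
  hS.flow.exists_lipschitzOnWith_comp (hS.locallyLipschitz i) hs

/-- By the chain rule the speed of an output is at most ‖h‖ ‖v‖, hence at most a constant times
N^{L-1} η, which tends to 0. -/
theorem exists_abs_output_sub_le
    (hS : StableMarginFlow ηM ηA cM c₁ c₂ η θ v g L φ F y h l θbar γ) {ε : ℝ} (hε : 0 < ε) :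
    ∃ T, 0 ≤ T ∧ ∀ i s t, T ≤ s → s ≤ t → |F i (θ s) - F i (θ t)| ≤ ε * (t - s) := by
  obtain ⟨R, hR, hv⟩ := hS.flow.exists_velocity_bound
  obtain ⟨C, hC, h1⟩ := hS.exists_subgradient_bound
  have h2 : Tendsto (fun t => C * R * (N (θ t) ^ (L - 1) * η t)) atTop (𝓝 0) := by
    simpa using hS.tendsto_rpow_norm_mul.const_mul (C * R)
  obtain ⟨T, hT⟩ := eventually_atTop.1 (h1.and (h2.eventually (gt_mem_nhds hε)))
  refine ⟨max T 0, le_max_right _ _, fun i s t hs ht => ?_⟩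
  have hs0 : 0 ≤ s := (le_max_right _ _).trans hs
  obtain ⟨C', hC'⟩ := hS.exists_lipschitzOnWith_output i (t := t) hs0
  rw [abs_sub_comm]
  refine abs_sub_le_of_lipschitzOn ht hC' ?_
  filter_upwards [hS.chain_rule i, hv] with r h3 h4 hr
  have hr0 : 0 < r := hs0.trans_lt hr.1
  obtain ⟨h5, h6⟩ := hT r ((le_max_left _ _).trans (hs.trans hr.1.le))
  refine ⟨_, h3 hr0, (abs_real_inner_le_norm _ _).trans ?_⟩
  calc ‖h i r‖ * ‖v r‖ ≤ (C * N (θ r) ^ (L - 1)) * (R * η r) :=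
        mul_le_mul (h5 i) (h4 hr0) (norm_nonneg _)
          (mul_nonneg hC.le (Real.rpow_nonneg (hybridNorm_nonneg _ _) _))
    _ = C * R * (N (θ r) ^ (L - 1) * η r) := by ring
    _ ≤ ε := h6.le

theorem exists_abs_norm_sub_le
    (hS : StableMarginFlow ηM ηA cM c₁ c₂ η θ v g L φ F y h l θbar γ) {ε : ℝ} (hε : 0 < ε) :
    ∃ T, ∀ s t, T ≤ s → s ≤ t → |N (θ s) - N (θ t)| ≤ ε * (t - s) := by
  obtain ⟨R, hR, hv⟩ := hS.flow.exists_velocity_bound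
  obtain ⟨C, hC, h1⟩ := exists_hybridNorm_le_mul_norm (rows := rows) (cols := cols) (q := q)
    hS.α_pos.le
  have h2 : Tendsto (fun t => C * R * η t) atTop (𝓝 0) := by
    simpa using hS.tendsto_η.const_mul (C * R)
  obtain ⟨T, hT⟩ := eventually_atTop.1 (h2.eventually (gt_mem_nhds hε))
  refine ⟨max T 0, fun s t hs ht => ?_⟩
  have hs0 : 0 ≤ s := (le_max_right _ _).trans hs
  have h3 := abs_sub_map_le_sub (hybridSeminorm hS.α_pos.le : Seminorm ℝ (Param rows cols q))
    (θ t) (θ s)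
  rw [coe_hybridSeminorm] at h3
  rw [abs_sub_comm]
  refine h3.trans ((h1 _).trans ?_)
  have h4 := hS.flow.norm_sub_le hR hv hs0 ht
  calc C * ‖θ t - θ s‖ ≤ C * (R * η s * (t - s)) := mul_le_mul_of_nonneg_left h4 hC.le
    _ = C * R * η s * (t - s) := by ring
    _ ≤ ε * (t - s) := mul_le_mul_of_nonneg_right (hT s ((le_max_left _ _).trans hs)).le
        (sub_nonneg.2 ht)

/-- The logarithm of the weight is -φ(z) + log φ'(z) + (L - 1) log N. Each term is Lipschitz in z or
N on the relevant range, and both z and N move at vanishing speed. -/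
theorem slowlyVarying_sampleWeight
    (hS : StableMarginFlow ηM ηA cM c₁ c₂ η θ v g L φ F y h l θbar γ) (i : Fin m) :
    SlowlyVarying (𝔟 i) := by
  refine SlowlyVarying.of_log fun ε hε => ?_
  obtain ⟨β, hβ0, -, hβ⟩ := hS.lossExponent.exists_tendsto_deriv
  obtain ⟨D, hD0, hD⟩ := hS.lossExponent.exists_abs_log_deriv_sub_le
  obtain ⟨r, hr, hN⟩ := hS.exists_eventually_le_norm
  have hL1 : 0 ≤ L - 1 := by linarith [hS.one_le]
  -- Sum of the three Lipschitz constants; the extra 1 only ensures positivity of `c`.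
  set c := β + D + (L - 1) / r + 1 with hc
  have hc0 : 0 < c := by positivity
  obtain ⟨T₁, -, hT₁⟩ := hS.exists_abs_output_sub_le (div_pos hε hc0)
  obtain ⟨T₂, hT₂⟩ := hS.exists_abs_norm_sub_le (div_pos hε hc0)
  obtain ⟨T₃, hT₃⟩ := eventually_atTop.1 (hN.and (hS.eventually_output_nonneg i))
  refine ⟨max T₁ (max T₂ T₃), fun s t hs ht => ?_⟩
  have hs1 : T₁ ≤ s := (le_max_left _ _).trans hs
  have hs2 : T₂ ≤ s := ((le_max_left _ _).trans (le_max_right _ _)).trans hs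
  have hs3 : T₃ ≤ s := ((le_max_right _ _).trans (le_max_right _ _)).trans hs
  have hNs := (hT₃ s hs3).1
  have hNt := (hT₃ t (hs3.trans ht)).1
  have hzs := (hT₃ s hs3).2
  have hzt := (hT₃ t (hs3.trans ht)).2
  have hlog : ∀ r', r ≤ N (θ r') → Real.log (𝔟 i r') =
      -φ (y i * F i (θ r')) + Real.log (deriv φ (y i * F i (θ r'))) + (L - 1) * Real.log (N (θ r')) := by
    intro r' hr'
    have hN0 := hr.trans_le hr'
    have hd := (hS.lossExponent.deriv_pos (y i * F i (θ r'))).ne'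
    rw [sampleWeight, scaledWeight, lossWeight, Real.log_mul (mul_ne_zero (Real.exp_ne_zero _) hd)
      (Real.rpow_pos_of_pos hN0 _).ne', Real.log_mul (Real.exp_ne_zero _) hd, Real.log_exp,
      Real.log_rpow hN0]
  refine ⟨scaledWeight_pos hS.lossExponent (hr.trans_le hNs), ?_⟩
  rw [hlog s hNs, hlog t hNt]
  have e0 : |y i * F i (θ s) - y i * F i (θ t)| ≤ ε / c * (t - s) := by
    rw [← mul_sub, abs_mul, hS.abs_y, one_mul]
    exact hT₁ i s t hs1 ht
  have e1 := (hS.lossExponent.abs_sub_le hβ (y i * F i (θ s)) (y i * F i (θ t))).trans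
    (mul_le_mul_of_nonneg_left e0 hβ0.le)
  have e2 := (hD _ _ hzs hzt).trans (mul_le_mul_of_nonneg_left e0 hD0)
  have e3 := (abs_log_sub_log_le hr hNs hNt).trans
    (div_le_div_of_nonneg_right (hT₂ s t hs2 ht) hr.le)
  have e4 := mul_le_mul_of_nonneg_left e3 hL1
  set φs := φ (y i * F i (θ s))
  set φt := φ (y i * F i (θ t))
  set ds := Real.log (deriv φ (y i * F i (θ s)))
  set dt := Real.log (deriv φ (y i * F i (θ t)))
  set ns := Real.log (N (θ s))
  set nt := Real.log (N (θ t))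
  have e5 : |(-φs + ds + (L - 1) * ns) - (-φt + dt + (L - 1) * nt)| ≤
      |φs - φt| + |ds - dt| + (L - 1) * |ns - nt| := by
    calc _ = |(-(φs - φt) + (ds - dt)) + (L - 1) * (ns - nt)| := by congr 1; ring
      _ ≤ |-(φs - φt)| + |ds - dt| + |(L - 1) * (ns - nt)| :=
          (abs_add_le _ _).trans (add_le_add_left (abs_add_le _ _) _)
      _ = _ := by rw [abs_neg, abs_mul, abs_of_nonneg hL1]
  refine e5.trans ?_
  have e6 : (L - 1) * (ε / c * (t - s) / r) = (L - 1) / r * (ε / c * (t - s)) := by ring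
  rw [e6] at e4
  have e7 : ε * (t - s) = c * (ε / c * (t - s)) := by field_simp
  have e8 : 0 ≤ ε / c * (t - s) := mul_nonneg (div_pos hε hc0).le (sub_nonneg.2 ht)
  rw [e7, hc]
  linarith

theorem slowlyVarying_totalWeight
    (hS : StableMarginFlow ηM ηA cM c₁ c₂ η θ v g L φ F y h l θbar γ) : SlowlyVarying 𝔅 := by
  have := hS.nonempty
  exact SlowlyVarying.sum Finset.univ_nonempty fun i _ => hS.slowlyVarying_sampleWeight i

theorem gradient_add_limitGradient
    (hS : StableMarginFlow ηM ηA cM c₁ c₂ η θ v g L φ F y h l θbar γ) {t : ℝ} (ht : 0 ≤ t)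
    (hN : 0 < N (θ t)) :
    g t + 𝔭 t = -∑ i, (𝔟 i t * y i) • ((N (θ t) ^ (L - 1))⁻¹ • h i t - l i) := by
  have hp := (Real.rpow_pos_of_pos hN (L - 1)).ne'
  rw [hS.gradient_eq t ht, limitGradient, neg_add_eq_sub, ← neg_sub, ← Finset.sum_sub_distrib]
  congr 1
  refine Finset.sum_congr rfl fun i _ => ?_
  rw [smul_sub, smul_smul]
  congr 2
  rw [sampleWeight, scaledWeight, lossWeight]
  field_simp

/-- The gradient is asymptotic to `-𝔭`, relative to the total weight. -/
theorem exists_norm_gradient_add_le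
    (hS : StableMarginFlow ηM ηA cM c₁ c₂ η θ v g L φ F y h l θbar γ) {ε : ℝ} (hε : 0 < ε) :
    ∀ᶠ t in atTop, ‖g t + 𝔭 t‖ ≤ ε * 𝔅 t := by
  have h1 : ∀ᶠ t in atTop, ∀ i, ‖(N (θ t) ^ (L - 1))⁻¹ • h i t - l i‖ < ε :=
    eventually_all.2 fun i => by
      have := ((hS.tendsto_subgradient i).sub_const (l i)).norm
      rw [sub_self, norm_zero] at this
      exact this.eventually (gt_mem_nhds hε)
  filter_upwards [h1, hS.eventually_norm_pos, eventually_ge_atTop 0] with t h2 hN ht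
  rw [hS.gradient_add_limitGradient ht hN, norm_neg, totalWeight, Finset.mul_sum]
  refine (norm_sum_le _ _).trans (Finset.sum_le_sum fun i _ => ?_)
  have h3 : 0 < 𝔟 i t := scaledWeight_pos hS.lossExponent hN
  rw [norm_smul, norm_mul, Real.norm_of_nonneg h3.le, Real.norm_eq_abs, hS.abs_y, mul_one, mul_comm]
  exact mul_le_mul_of_nonneg_right (h2 i).le h3.le

theorem eventually_norm_limitGradient_le
    (hS : StableMarginFlow ηM ηA cM c₁ c₂ η θ v g L φ F y h l θbar γ) :
    ∀ᶠ t in atTop, ‖𝔭 t‖ ≤ (∑ i, ‖l i‖) * 𝔅 t := by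
  filter_upwards [hS.eventually_norm_pos] with t hN
  rw [limitGradient, totalWeight, Finset.mul_sum]
  refine (norm_sum_le _ _).trans (Finset.sum_le_sum fun i _ => ?_)
  have h3 : 0 < 𝔟 i t := scaledWeight_pos hS.lossExponent hN
  rw [norm_smul, norm_mul, Real.norm_of_nonneg h3.le, Real.norm_eq_abs, hS.abs_y, mul_one, mul_comm]
  exact mul_le_mul_of_nonneg_right
    (Finset.single_le_sum (f := fun i => ‖l i‖) (fun _ _ => norm_nonneg _) (Finset.mem_univ i)) h3.le

/-- The error at time `s` itself and the drift of the weights from `s` to `t` are merged. The 1 in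
the exponent makes room for the static error, since e^ε ≥ 1 + ε. -/
theorem exists_norm_gradient_add_limitGradient_le
    (hS : StableMarginFlow ηM ηA cM c₁ c₂ η θ v g L φ F y h l θbar γ) {ε : ℝ} (hε : 0 < ε) :
    ∃ T, ∀ s t, T ≤ s → s ≤ t →
      ‖g s + 𝔭 t‖ ≤ (1 + ∑ i, ‖l i‖) * (Real.exp (ε * (1 + (t - s))) - 1) * 𝔅 t := by
  choose T₁ hT₁ using fun i => hS.slowlyVarying_sampleWeight i ε hε
  obtain ⟨T₂, hT₂⟩ := hS.slowlyVarying_totalWeight ε hε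
  obtain ⟨T₃, hT₃⟩ := eventually_atTop.1 (hS.exists_norm_gradient_add_le hε)
  obtain ⟨T₁', hT₁'⟩ := (Set.finite_range T₁).bddAbove
  refine ⟨max T₁' (max T₂ T₃), fun s t hs ht => ?_⟩
  have hs1 : ∀ i, T₁ i ≤ s := fun i => (hT₁' ⟨i, rfl⟩).trans ((le_max_left _ _).trans hs)
  have hs2 : T₂ ≤ s := ((le_max_left _ _).trans (le_max_right _ _)).trans hs
  have hs3 : T₃ ≤ s := ((le_max_right _ _).trans (le_max_right _ _)).trans hs
  have hBt := (hT₂ t t (hs2.trans ht) le_rfl).1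
  have e1 := hT₃ s hs3
  have e2 := SlowlyVarying.le_exp_mul (hT₂ s t hs2 ht).2
  set x := Real.exp (ε * (t - s)) with hx
  have hx1 : 1 ≤ x := Real.one_le_exp (mul_nonneg hε.le (sub_nonneg.2 ht))
  have hX : Real.exp (ε * (1 + (t - s))) = Real.exp ε * x := by
    rw [hx, ← Real.exp_add]; congr 1; ring
  have hεe : 1 + ε ≤ Real.exp ε := by linarith [Real.add_one_le_exp ε]
  set S := ∑ i, ‖l i‖ with hSdef
  have hS0 : 0 ≤ S := Finset.sum_nonneg fun _ _ => norm_nonneg _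
  have e3 : ‖𝔭 t - 𝔭 s‖ ≤ S * (x - 1) * 𝔅 t := by
    rw [limitGradient, limitGradient, ← Finset.sum_sub_distrib, totalWeight, Finset.mul_sum]
    refine (norm_sum_le _ _).trans (Finset.sum_le_sum fun i _ => ?_)
    rw [← sub_smul, ← sub_mul, norm_smul, norm_mul, Real.norm_eq_abs (y i), hS.abs_y, mul_one,
      Real.norm_eq_abs, abs_sub_comm]
    have h3 := (hT₁ i s t (hs1 i) ht).2
    have h4 : ‖l i‖ ≤ S :=
      Finset.single_le_sum (f := fun i => ‖l i‖) (fun _ _ => norm_nonneg _) (Finset.mem_univ i)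
    have h5 := (hT₁ i t t ((hs1 i).trans ht) le_rfl).1
    calc _ ≤ (x - 1) * 𝔟 i t * S := mul_le_mul h3 h4 (norm_nonneg _)
          (mul_nonneg (sub_nonneg.2 hx1) h5.le)
      _ = _ := by ring
  rw [hX]
  calc ‖g s + 𝔭 t‖ = ‖(g s + 𝔭 s) + (𝔭 t - 𝔭 s)‖ := by congr 1; abel
    _ ≤ ε * 𝔅 s + S * (x - 1) * 𝔅 t := (norm_add_le _ _).trans (add_le_add e1 e3)
    _ ≤ ε * (x * 𝔅 t) + S * (x - 1) * 𝔅 t :=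
        add_le_add_left (mul_le_mul_of_nonneg_left e2 hε.le) _
    _ = (ε * x + S * (x - 1)) * 𝔅 t := by ring
    _ ≤ (1 + S) * (Real.exp ε * x - 1) * 𝔅 t := by
        refine mul_le_mul_of_nonneg_right ?_ hBt.le
        have h6 : (1 + ε) * x ≤ Real.exp ε * x :=
          mul_le_mul_of_nonneg_right hεe (zero_le_one.trans hx1)
        have h7 : 0 ≤ ε * x := mul_nonneg hε.le (zero_le_one.trans hx1)
        have h8 : S * (x - 1) ≤ S * (Real.exp ε * x - 1) :=
          mul_le_mul_of_nonneg_left (by linarith) hS0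
        linarith

theorem tendsto_ema_add_div
    (hS : StableMarginFlow ηM ηA cM c₁ c₂ η θ v g L φ F y h l θbar γ) {c : ℝ} (hc : 0 < c)
    (idx : ParamIndex rows cols q) :
    Tendsto (fun t => (ema c (fun s => g s idx) t + 𝔭 t idx) / 𝔅 t) atTop (𝓝 0) := by
  have hA : 0 ≤ 1 + ∑ i, ‖l i‖ := by positivity
  have h1 := tendsto_ema_sub_div (p := fun t => -𝔭 t idx) hc hA hS.slowlyVarying_totalWeight ?_
    (fun T hT => hS.flow.integrableOn_apply idx hT) ?_
  · simpa using h1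
  · filter_upwards [hS.eventually_norm_limitGradient_le, hS.slowlyVarying_totalWeight.eventually_pos]
      with t ht hB
    rw [abs_neg]
    refine (PiLp.norm_apply_le (𝔭 t) idx).trans (ht.trans ?_)
    linarith
  · intro ε hε
    obtain ⟨T, hT⟩ := hS.exists_norm_gradient_add_limitGradient_le hε
    refine ⟨T, fun s t hs ht => ?_⟩
    rw [sub_neg_eq_add]
    exact (PiLp.norm_apply_le (g s + 𝔭 t) idx).trans (hT s t hs ht)

theorem tendsto_ema_sq_sub_div
    (hS : StableMarginFlow ηM ηA cM c₁ c₂ η θ v g L φ F y h l θbar γ) {c : ℝ} (hc : 0 < c)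
    (idx : ParamIndex rows cols q) :
    Tendsto (fun t => (ema c (fun s => g s idx ^ 2) t - 𝔭 t idx ^ 2) / 𝔅 t ^ 2) atTop (𝓝 0) := by
  set A := 1 + ∑ i, ‖l i‖ with hAdef
  have hA : 0 ≤ A := by positivity
  have hpA : ∀ᶠ t in atTop, |𝔭 t idx| ≤ A * 𝔅 t := by
    filter_upwards [hS.eventually_norm_limitGradient_le, hS.slowlyVarying_totalWeight.eventually_pos]
      with t ht hB
    refine (PiLp.norm_apply_le (𝔭 t) idx).trans (ht.trans ?_)
    linarith
  refine tendsto_ema_sub_div (A := 2 * A ^ 2) hc (by positivity)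
    hS.slowlyVarying_totalWeight.sq ?_ (fun T hT => hS.flow.integrableOn_apply_sq idx hT) ?_
  · filter_upwards [hpA] with t ht
    rw [abs_pow]
    have := pow_le_pow_left₀ (abs_nonneg _) ht 2
    rw [mul_pow] at this
    nlinarith [sq_nonneg (A * 𝔅 t)]
  · intro ε hε
    -- ε is halved because g² - p² factors into a difference of size X - 1 and a sum of size X + 1,
    -- whose product X² - 1 must match e^{ε(1+t-s)} - 1.
    obtain ⟨T, hT⟩ := hS.exists_norm_gradient_add_limitGradient_le (half_pos hε)
    obtain ⟨T', hT'⟩ := eventually_atTop.1 (hpA.and hS.slowlyVarying_totalWeight.eventually_pos)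
    refine ⟨max T T', fun s t hs ht => ?_⟩
    have h1 := (PiLp.norm_apply_le (g s + 𝔭 t) idx).trans
      (hT s t ((le_max_left _ _).trans hs) ht)
    obtain ⟨h2, hB⟩ := hT' t (((le_max_right _ _).trans hs).trans ht)
    change |g s idx + 𝔭 t idx| ≤ _ at h1
    rw [← hAdef] at h1
    set X := Real.exp (ε / 2 * (1 + (t - s))) with hX
    have hX1 : 1 ≤ X := Real.one_le_exp (mul_nonneg (half_pos hε).le
      (by linarith))
    have hX2 : Real.exp (ε * (1 + (t - s))) = X ^ 2 := by
      rw [hX, ← Real.exp_nat_mul]; congr 1; push_cast; ring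
    rw [hX2]
    have h3 : |g s idx - 𝔭 t idx| ≤ A * (X + 1) * 𝔅 t := by
      calc |g s idx - 𝔭 t idx| = |(g s idx + 𝔭 t idx) - 2 * 𝔭 t idx| := by congr 1; ring
        _ ≤ |g s idx + 𝔭 t idx| + 2 * |𝔭 t idx| := by
            refine (abs_sub _ _).trans ?_
            rw [abs_mul, abs_two]
        _ ≤ A * (X - 1) * 𝔅 t + 2 * (A * 𝔅 t) := by linarith
        _ = _ := by ring
    calc |g s idx ^ 2 - 𝔭 t idx ^ 2| = |g s idx + 𝔭 t idx| * |g s idx - 𝔭 t idx| := by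
          rw [← abs_mul]; congr 1; ring
      _ ≤ (A * (X - 1) * 𝔅 t) * (A * (X + 1) * 𝔅 t) :=
          mul_le_mul h1 h3 (abs_nonneg _) ((abs_nonneg _).trans h1)
      _ = A ^ 2 * (X ^ 2 - 1) * 𝔅 t ^ 2 := by ring
      _ ≤ _ := by
          have : 0 ≤ A ^ 2 * (X ^ 2 - 1) * 𝔅 t ^ 2 := by
            have : 0 ≤ X ^ 2 - 1 := by nlinarith
            positivity
          linarith

/-- The velocity is asymptotically a direction of steepest descent for the hybrid norm. -/
theorem exists_alignment
    (hS : StableMarginFlow ηM ηA cM c₁ c₂ η θ v g L φ F y h l θbar γ) :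
    ∃ δ : ℝ → ℝ, Tendsto δ atTop (𝓝 0) ∧ ∀ᵐ t, 0 < t → 0 < 𝔅 t →
      ∀ d, N d ≤ 1 → ηA * η t * inner ℝ (𝔭 t) d ≤ inner ℝ (𝔭 t) (v t) + ηA * η t * (δ t * 𝔅 t) := by
  refine hS.flow.exists_alignment (A := ∑ i, ‖l i‖) (fun idx => ?_)
    (fun c hc idx => hS.tendsto_ema_add_div hc idx)
    (fun idx => hS.tendsto_ema_sq_sub_div hS.flow.c₂_pos idx)
  filter_upwards [hS.eventually_norm_limitGradient_le, hS.slowlyVarying_totalWeight.eventually_pos]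
    with t ht hB
  rw [abs_div, abs_of_pos hB, div_le_iff₀ hB]
  exact (PiLp.norm_apply_le (𝔭 t) idx).trans ht

end StableMarginFlow


/-- A function whose derivative eventually dominates `c * η` eventually dominates `c * ∫ η`. -/
theorem MuonAdamFlow.exists_mul_integral_sub_le {K : ℕ} {rows cols : Fin K → ℕ} {q : ℕ}
    {ηM ηA cM c₁ c₂ : ℝ} {η : ℝ → ℝ} {θ v g : ℝ → Param rows cols q}
    (hF : MuonAdamFlow ηM ηA cM c₁ c₂ η θ v g) {Z : ℝ → ℝ} {c T : ℝ}
    (hZ : ∀ s t, T ≤ s → s ≤ t → ∃ C, LipschitzOnWith C Z (Set.Icc s t))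
    (hd : ∀ᵐ t, T < t → ∃ D, HasDerivAt Z D t ∧ c * η t ≤ D) :
    ∃ C, ∀ᶠ t in atTop, c * (∫ s in (0 : ℝ)..t, η s) - C ≤ Z t := by
  set S := max T 0
  have hS0 : 0 ≤ S := le_max_right _ _
  refine ⟨c * (∫ s in (0 : ℝ)..S, η s) - Z S, ?_⟩
  filter_upwards [eventually_ge_atTop S] with t ht
  obtain ⟨C, hC⟩ := hZ S t (le_max_left _ _) ht
  have h1 := integral_le_sub_of_lipschitzOn ht hC
    ((hF.intervalIntegrable_η hS0 ht).const_mul c) (by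
      filter_upwards [hd] with r hr hr'
      exact hr ((le_max_left _ _).trans_lt hr'.1))
  rw [intervalIntegral.integral_const_mul] at h1
  rw [← intervalIntegral.integral_add_adjacent_intervals
    (hF.intervalIntegrable_η le_rfl hS0) (hF.intervalIntegrable_η hS0 ht)]
  linarith

/-! ### Growth of the negative log-loss and its consequences. -/

section LogLoss

variable {m K : ℕ} {rows cols : Fin K → ℕ} {q : ℕ}

/-- The training loss along a trajectory. -/
noncomputable def lossAlong (φ : ℝ → ℝ) (F : Fin m → Param rows cols q → ℝ) (y : Fin m → ℝ)
    (θ : ℝ → Param rows cols q) (t : ℝ) : ℝ :=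
  ∑ i, Real.exp (-φ (y i * F i (θ t)))

/-- The negative logarithm of the training loss along a trajectory. -/
noncomputable def negLogLoss (φ : ℝ → ℝ) (F : Fin m → Param rows cols q → ℝ) (y : Fin m → ℝ)
    (θ : ℝ → Param rows cols q) (t : ℝ) : ℝ :=
  -Real.log (lossAlong φ F y θ t)

end LogLoss

namespace StableMarginFlow

variable {m K : ℕ} {rows cols : Fin K → ℕ} {q : ℕ} {ηM ηA cM c₁ c₂ : ℝ}
    {η : ℝ → ℝ} {θ v g : ℝ → Param rows cols q} {L : ℝ} {φ : ℝ → ℝ}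
    {F : Fin m → Param rows cols q → ℝ} {y : Fin m → ℝ} {h : Fin m → ℝ → Param rows cols q}
    {l : Fin m → Param rows cols q} {θbar : Param rows cols q} {γ : ℝ}

local notation "N" => hybridNorm (ηA / ηM)
local notation "𝔟" => sampleWeight (ηA / ηM) L φ F y θ
local notation "𝔅" => totalWeight (ηA / ηM) L φ F y θ
local notation "𝔭" => limitGradient (ηA / ηM) L φ F y θ l
local notation "𝓛" => lossAlong φ F y θ
local notation "𝔾" => negLogLoss φ F y θ

theorem lossAlong_pos (hS : StableMarginFlow ηM ηA cM c₁ c₂ η θ v g L φ F y h l θbar γ) (t : ℝ) :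
    0 < 𝓛 t := by
  have := hS.nonempty
  exact Finset.sum_pos (fun _ _ => Real.exp_pos _) Finset.univ_nonempty

theorem negLogLoss_le (i : Fin m) (t : ℝ) : 𝔾 t ≤ φ (y i * F i (θ t)) := by
  rw [negLogLoss, neg_le, ← Real.log_exp (-φ (y i * F i (θ t)))]
  exact Real.log_le_log (Real.exp_pos _) (Finset.single_le_sum
    (f := fun i => Real.exp (-φ (y i * F i (θ t)))) (fun _ _ => (Real.exp_pos _).le)
    (Finset.mem_univ i))

theorem exists_lipschitzOnWith_negLogLoss
    (hS : StableMarginFlow ηM ηA cM c₁ c₂ η θ v g L φ F y h l θbar γ) {s t : ℝ} (hs : 0 ≤ s) :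
    ∃ C, LipschitzOnWith C 𝔾 (Set.Icc s t) := by
  choose C hC using fun i => hS.exists_lipschitzOnWith_output i (t := t) hs
  have h1 : LipschitzOnWith (∑ i, C i) (fun r (i : Fin m) => F i (θ r)) (Set.Icc s t) := by
    refine LipschitzOnWith.of_dist_le_mul fun a ha b hb => ?_
    refine (dist_pi_le_iff (by positivity)).2 fun i => ?_
    refine ((hC i).dist_le_mul a ha b hb).trans (mul_le_mul_of_nonneg_right ?_ dist_nonneg)
    exact_mod_cast Finset.single_le_sum (f := C) (fun _ _ => zero_le) (Finset.mem_univ i)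
  refine exists_lipschitzOnWith_comp
    (Φ := fun w : Fin m → ℝ => -Real.log (∑ i, Real.exp (-φ (y i * w i)))) h1 fun r _ => ?_
  have hφ1 : ContDiff ℝ 1 φ := hS.lossExponent.contDiff.of_le one_le_two
  have h2 : ContDiff ℝ 1 fun w : Fin m → ℝ => ∑ i, Real.exp (-φ (y i * w i)) :=
    ContDiff.sum fun i _ => (hφ1.comp (contDiff_const.mul (contDiff_apply ℝ ℝ i))).neg.exp
  exact (h2.contDiffAt.log (hS.lossAlong_pos r).ne').neg

theorem ae_hasDerivAt_negLogLoss
    (hS : StableMarginFlow ηM ηA cM c₁ c₂ η θ v g L φ F y h l θbar γ) :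
    ∀ᵐ t, 0 < t → HasDerivAt 𝔾 (-inner ℝ (g t) (v t) / 𝓛 t) t := by
  filter_upwards [ae_all_iff.2 hS.chain_rule] with t h1 ht
  have h2 : ∀ i, HasDerivAt (fun s => Real.exp (-φ (y i * F i (θ s))))
      (Real.exp (-φ (y i * F i (θ t))) *
        (-(deriv φ (y i * F i (θ t)) * (y i * inner ℝ (h i t) (v t))))) t := fun i =>
    (((hS.lossExponent.differentiable _).hasDerivAt.comp t ((h1 i ht).const_mul (y i))).neg).exp
  have h3 : HasDerivAt 𝓛 _ t := HasDerivAt.fun_sum (u := Finset.univ) fun i _ => h2 i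
  have h4 := (h3.log (hS.lossAlong_pos t).ne').neg
  refine h4.congr_deriv ?_
  rw [← neg_div]
  congr 2
  rw [hS.gradient_eq t ht.le, inner_neg_left, sum_inner, ← Finset.sum_neg_distrib]
  refine Finset.sum_congr rfl fun i _ => ?_
  rw [real_inner_smul_left]
  ring

theorem eventually_totalWeight_pos
    (hS : StableMarginFlow ηM ηA cM c₁ c₂ η θ v g L φ F y h l θbar γ) : ∀ᶠ t in atTop, 0 < 𝔅 t :=
  hS.slowlyVarying_totalWeight.eventually_pos

theorem tendsto_norm_gradient_add_div
    (hS : StableMarginFlow ηM ηA cM c₁ c₂ η θ v g L φ F y h l θbar γ) :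
    Tendsto (fun t => ‖g t + 𝔭 t‖ / 𝔅 t) atTop (𝓝 0) := by
  rw [Metric.tendsto_nhds]
  intro ε hε
  filter_upwards [hS.exists_norm_gradient_add_le (half_pos hε), hS.eventually_totalWeight_pos]
    with t h1 h2
  rw [Real.dist_eq, sub_zero, abs_of_nonneg (by positivity), div_lt_iff₀ h2]
  nlinarith

/-- The decrease of the log-loss is asymptotically at least that of steepest descent. -/
theorem exists_negLogLoss_ascent
    (hS : StableMarginFlow ηM ηA cM c₁ c₂ η θ v g L φ F y h l θbar γ) :
    ∃ δ : ℝ → ℝ, Tendsto δ atTop (𝓝 0) ∧ ∀ᵐ t, 0 < t → 0 < 𝔅 t → ∃ D, HasDerivAt 𝔾 D t ∧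
      ∀ d, N d ≤ 1 → 𝔅 t / 𝓛 t * (ηA * η t * ((𝔅 t)⁻¹ * inner ℝ (𝔭 t) d - δ t)) ≤ D := by
  obtain ⟨δ, hδ, h1⟩ := hS.exists_alignment
  obtain ⟨R, hR, hv⟩ := hS.flow.exists_velocity_bound
  have hηA := hS.flow.ηA_pos
  -- The second term pays for replacing -g by its asymptotic form 𝔭 in the derivative of the
  -- log-loss.
  refine ⟨fun t => δ t + R / ηA * (‖g t + 𝔭 t‖ / 𝔅 t), ?_, ?_⟩
  · simpa using hδ.add (hS.tendsto_norm_gradient_add_div.const_mul (R / ηA))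
  filter_upwards [h1, hv, hS.ae_hasDerivAt_negLogLoss] with t h2 h3 h4 ht hB
  refine ⟨_, h4 ht, fun d hd => ?_⟩
  have h5 := h2 ht hB d hd
  have h6 : inner ℝ (g t + 𝔭 t) (v t) ≤ ‖g t + 𝔭 t‖ * (R * η t) :=
    (real_inner_le_norm _ _).trans (mul_le_mul_of_nonneg_left (h3 ht) (norm_nonneg _))
  rw [inner_add_left] at h6
  rw [le_div_iff₀ (hS.lossAlong_pos t)]
  have hL0 := (hS.lossAlong_pos t).ne'
  have h7 : 𝔅 t / 𝓛 t * (ηA * η t * ((𝔅 t)⁻¹ * inner ℝ (𝔭 t) d -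
      (δ t + R / ηA * (‖g t + 𝔭 t‖ / 𝔅 t)))) * 𝓛 t =
      ηA * η t * inner ℝ (𝔭 t) d - ηA * η t * (δ t * 𝔅 t) - ‖g t + 𝔭 t‖ * (R * η t) := by
    have := hB.ne'
    field_simp
    ring
  rw [h7]
  linarith

/-- Euler's identity at the limit direction, a unit vector, shows that the dual norm of 𝔭 is at
least L γ 𝔅. This is the lower bound that the contradiction argument proves to be asymptotically
attained. -/
theorem le_inner_limitGradient
    (hS : StableMarginFlow ηM ηA cM c₁ c₂ η θ v g L φ F y h l θbar γ) {t : ℝ} (hN : 0 < N (θ t)) :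
    L * γ * 𝔅 t ≤ inner ℝ (𝔭 t) θbar := by
  rw [limitGradient, totalWeight, sum_inner, Finset.mul_sum]
  refine Finset.sum_le_sum fun i _ => ?_
  have h3 : 0 < 𝔟 i t := scaledWeight_pos hS.lossExponent hN
  rw [real_inner_smul_left, hS.inner_limit]
  have h4 : L * γ ≤ L * (y i * F i θbar) :=
    mul_le_mul_of_nonneg_left (hS.γ_le i) (zero_le_one.trans hS.one_le)
  nlinarith

theorem mul_lossAlong_le_totalWeight {t b : ℝ}
    (hb : ∀ i, b ≤ deriv φ (y i * F i (θ t))) : b * N (θ t) ^ (L - 1) * 𝓛 t ≤ 𝔅 t := by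
  rw [lossAlong, totalWeight, Finset.mul_sum]
  refine Finset.sum_le_sum fun i _ => ?_
  rw [sampleWeight, scaledWeight, lossWeight]
  have h1 := Real.rpow_nonneg (hybridNorm_nonneg (ηA / ηM) (θ t)) (L - 1)
  have h2 := mul_le_mul_of_nonneg_left (hb i)
    (mul_nonneg h1 (Real.exp_nonneg (-φ (y i * F i (θ t)))))
  linarith

/-- Testing the ascent inequality with the limit direction gives a derivative of at least a constant
times η, whose integral diverges. -/
theorem tendsto_negLogLoss
    (hS : StableMarginFlow ηM ηA cM c₁ c₂ η θ v g L φ F y h l θbar γ) :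
    Tendsto 𝔾 atTop atTop := by
  obtain ⟨δ, hδ, h1⟩ := hS.exists_negLogLoss_ascent
  obtain ⟨r, hr, hN⟩ := hS.exists_eventually_le_norm
  have hηA := hS.flow.ηA_pos
  have hd := hS.lossExponent.deriv_pos 0
  have hL : 0 < L := zero_lt_one.trans_le hS.one_le
  have hLγ : 0 < L * γ / 2 := half_pos (mul_pos hL hS.γ_pos)
  obtain ⟨T, hT⟩ := eventually_atTop.1 ((hδ.eventually (gt_mem_nhds hLγ)).and
    (hN.and (hS.eventually_totalWeight_pos.and (eventually_all.2 hS.eventually_output_nonneg))))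
  set c := deriv φ 0 * r ^ (L - 1) * (ηA * (L * γ / 2)) with hc
  have hp := Real.rpow_pos_of_pos hr (L - 1)
  have hc0 : 0 < c := by positivity
  obtain ⟨C, hC⟩ := hS.flow.exists_mul_integral_sub_le (Z := 𝔾) (c := c) (T := max T 0)
    (fun s t hs _ => hS.exists_lipschitzOnWith_negLogLoss ((le_max_right _ _).trans hs)) (by
      filter_upwards [h1] with t h2 ht
      have ht0 : 0 < t := (le_max_right _ _).trans_lt ht
      obtain ⟨h3, h4, h5, h6⟩ := hT t ((le_max_left _ _).trans ht.le)
      obtain ⟨D, hD, h7⟩ := h2 ht0 h5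
      refine ⟨D, hD, le_trans ?_ (h7 θbar hS.norm_direction.le)⟩
      have h8 := hS.le_inner_limitGradient (hr.trans_le h4)
      have h9 : L * γ ≤ (𝔅 t)⁻¹ * inner ℝ (𝔭 t) θbar := by
        rw [le_inv_mul_iff₀ h5]; linarith
      have h10 : deriv φ 0 * r ^ (L - 1) ≤ 𝔅 t / 𝓛 t := by
        rw [le_div_iff₀ (hS.lossAlong_pos t)]
        refine le_trans ?_ (mul_lossAlong_le_totalWeight
          fun i => hS.lossExponent.monotone_deriv (h6 i))
        refine mul_le_mul_of_nonneg_right ?_ (hS.lossAlong_pos t).le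
        exact mul_le_mul_of_nonneg_left (Real.rpow_le_rpow hr.le h4 (by linarith [hS.one_le])) hd.le
      have hη := hS.flow.η_pos t ht0.le
      calc c * η t = deriv φ 0 * r ^ (L - 1) * (ηA * η t * (L * γ / 2)) := by rw [hc]; ring
        _ ≤ _ := by
          refine mul_le_mul h10 (mul_le_mul_of_nonneg_left (by linarith) (by positivity))
            (by positivity) (div_nonneg h5.le (hS.lossAlong_pos t).le))
  exact tendsto_atTop_mono' _ hC
    (tendsto_atTop_add_const_right _ (-C) (hS.integral_diverges.const_mul_atTop hc0))

theorem tendsto_output (hS : StableMarginFlow ηM ηA cM c₁ c₂ η θ v g L φ F y h l θbar γ)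
    (i : Fin m) : Tendsto (fun t => y i * F i (θ t)) atTop atTop := by
  obtain ⟨β, hβ0, -, hβ⟩ := hS.lossExponent.exists_tendsto_deriv
  have h1 : Tendsto (fun t => β⁻¹ * (𝔾 t + -φ 0)) atTop atTop :=
    (tendsto_atTop_add_const_right _ (-φ 0) hS.tendsto_negLogLoss).const_mul_atTop (inv_pos.2 hβ0)
  refine tendsto_atTop_mono' _ ?_ h1
  filter_upwards [hS.eventually_output_nonneg i] with t ht
  rw [inv_mul_le_iff₀ hβ0]
  have h2 := hS.lossExponent.sub_le_mul hβ ht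
  have h3 := negLogLoss_le (φ := φ) (F := F) (y := y) (θ := θ) i t
  linarith

theorem tendsto_rpow_norm (hS : StableMarginFlow ηM ηA cM c₁ c₂ η θ v g L φ F y h l θbar γ) :
    Tendsto (fun t => N (θ t) ^ L) atTop atTop := by
  obtain ⟨i, hi⟩ := hS.γ_attained
  have hγ := hS.γ_pos
  have h1 : Tendsto (fun t => (2 * γ)⁻¹ * (y i * F i (θ t))) atTop atTop :=
    (hS.tendsto_output i).const_mul_atTop (by positivity)
  have h2 : y i * F i θbar < 2 * γ := by linarith
  refine tendsto_atTop_mono' _ ?_ h1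
  filter_upwards [(hS.tendsto_normalized_output i).eventually (gt_mem_nhds h2),
    hS.eventually_norm_pos] with t h3 hN
  rw [div_lt_iff₀ (Real.rpow_pos_of_pos hN L)] at h3
  rw [inv_mul_le_iff₀ (by positivity)]
  exact h3.le

/-- Samples away from the margin have asymptotically negligible weight. -/
theorem tendsto_sampleWeight_div
    (hS : StableMarginFlow ηM ηA cM c₁ c₂ η θ v g L φ F y h l θbar γ) {i : Fin m}
    (hi : y i * F i θbar ≠ γ) : Tendsto (fun t => 𝔟 i t / 𝔅 t) atTop (𝓝 0) := by
  obtain ⟨j, hj⟩ := hS.γ_attained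
  obtain ⟨β, hβ0, -, hβ⟩ := hS.lossExponent.exists_tendsto_deriv
  have hd := hS.lossExponent.deriv_pos 0
  have hpos : 0 < y i * F i θbar - y j * F j θbar := by
    rw [← hj, sub_pos]; exact lt_of_le_of_ne (hS.γ_le i) (Ne.symm hi)
  have h1 : Tendsto (fun t => N (θ t) ^ L * (y i * F i (θ t) / N (θ t) ^ L -
      y j * F j (θ t) / N (θ t) ^ L)) atTop atTop :=
    hS.tendsto_rpow_norm.atTop_mul_pos hpos
      ((hS.tendsto_normalized_output i).sub (hS.tendsto_normalized_output j))
  have h2 : Tendsto (fun t => y i * F i (θ t) - y j * F j (θ t)) atTop atTop := by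
    refine h1.congr' ?_
    filter_upwards [hS.eventually_norm_pos] with t hN
    have := (Real.rpow_pos_of_pos hN L).ne'
    field_simp
  -- Upper bound for b_i / b_j, with j a sample attaining the margin. Convexity bounds the
  -- exponential factor, and β / φ'(0) bounds the quotient of the derivatives. The output gap grows
  -- like N^L.
  have h3 : Tendsto (fun t => Real.exp (-(deriv φ 0 * (y i * F i (θ t) - y j * F j (θ t)))) *
      (β / deriv φ 0)) atTop (𝓝 0) := by
    simpa using (Real.tendsto_exp_neg_atTop_nhds_zero.comp
      (h2.const_mul_atTop hd)).mul_const (β / deriv φ 0)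
  refine squeeze_zero' ?_ ?_ h3
  · filter_upwards [hS.eventually_norm_pos, hS.eventually_totalWeight_pos] with t hN hB
    exact div_nonneg (scaledWeight_pos hS.lossExponent hN).le hB.le
  · filter_upwards [hS.eventually_norm_pos, h2.eventually_ge_atTop 0,
      hS.eventually_output_nonneg j, hS.eventually_totalWeight_pos] with t hN h4 h5 hB
    set zi := y i * F i (θ t) with hzi
    set zj := y j * F j (θ t) with hzj
    have hbj : 0 < 𝔟 j t := scaledWeight_pos hS.lossExponent hN
    have h6 : 𝔟 j t ≤ 𝔅 t := Finset.single_le_sum (f := fun i => 𝔟 i t)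
      (fun i _ => (scaledWeight_pos hS.lossExponent hN).le) (Finset.mem_univ j)
    have hE := Real.exp_nonneg (-(deriv φ 0 * (zi - zj)))
    rw [div_le_iff₀ hB]
    refine le_trans ?_ (mul_le_mul_of_nonneg_left h6 (by positivity))
    have h7 := hS.lossExponent.add_mul_le h5 (sub_nonneg.1 h4)
    have h8 : Real.exp (-φ zi) ≤ Real.exp (-(deriv φ 0 * (zi - zj))) * Real.exp (-φ zj) := by
      rw [← Real.exp_add, Real.exp_le_exp]; linarith
    have h9 : deriv φ zi ≤ β / deriv φ 0 * deriv φ zj := by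
      refine (hβ zi).trans ?_
      rw [div_mul_eq_mul_div, le_div_iff₀ hd]
      exact mul_le_mul_of_nonneg_left (hS.lossExponent.monotone_deriv h5) hβ0.le
    rw [sampleWeight, sampleWeight, scaledWeight, scaledWeight, lossWeight, lossWeight,
      ← hzi, ← hzj]
    have hp := (Real.rpow_pos_of_pos hN (L - 1)).le
    calc Real.exp (-φ zi) * deriv φ zi * N (θ t) ^ (L - 1)
        ≤ (Real.exp (-(deriv φ 0 * (zi - zj))) * Real.exp (-φ zj)) *
            (β / deriv φ 0 * deriv φ zj) * N (θ t) ^ (L - 1) :=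
          mul_le_mul_of_nonneg_right (mul_le_mul h8 h9 (hS.lossExponent.deriv_pos _).le
            (by positivity)) hp
      _ = _ := by ring

end StableMarginFlow


/-! ### Near-minimality of the dual norm and the limiting multipliers. -/

theorem exists_slack {e L : ℝ} (he : 0 < e) :
    ∃ κ, 0 < κ ∧ κ < 1 ∧ (1 + κ) ^ 2 < (1 + κ) ^ (1 - L) * (1 - κ) * (1 + e) := by
  have h1 : Tendsto (fun κ : ℝ => (1 + κ) ^ (1 - L) * (1 - κ) * (1 + e) - (1 + κ) ^ 2) (𝓝[>] 0)
      (𝓝 ((1 + 0) ^ (1 - L) * (1 - 0) * (1 + e) - (1 + 0) ^ 2)) := by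
    have h2 : ContinuousAt (fun κ : ℝ => (1 + κ) ^ (1 - L) * (1 - κ) * (1 + e) - (1 + κ) ^ 2) 0 := by
      have h3 : ContinuousAt (fun κ : ℝ => (1 + κ) ^ (1 - L)) 0 :=
        ContinuousAt.rpow_const (by fun_prop) (Or.inl (by norm_num))
      fun_prop
    exact h2.tendsto.mono_left nhdsWithin_le_nhds
  have h4 : (0 : ℝ) < (1 + 0) ^ (1 - L) * (1 - 0) * (1 + e) - (1 + 0) ^ 2 := by
    simp [he]
  obtain ⟨κ, hκ, hκ0, hκ1⟩ := ((h1.eventually (lt_mem_nhds h4)).and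
    (Ioo_mem_nhdsGT (zero_lt_one' ℝ))).exists
  exact ⟨κ, hκ0, hκ1, sub_pos.1 hκ⟩

namespace StableMarginFlow

variable {m K : ℕ} {rows cols : Fin K → ℕ} {q : ℕ} {ηM ηA cM c₁ c₂ : ℝ}
    {η : ℝ → ℝ} {θ v g : ℝ → Param rows cols q} {L : ℝ} {φ : ℝ → ℝ}
    {F : Fin m → Param rows cols q → ℝ} {y : Fin m → ℝ} {h : Fin m → ℝ → Param rows cols q}
    {l : Fin m → Param rows cols q} {θbar : Param rows cols q} {γ : ℝ}

local notation "N" => hybridNorm (ηA / ηM)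
local notation "𝔟" => sampleWeight (ηA / ηM) L φ F y θ
local notation "𝔅" => totalWeight (ηA / ηM) L φ F y θ
local notation "𝔭" => limitGradient (ηA / ηM) L φ F y θ l
local notation "𝓛" => lossAlong φ F y θ
local notation "𝔾" => negLogLoss φ F y θ

/-- For a sample attaining the margin, G ≤ φ(z) ≤ φ(0) + β z with z asymptotic to γ N^L; the
constant φ(0) is negligible because N^L → ∞. -/
theorem eventually_negLogLoss_div_le
    (hS : StableMarginFlow ηM ηA cM c₁ c₂ η θ v g L φ F y h l θbar γ) {β κ : ℝ} (hβ0 : 0 < β)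
    (hβ : ∀ u, deriv φ u ≤ β) (hκ : 0 < κ) :
    ∀ᶠ t in atTop, 𝔾 t / (β * γ) ≤ ((1 + κ) * N (θ t)) ^ L := by
  obtain ⟨i, hi⟩ := hS.γ_attained
  have hγ := hS.γ_pos
  have hL : 0 < L := zero_lt_one.trans_le hS.one_le
  have h1 : Tendsto (fun t => φ 0 * (N (θ t) ^ L)⁻¹ + β * (y i * F i (θ t) / N (θ t) ^ L)) atTop
      (𝓝 (β * γ)) := by
    have := ((tendsto_inv_atTop_zero.comp hS.tendsto_rpow_norm).const_mul (φ 0)).add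
      ((hS.tendsto_normalized_output i).const_mul β)
    rw [← hi, mul_zero, zero_add] at this
    exact this
  have h2 : β * γ < β * γ * (1 + κ) ^ L :=
    lt_mul_of_one_lt_right (by positivity) (Real.one_lt_rpow (by linarith) hL)
  filter_upwards [h1.eventually (gt_mem_nhds h2), hS.eventually_norm_pos,
    hS.eventually_output_nonneg i] with t h3 hN hz
  have hp := Real.rpow_pos_of_pos hN L
  have h4 := hS.lossExponent.sub_le_mul hβ hz
  have h5 := negLogLoss_le (φ := φ) (F := F) (y := y) (θ := θ) i t
  rw [Real.mul_rpow (by linarith) hN.le, div_le_iff₀ (by positivity)]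
  have h6 := mul_lt_mul_of_pos_right h3 hp
  have h7 : (φ 0 * (N (θ t) ^ L)⁻¹ + β * (y i * F i (θ t) / N (θ t) ^ L)) * N (θ t) ^ L =
      φ 0 + β * (y i * F i (θ t)) := by field_simp
  rw [h7] at h6
  linarith

/-- Infinitely often, the dual norm of the normalized gradient is nearly minimal. -/
theorem frequently_inner_limitGradient_le
    (hS : StableMarginFlow ηM ηA cM c₁ c₂ η θ v g L φ F y h l θbar γ) {ε : ℝ} (hε : 0 < ε) :
    ∃ᶠ t in atTop, ∀ d, N d ≤ 1 → (𝔅 t)⁻¹ * inner ℝ (𝔭 t) d ≤ L * γ + ε := by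
  intro hcon
  obtain ⟨δ, hδ, h1⟩ := hS.exists_negLogLoss_ascent
  obtain ⟨β, hβ0, hβlim, hβ⟩ := hS.lossExponent.exists_tendsto_deriv
  have hηA := hS.flow.ηA_pos
  have hγ := hS.γ_pos
  have hL : 0 < L := zero_lt_one.trans_le hS.one_le
  -- L γ (1 + e) = L γ + ε/2: half of the assumed excess is kept, the other half absorbs the error
  -- `δ`.
  set e := ε / (2 * (L * γ)) with he
  have he0 : 0 < e := by positivity
  -- κ measures the loss in G ≤ β γ ((1 + κ) N)^L, in φ' ≥ (1 - κ) β and in the growth bound on N.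
  -- At κ = 0 the required inequality reads 1 < 1 + e.
  obtain ⟨κ, hκ0, hκ1, hκ⟩ := exists_slack (L := L) he0
  set A := (1 + κ) ^ (1 - L) * (1 - κ) * (1 + e) with hA
  have hA0 : 0 < A := lt_of_le_of_lt (by positivity) hκ
  have hderiv : ∀ i, ∀ᶠ t in atTop, (1 - κ) * β ≤ deriv φ (y i * F i (θ t)) := fun i =>
    ((hβlim.comp (hS.tendsto_output i)).eventually
      (lt_mem_nhds (show (1 - κ) * β < β by nlinarith))).mono fun t ht => ht.le
  obtain ⟨T, hT⟩ := eventually_atTop.1 (hcon.and ((hδ.eventually (gt_mem_nhds (half_pos hε))).and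
    ((eventually_all.2 hderiv).and (hS.eventually_norm_pos.and (hS.eventually_totalWeight_pos.and
      ((hS.tendsto_negLogLoss.eventually_gt_atTop 0).and
        (hS.eventually_negLogLoss_div_le hβ0 hβ hκ0)))))))
  have hβγ : 0 < β * γ := mul_pos hβ0 hγ
  -- The L-th root makes the powers of N cancel: N^{L-1} from the ascent rate of G meets N^{1-L}
  -- from the derivative of the root, leaving the rate A ηA η.
  obtain ⟨C, hC⟩ := hS.flow.exists_mul_integral_sub_le
    (Z := fun t => (𝔾 t / (β * γ)) ^ (1 / L)) (c := A * ηA) (T := max T 0) (fun s t hs _ => by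
      obtain ⟨C, hC⟩ := hS.exists_lipschitzOnWith_negLogLoss (t := t) ((le_max_right _ _).trans hs)
      refine exists_lipschitzOnWith_comp (Φ := fun w => (w / (β * γ)) ^ (1 / L)) hC fun r hr => ?_
      have h2 := (hT r ((le_max_left _ _).trans (hs.trans hr.1))).2.2.2.2.2.1
      exact (contDiffAt_id.div_const _).rpow_const_of_ne (div_pos h2 hβγ).ne') (by
      filter_upwards [h1] with t h2 ht
      have ht0 : 0 < t := (le_max_right _ _).trans_lt ht
      obtain ⟨h3, h4, h5, hN, h6, h7, h8⟩ := hT t ((le_max_left _ _).trans ht.le)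
      push Not at h3
      obtain ⟨d, hd, h9⟩ := h3
      obtain ⟨D, hD, h10⟩ := h2 ht0 h6
      have h11 := h10 d hd
      set w := 𝔾 t / (β * γ) with hw
      have hw0 : 0 < w := div_pos h7 hβγ
      refine ⟨_, (hD.div_const (β * γ)).rpow_const (p := 1 / L) (Or.inl hw0.ne'), ?_⟩
      have hη := hS.flow.η_pos t ht0.le
      have hp := Real.rpow_pos_of_pos hN (L - 1)
      have h12 : (1 - κ) * β * N (θ t) ^ (L - 1) ≤ 𝔅 t / 𝓛 t := by
        rw [le_div_iff₀ (hS.lossAlong_pos t)]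
        exact mul_lossAlong_le_totalWeight h5
      have h13 : (1 - κ) * β * N (θ t) ^ (L - 1) * (ηA * η t * (L * γ * (1 + e))) ≤ D := by
        refine le_trans (mul_le_mul h12 (mul_le_mul_of_nonneg_left ?_ (by positivity))
          (by positivity) (div_nonneg h6.le (hS.lossAlong_pos t).le)) h11
        have : L * γ * (1 + e) = L * γ + ε / 2 := by rw [he]; field_simp
        linarith
      have h14 : (1 + κ) ^ (1 - L) * (N (θ t) ^ (L - 1))⁻¹ ≤ w ^ (1 / L - 1) := by
        have h15 : 1 / L - 1 ≤ 0 := by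
          rw [sub_nonpos, div_le_one hL]; exact hS.one_le
        refine le_trans (le_of_eq ?_) (Real.rpow_le_rpow_of_nonpos hw0 h8 h15)
        rw [← Real.rpow_mul (by positivity), show L * (1 / L - 1) = 1 - L by field_simp,
          Real.mul_rpow (by linarith) hN.le, ← Real.rpow_neg hN.le, neg_sub]
      have h16 : A * ηA * η t = ((1 - κ) * β * N (θ t) ^ (L - 1) * (ηA * η t * (L * γ * (1 + e)))) /
          (β * γ) * (1 / L) * ((1 + κ) ^ (1 - L) * (N (θ t) ^ (L - 1))⁻¹) := by
        rw [hA]; field_simp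
      rw [h16]
      have h1κ : 0 ≤ 1 - κ := by linarith
      gcongr
      have : 0 ≤ D := le_trans (by positivity) h13
      positivity)
  obtain ⟨C', hC'⟩ := hS.eventually_norm_le hκ0
  -- The root of G grows at least like A ηA ∫ η, yet is at most (1 + κ) N, hence at most (1 + κ)² ηA
  -- ∫ η up to a constant. As A > (1 + κ)², divergence of ∫ η is contradictory.
  have hdiv : Tendsto (fun t => ((A - (1 + κ) ^ 2) * ηA) * ∫ s in (0 : ℝ)..t, η s) atTop atTop :=
    hS.integral_diverges.const_mul_atTop (mul_pos (sub_pos.2 hκ) hηA)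
  obtain ⟨t, h2, h3, h4, h5, h6⟩ := (hC.and (hC'.and ((hdiv.eventually_gt_atTop
    (C + (1 + κ) * C')).and (eventually_ge_atTop T |>.and hS.eventually_norm_pos)))).exists
  obtain ⟨-, -, -, -, -, h7, h8⟩ := hT t h5
  have h9 : (𝔾 t / (β * γ)) ^ (1 / L) ≤ (1 + κ) * N (θ t) := by
    have := Real.rpow_le_rpow (div_pos h7 hβγ).le h8 (one_div_pos.2 hL).le
    rwa [← Real.rpow_mul (by positivity), mul_one_div_cancel hL.ne', Real.rpow_one] at this
  have h10 := mul_le_mul_of_nonneg_left h3 (by positivity : 0 ≤ 1 + κ)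
  linarith

theorem inv_mul_inner_limitGradient (t : ℝ) (d : Param rows cols q) :
    (𝔅 t)⁻¹ * inner ℝ (𝔭 t) d = ∑ i, 𝔟 i t / 𝔅 t * (y i * inner ℝ (l i) d) := by
  rw [limitGradient, sum_inner, Finset.mul_sum]
  refine Finset.sum_congr rfl fun i _ => ?_
  rw [real_inner_smul_left]
  ring

/-- The limit direction admits multipliers, supported on the samples that attain the margin, that
satisfy the stationarity condition. -/
theorem exists_multipliers
    (hS : StableMarginFlow ηM ηA cM c₁ c₂ η θ v g L φ F y h l θbar γ) :
    ∃ μ : Fin m → ℝ, (∀ i, 0 ≤ μ i) ∧ ∑ i, μ i = 1 ∧ (∀ i, μ i ≠ 0 → y i * F i θbar = γ) ∧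
      ∀ d, N d ≤ 1 → inner ℝ (∑ i, (μ i * y i) • l i) d ≤ L * γ := by
  have h1 : ∀ n : ℕ, ∃ t : ℝ, (n : ℝ) ≤ t ∧ 0 < N (θ t) ∧
      ∀ d, N d ≤ 1 → (𝔅 t)⁻¹ * inner ℝ (𝔭 t) d ≤ L * γ + 1 / ((n : ℝ) + 1) := fun n => by
    obtain ⟨t, h2, h3, h4⟩ := ((hS.frequently_inner_limitGradient_le
      (Nat.one_div_pos_of_nat (α := ℝ) (n := n))).and_eventually
        ((eventually_ge_atTop (n : ℝ)).and hS.eventually_norm_pos)).exists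
    exact ⟨t, h3, h4, h2⟩
  choose s hs hN hle using h1
  have hs_atTop : Tendsto s atTop atTop := tendsto_atTop_mono hs tendsto_natCast_atTop_atTop
  have := hS.nonempty
  have hmem : ∀ n, (fun i => 𝔟 i (s n) / 𝔅 (s n)) ∈ stdSimplex ℝ (Fin m) := fun n => by
    have hb : ∀ i, 0 < 𝔟 i (s n) := fun i => scaledWeight_pos hS.lossExponent (hN n)
    have hB : 0 < 𝔅 (s n) := Finset.sum_pos (fun i _ => hb i) Finset.univ_nonempty
    refine ⟨fun i => (div_pos (hb i) hB).le, ?_⟩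
    rw [← Finset.sum_div]
    exact div_self hB.ne'
  -- The normalized weights need not converge; a limit point along the selected times is enough.
  obtain ⟨μ, hμ, ψ, hψ, hlim⟩ := (isCompact_stdSimplex ℝ (Fin m)).tendsto_subseq hmem
  have hlim' : ∀ i, Tendsto (fun n => 𝔟 i (s (ψ n)) / 𝔅 (s (ψ n))) atTop (𝓝 (μ i)) := fun i =>
    (tendsto_pi_nhds.1 hlim) i
  refine ⟨μ, hμ.1, hμ.2, fun i hi => ?_, fun d hd => ?_⟩
  · by_contra hne
    exact hi (tendsto_nhds_unique (hlim' i)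
      ((hS.tendsto_sampleWeight_div hne).comp (hs_atTop.comp hψ.tendsto_atTop)))
  · have h2 : Tendsto (fun n => ∑ i, 𝔟 i (s (ψ n)) / 𝔅 (s (ψ n)) * (y i * inner ℝ (l i) d)) atTop
        (𝓝 (∑ i, μ i * (y i * inner ℝ (l i) d))) :=
      tendsto_finsetSum _ fun i _ => (hlim' i).mul_const _
    have h3 : Tendsto (fun n => L * γ + 1 / ((ψ n : ℝ) + 1)) atTop (𝓝 (L * γ + 0)) :=
      (tendsto_one_div_add_atTop_nhds_zero_nat.comp hψ.tendsto_atTop).const_add _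
    rw [add_zero] at h3
    have h4 := le_of_tendsto_of_tendsto' h2 h3 fun n => by
      rw [← inv_mul_inner_limitGradient]
      exact hle (ψ n) d hd
    rw [sum_inner]
    refine le_trans (le_of_eq (Finset.sum_congr rfl fun i _ => ?_)) h4
    rw [real_inner_smul_left]
    ring

end StableMarginFlow


/-! ### From the problem data to stable flows -/

theorem locallyLipschitz_pi {E : Type*} [PseudoMetricSpace E] {m : ℕ} {F : Fin m → E → ℝ}
    (hF : ∀ i, LocallyLipschitz (F i)) : LocallyLipschitz fun x i => F i x := by
  intro x
  choose C s hs hC using fun i => hF i x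
  refine ⟨∑ i, C i, ⋂ i, s i, iInter_mem.2 hs, LipschitzOnWith.of_dist_le_mul fun a ha b hb => ?_⟩
  refine (dist_pi_le_iff (by positivity)).2 fun i => ?_
  refine ((hC i).dist_le_mul a (Set.mem_iInter.1 ha i) b (Set.mem_iInter.1 hb i)).trans
    (mul_le_mul_of_nonneg_right ?_ dist_nonneg)
  exact_mod_cast Finset.single_le_sum (f := C) (fun _ _ => zero_le) (Finset.mem_univ i)

section Loss

variable {X E : Type*} [NormedAddCommGroup E] {m : ℕ} {φ : ℝ → ℝ}
  {f : X → E → ℝ} {x : Fin m → X} {y : Fin m → ℝ}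

theorem locallyLipschitz_trainLoss (hφ : IsLossExponent φ) (hf : ∀ x', LocallyLipschitz (f x')) :
    LocallyLipschitz (trainLoss φ f x y) := by
  have hφ1 : ContDiff ℝ 1 φ := hφ.contDiff.of_le one_le_two
  have h2 : ContDiff ℝ 1 fun w : Fin m → ℝ => ∑ i, Real.exp (-φ (y i * w i)) :=
    ContDiff.sum fun i _ => (hφ1.comp (contDiff_const.mul (contDiff_apply ℝ ℝ i))).neg.exp
  exact h2.locallyLipschitz.comp (locallyLipschitz_pi fun i => hf (x i))

variable [InnerProductSpace ℝ E]

theorem contDiff_trainLoss (hφ : IsLossExponent φ) (hf : ∀ x', ContDiff ℝ 1 (f x')) :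
    ContDiff ℝ 1 (trainLoss φ f x y) := by
  have hφ1 : ContDiff ℝ 1 φ := hφ.contDiff.of_le one_le_two
  exact ContDiff.sum fun i _ => (hφ1.comp (contDiff_const.mul (hf (x i)))).neg.exp

theorem gradient_trainLoss [CompleteSpace E] (hφ : IsLossExponent φ)
    (hf : ∀ x', ContDiff ℝ 1 (f x')) (θ : E) :
    gradient (trainLoss φ f x y) θ = -∑ i, (Real.exp (-φ (y i * f (x i) θ)) *
      deriv φ (y i * f (x i) θ) * y i) • gradient (f (x i)) θ := by
  refine HasGradientAt.gradient (hasGradientAt_iff_hasFDerivAt.2 ?_)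
  have h1 : ∀ i, HasFDerivAt (fun ϑ => Real.exp (-φ (y i * f (x i) ϑ)))
      (Real.exp (-φ (y i * f (x i) θ)) • -(deriv φ (y i * f (x i) θ) •
        (y i • fderiv ℝ (f (x i)) θ))) θ := fun i =>
    (((hφ.differentiable _).hasDerivAt.comp_hasFDerivAt θ
      (((hf (x i)).differentiable one_ne_zero θ).hasFDerivAt.const_mul (y i))).neg).exp
  have h2 := HasFDerivAt.fun_sum (u := Finset.univ) fun i _ => h1 i
  refine h2.congr_fderiv ?_
  ext d
  simp [gradient, Finset.sum_neg_distrib, mul_assoc]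

end Loss

section Flow

variable {K : ℕ} {rows cols : Fin K → ℕ} {q : ℕ} {ηM ηA cM c₁ c₂ L : ℝ} {η : ℝ → ℝ}
  {θ v g : ℝ → Param rows cols q}

/-- Clarke subgradients of a locally Lipschitz function are bounded on the compact trace of the
trajectory, which supplies the local bound on the signal. -/
theorem IsMuonAdamTrajectory.exists_flow {F : Param rows cols q → ℝ}
    (htraj : IsMuonAdamTrajectory F ηM ηA cM c₁ c₂ η θ g) (hF : LocallyLipschitz F)
    (hηM : 0 < ηM) (hηA : 0 < ηA) (hcM : 0 < cM) (hc₂ : 0 < c₂) (hc : c₂ ≤ c₁)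
    (hη : IsAdamSchedule L η) : ∃ v, MuonAdamFlow ηM ηA cM c₁ c₂ η θ v g := by
  obtain ⟨v, harc, hup⟩ := htraj.flow
  refine ⟨v, hηM, hηA, hcM, hc₂, hc, hη.pos, hη.antitone, harc, htraj.measurable, fun T => ?_, hup⟩
  have h1 : ContinuousOn θ (Set.Icc 0 T) := by
    have h2 : IntegrableOn v (Set.uIcc 0 (max T 0)) := by
      rw [Set.uIcc_of_le (le_max_right _ _)]
      exact harc.1.integrableOn_compact_subset (fun r hr => hr.1) isCompact_Icc
    refine ContinuousOn.congr (f := fun t => θ 0 + ∫ s in (0 : ℝ)..t, v s) ?_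
      fun t ht => harc.2 t ht.1
    refine continuousOn_const.add ((intervalIntegral.continuousOn_primitive_interval h2).mono ?_)
    rw [Set.uIcc_of_le (le_max_right _ _)]
    exact Set.Icc_subset_Icc_right (le_max_left _ _)
  obtain ⟨C, hC⟩ := exists_norm_bound_clarkeSubdifferential hF (isCompact_Icc.image_of_continuousOn h1)
  exact ⟨C, fun t ht => hC _ (Set.mem_image_of_mem _ ht) _ (htraj.subgradient t ht.1)⟩

theorem MuonAdamFlow.ae_differentiableAt_comp (hF : MuonAdamFlow ηM ηA cM c₁ c₂ η θ v g)
    {F : Param rows cols q → ℝ} (hL : LocallyLipschitz F) :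
    ∀ᵐ t, 0 < t → DifferentiableAt ℝ (fun s => F (θ s)) t := by
  choose C hC using fun n : ℕ => hF.exists_lipschitzOnWith_comp hL (t := (n : ℝ)) le_rfl
  filter_upwards [ae_all_iff.2 fun n => (hC n).ae_differentiableWithinAt_of_mem] with t ht ht0
  obtain ⟨n, hn⟩ := exists_nat_gt t
  exact (ht n ⟨ht0.le, hn.le⟩).differentiableAt (Icc_mem_nhds ht0 hn)

theorem MuonAdamFlow.ae_hasDerivAt_comp (hF : MuonAdamFlow ηM ηA cM c₁ c₂ η θ v g)
    {F : Param rows cols q → ℝ} (hd : Differentiable ℝ F) :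
    ∀ᵐ t, 0 < t → HasDerivAt (fun s => F (θ s)) (inner ℝ (gradient F (θ t)) (v t)) t := by
  filter_upwards [hF.ae_hasDerivAt] with t ht ht0
  rw [inner_gradient_left]
  exact (hd (θ t)).hasFDerivAt.comp_hasDerivAt t (ht ht0)

/-- Limits of normalized subgradients are subgradients at the limit direction. -/
theorem mem_clarkeSubdifferential_of_tendsto_direction {N : Param rows cols q → ℝ}
    {F : Param rows cols q → ℝ} (hF : LocallyLipschitz F)
    (hhom : ∀ (ϑ : Param rows cols q) (α : ℝ), 0 < α → F (α • ϑ) = α ^ L * F ϑ)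
    {θbar l : Param rows cols q} {h : ℝ → Param rows cols q}
    (hN : ∀ᶠ t in atTop, 0 < N (θ t))
    (hθ : Tendsto (fun t => (N (θ t))⁻¹ • θ t) atTop (𝓝 θbar))
    (hh : ∀ t, 0 ≤ t → h t ∈ clarkeSubdifferential F (θ t))
    (hl : Tendsto (fun t => (N (θ t) ^ (L - 1))⁻¹ • h t) atTop (𝓝 l)) :
    l ∈ clarkeSubdifferential F θbar := by
  refine mem_clarkeSubdifferential_of_tendsto hF hθ ?_ hl
  filter_upwards [hN, eventually_ge_atTop 0] with t h1 h2
  rw [← Real.inv_rpow h1.le]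
  exact smul_mem_clarkeSubdifferential_of_homogeneous hhom (hh t h2) (inv_pos.2 h1)

theorem tendsto_gradient_direction {N : Param rows cols q → ℝ}
    {F : Param rows cols q → ℝ} (hF : ContDiff ℝ 1 F)
    (hhom : ∀ (ϑ : Param rows cols q) (α : ℝ), 0 < α → F (α • ϑ) = α ^ L * F ϑ)
    {θbar : Param rows cols q} (hN : ∀ᶠ t in atTop, 0 < N (θ t))
    (hθ : Tendsto (fun t => (N (θ t))⁻¹ • θ t) atTop (𝓝 θbar)) :
    Tendsto (fun t => (N (θ t) ^ (L - 1))⁻¹ • gradient F (θ t)) atTop (𝓝 (gradient F θbar)) := by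
  have hcont : Continuous (gradient F) :=
    (InnerProductSpace.toDual ℝ _).symm.continuous.comp (hF.continuous_fderiv one_ne_zero)
  refine ((hcont.tendsto θbar).comp hθ).congr' ?_
  filter_upwards [hN] with t h1
  rw [Function.comp_apply, ← Real.inv_rpow h1.le]
  exact (gradient_smul_of_homogeneous hhom (hF.differentiable one_ne_zero _) (inv_pos.2 h1)).gradient

end Flow

/-! ### KKT points -/

theorem inner_le_mul_hybridNorm {K : ℕ} {rows cols : Fin K → ℕ} {q : ℕ} {α r : ℝ} (hα : 0 < α)
    {c : Param rows cols q} (hc : ∀ d, hybridNorm α d ≤ 1 → inner ℝ c d ≤ r)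
    (d : Param rows cols q) : inner ℝ c d ≤ r * hybridNorm α d := by
  rcases (hybridNorm_nonneg α d).eq_or_lt with h0 | h0
  · obtain ⟨C, -, hC⟩ := exists_norm_le_mul_hybridNorm (rows := rows) (cols := cols) (q := q) hα
    have h1 := hC d
    rw [← h0, mul_zero, norm_le_zero_iff] at h1
    rw [← h0, h1, inner_zero_right, mul_zero]
  · have h2 := map_smul_eq_mul (hybridSeminorm hα.le : Seminorm ℝ (Param rows cols q))
      (hybridNorm α d)⁻¹ d
    rw [coe_hybridSeminorm, Real.norm_of_nonneg (inv_nonneg.2 h0.le), inv_mul_cancel₀ h0.ne'] at h2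
    have h3 := hc _ h2.le
    rwa [real_inner_smul_right, inv_mul_le_iff₀ h0, mul_comm] at h3

/-- Rescaling a unit direction with multipliers satisfying the stationarity condition yields a KKT
point. -/
theorem exists_isKKTPoint_of_multipliers {X : Type*} {m K : ℕ} {rows cols : Fin K → ℕ} {q : ℕ}
    {α L γ : ℝ} (hα : 0 < α) (hL : 0 < L) (hγ : 0 < γ) {f : X → Param rows cols q → ℝ}
    {x : Fin m → X} {y : Fin m → ℝ}
    (hhom : ∀ (x' : X) (ϑ : Param rows cols q) (a : ℝ), 0 < a → f x' (a • ϑ) = a ^ L * f x' ϑ)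
    {θbar : Param rows cols q} (hN : hybridNorm α θbar = 1) {l : Fin m → Param rows cols q}
    (hl : ∀ i, l i ∈ clarkeSubdifferential (f (x i)) θbar)
    (hinner : ∀ i, inner ℝ (l i) θbar = L * f (x i) θbar)
    (hmargin : ∀ i, γ ≤ y i * f (x i) θbar) {μ : Fin m → ℝ} (hμ : ∀ i, 0 ≤ μ i)
    (hsum : ∑ i, μ i = 1) (hsupp : ∀ i, μ i ≠ 0 → y i * f (x i) θbar = γ)
    (hdual : ∀ d, hybridNorm α d ≤ 1 → inner ℝ (∑ i, (μ i * y i) • l i) d ≤ L * γ) :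
    ∃ θs, IsKKTPoint (hybridNorm α) f x y θs ∧ θs ≠ 0 ∧ (hybridNorm α θs)⁻¹ • θs = θbar := by
  -- The scale at which the margin becomes exactly 1.
  set a := γ ^ (-(1 / L)) with ha
  have ha0 : 0 < a := Real.rpow_pos_of_pos hγ _
  have haL : a ^ L = γ⁻¹ := by
    rw [ha, ← Real.rpow_mul hγ.le, neg_mul, one_div_mul_cancel hL.ne', Real.rpow_neg_one]
  have hp := (Real.rpow_pos_of_pos ha0 (L - 1))
  have hLγ : 0 < L * γ := mul_pos hL hγ
  have hNa : hybridNorm α (a • θbar) = a := by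
    have h2 := map_smul_eq_mul (hybridSeminorm hα.le : Seminorm ℝ (Param rows cols q)) a θbar
    rwa [coe_hybridSeminorm, hN, mul_one, Real.norm_of_nonneg ha0.le] at h2
  have hout : ∀ i, y i * f (x i) (a • θbar) = γ⁻¹ * (y i * f (x i) θbar) := fun i => by
    rw [hhom _ _ _ ha0, haL]; ring
  -- A norming functional: in the dual unit ball by hypothesis, and equal to 1 at the limit
  -- direction by Euler's identity on the support of `μ`.
  set c : Param rows cols q := (L * γ)⁻¹ • ∑ i, (μ i * y i) • l i with hc
  have hcd : ∀ d, inner ℝ c d ≤ hybridSeminorm hα.le d := fun d => by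
    have h1 := inner_le_mul_hybridNorm hα hdual d
    rw [hc, real_inner_smul_left, coe_hybridSeminorm, inv_mul_le_iff₀ hLγ]
    exact h1
  have hcθ : inner ℝ c (a • θbar) = hybridSeminorm hα.le (a • θbar) := by
    rw [coe_hybridSeminorm, hNa, real_inner_smul_right, hc, real_inner_smul_left, sum_inner]
    have h1 : ∑ i, inner ℝ ((μ i * y i) • l i) θbar = L * γ := by
      rw [← mul_one (L * γ), ← hsum, Finset.mul_sum]
      refine Finset.sum_congr rfl fun i _ => ?_
      rw [real_inner_smul_left, hinner]
      rcases eq_or_ne (μ i) 0 with h0 | h0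
      · simp [h0]
      · rw [← hsupp i h0]; ring
    rw [h1, inv_mul_cancel₀ hLγ.ne', mul_one]
  have hk := smul_mem_clarkeSubdifferential_half_sq (hybridSeminorm hα.le) hcd hcθ
  simp only [coe_hybridSeminorm, hNa] at hk
  -- Subgradients of the model at the scaled point carry a factor a^{L-1}; the multipliers divide it
  -- out so that the sum equals a • c.
  refine ⟨a • θbar, ⟨fun i => ?_, a • c, hk, fun i => μ i * (a / (L * γ * a ^ (L - 1))),
    fun i => mul_nonneg (hμ i) (by positivity), fun i => a ^ (L - 1) • l i,
    fun i => smul_mem_clarkeSubdifferential_of_homogeneous (hhom (x i)) (hl i) ha0, ?_, ?_⟩, ?_, ?_⟩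
  · rw [hout, le_inv_mul_iff₀ hγ, mul_one]
    exact hmargin i
  · rw [sub_eq_zero, hc, smul_smul, Finset.smul_sum]
    refine Finset.sum_congr rfl fun i _ => ?_
    rw [smul_smul, smul_smul]
    congr 1
    field_simp
  · refine Finset.sum_eq_zero fun i _ => ?_
    rcases eq_or_ne (μ i) 0 with h0 | h0
    · simp [h0]
    · rw [hout, hsupp i h0, inv_mul_cancel₀ hγ.ne', sub_self, mul_zero]
  · refine smul_ne_zero ha0.ne' fun h0 => ?_
    rw [h0] at hN
    have h1 := map_zero (hybridSeminorm hα.le : Seminorm ℝ (Param rows cols q))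
    rw [coe_hybridSeminorm, hN] at h1
    exact one_ne_zero h1
  · rw [hNa, inv_smul_smul₀ ha0.ne']

end MuonAdam

/-! ### The main theorem. -/

open MuonAdam

theorem mainTheorem4
    -- data and model
    {d m K q : ℕ} (hm : 0 < m) (rows cols : Fin K → ℕ)
    (x : Fin m → EuclideanSpace ℝ (Fin d)) (y : Fin m → ℝ) (hy : ∀ i, y i = 1 ∨ y i = -1)
    (f : EuclideanSpace ℝ (Fin d) → Param rows cols q → ℝ)
    (φ : ℝ → ℝ) (hφ : IsLossExponent φ)
    -- homogeneity
    (L : ℝ) (hL : 1 ≤ L)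
    (hhom : ∀ (x' : EuclideanSpace ℝ (Fin d)) (ϑ : Param rows cols q) (α : ℝ), 0 < α →
      f x' (α • ϑ) = α ^ L * f x' ϑ)
    -- algorithm
    (ηM ηA cM c₁ c₂ : ℝ) (hηM : 0 < ηM) (hηA : 0 < ηA) (hcM : 0 < cM) (hc₂ : 0 < c₂)
    (hc : c₂ ≤ c₁)
    (η : ℝ → ℝ) (hη : IsAdamSchedule L η)
    (θ g : ℝ → Param rows cols q)
    (htraj : IsMuonAdamTrajectory (trainLoss φ f x y) ηM ηA cM c₁ c₂ η θ g)
    -- smooth model, or non-smooth model with stabilizing subgradients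
    (hmodel : (∀ x', ContDiff ℝ 1 (f x')) ∨
      ((∀ x', LocallyLipschitz (f x') ∧ IsWhitneyC1Stratifiable (f x')) ∧
        ModelSubgradientsConverge (hybridNorm (ηA / ηM)) L φ f x y θ g))
    -- nontrivial trajectory
    (hT1 : ∃ Nmin > 0, ∃ t₀ ≥ 0, ∀ t ≥ t₀, Nmin ≤ hybridNorm (ηA / ηM) (θ t))
    -- directional convergence to a direction of positive margin
    (θbar : Param rows cols q)
    (hT2 : Tendsto (fun t => (hybridNorm (ηA / ηM) (θ t))⁻¹ • θ t) atTop (𝓝 θbar))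
    (hmargin : 0 < margin (hybridNorm (ηA / ηM)) f x y θbar)
    -- gradients bounded away from zero on an initial interval
    (hA1 : ∃ τ > 0, ∃ ρ > 0, ∀ j, ∀ᵐ t ∂(volume.restrict (Set.Icc (0 : ℝ) τ)), ρ < g t j ^ 2) :
    ∃ θs : Param rows cols q, IsKKTPoint (hybridNorm (ηA / ηM)) f x y θs ∧
      θs ≠ 0 ∧ (hybridNorm (ηA / ηM) θs)⁻¹ • θs = θbar := by
  have hα : 0 < ηA / ηM := div_pos hηA hηM
  have hne : Nonempty (Fin m) := ⟨⟨0, hm⟩⟩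
  have hN : ∀ᶠ t in atTop, 0 < hybridNorm (ηA / ηM) (θ t) := by
    obtain ⟨r, hr, t₀, -, h⟩ := hT1
    exact eventually_atTop.2 ⟨t₀, fun t ht => hr.trans_le (h t ht)⟩
  have hNbar := hybridNorm_eq_one_of_tendsto hα.le hN hT2
  have hLip : ∀ x', LocallyLipschitz (f x') := fun x' =>
    hmodel.elim (fun h => (h x').locallyLipschitz) fun h => (h.1 x').1
  obtain ⟨v, hflow⟩ := htraj.exists_flow (locallyLipschitz_trainLoss hφ hLip) hηM hηA hcM hc₂ hc hη
  obtain ⟨h, l, hh, hg, hl, hchain⟩ : ∃ (h : Fin m → ℝ → Param rows cols q)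
      (l : Fin m → Param rows cols q),
      (∀ i t, 0 ≤ t → h i t ∈ clarkeSubdifferential (f (x i)) (θ t)) ∧
      (∀ t, 0 ≤ t → g t = -∑ i, (Real.exp (-φ (y i * f (x i) (θ t))) *
        deriv φ (y i * f (x i) (θ t)) * y i) • h i t) ∧
      (∀ i, Tendsto (fun t => (hybridNorm (ηA / ηM) (θ t) ^ (L - 1))⁻¹ • h i t) atTop (𝓝 (l i))) ∧
      ∀ i, ∀ᵐ t, 0 < t → HasDerivAt (fun s => f (x i) (θ s)) (inner ℝ (h i t) (v t)) t := by
    -- For smooth models the subgradients are gradients, whose normalized convergence follows from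
    -- homogeneity and directional convergence. For stratifiable models convergence is assumed, and
    -- only the chain rule needs the stratification.
    rcases hmodel with hC1 | ⟨hW, h, hh, hg, hl⟩
    · refine ⟨fun i t => gradient (f (x i)) (θ t), fun i => gradient (f (x i)) θbar,
        fun i t _ => ?_, fun t ht => ?_, fun i => ?_, fun i => ?_⟩
      · rw [clarkeSubdifferential_of_contDiff (hC1 _)]
        rfl
      · have h1 := htraj.subgradient t ht
        rw [clarkeSubdifferential_of_contDiff (contDiff_trainLoss hφ hC1)] at h1
        rw [Set.mem_singleton_iff.1 h1, gradient_trainLoss hφ hC1]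
      · exact tendsto_gradient_direction (hC1 _) (hhom (x i)) hN hT2
      · exact hflow.ae_hasDerivAt_comp ((hC1 _).differentiable one_ne_zero)
    · choose l hl using hl
      exact ⟨h, l, hh, hg, hl, fun i =>
        ae_hasDerivAt_of_isWhitneyC1Stratifiable (A := Set.Ioi 0) (hLip _).continuous (hW _).2
          hflow.ae_hasDerivAt (hflow.ae_differentiableAt_comp (hLip _))
          fun t ht => hh i t (Set.mem_Ioi.1 ht).le⟩
  have hmem : ∀ i, l i ∈ clarkeSubdifferential (f (x i)) θbar := fun i =>
    mem_clarkeSubdifferential_of_tendsto_direction (hLip _) (hhom (x i)) hN hT2 (hh i) (hl i)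
  have hinner : ∀ i, inner ℝ (l i) θbar = L * f (x i) θbar := fun i =>
    inner_clarkeSubdifferential_of_homogeneous (hLip _).continuous (hhom (x i)) (hmem i)
  obtain ⟨γ, hγ⟩ : ∃ γ, γ = margin (hybridNorm (ηA / ηM)) f x y θbar := ⟨_, rfl⟩
  -- The limit direction has norm 1, so the normalization inside the margin is trivial.
  have hγ' : γ = ⨅ i, y i * f (x i) θbar := by
    rw [hγ, margin, hNbar, inv_one, one_smul]
  have hγ0 : 0 < γ := hγ ▸ hmargin
  have hle : ∀ i, γ ≤ y i * f (x i) θbar := fun i => hγ' ▸ ciInf_le (Set.finite_range _).bddBelow i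
  have hS : StableMarginFlow ηM ηA cM c₁ c₂ η θ v g L φ (fun i => f (x i)) y h l θbar γ :=
    { flow := hflow
      abs_y := fun i => by rcases hy i with h1 | h1 <;> simp [h1]
      lossExponent := hφ
      one_le := hL
      homogeneous := fun i => hhom (x i)
      locallyLipschitz := fun i => hLip (x i)
      chain_rule := hchain
      gradient_eq := hg
      tendsto_subgradient := hl
      inner_limit := hinner
      integral_diverges := hη.integral_diverges
      decay := hη.decay
      norm_bounded_below := hT1
      tendsto_direction := hT2
      γ_pos := hγ0
      γ_le := hle
      γ_attained := by
        obtain ⟨i, hi⟩ := exists_eq_ciInf_of_finite (f := fun i => y i * f (x i) θbar)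
        exact ⟨i, hγ'.trans hi.symm⟩
      initial_gradient := hA1 }
  obtain ⟨μ, hμ, hsum, hsupp, hdual⟩ := hS.exists_multipliers
  exact exists_isKKTPoint_of_multipliers hα (zero_lt_one.trans_le hL) hγ0 hhom hNbar hmem hinner hle
    hμ hsum hsupp hdual
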